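/- Let $\Theta\subset\mathbb{R}^q$ and let $\{f_\theta,\ \theta\in\Theta\}$ be probability densities on $\mathbb{R}^d$, $d\ge 1$. Let $\xi_1,\xi_2,\ldots$ be i.i.d. with density $g=f_{\theta_0}$. Assume A2: $\theta_0$ is an interior point of $\Theta$, and on an open neighbourhood $\Theta_0\subset\Theta$ of $\theta_0$ the function $f_\theta(x)$ has first and second order partial derivatives with respect to the components of $\theta$ such that $f_\theta(x)$ and these derivatives are continuous in $(\theta,x)\in\Theta_0\times\mathbb{R}^d$. Let $K\subset\mathbb{R}^d$ be compact with $g>0$ on $K$. Let $h$ be one of $$h_1(x)=\ln x-x+1,\quad h_2(x)=(1-x)\ln x,\quad h_5(x)=\operatorname{sgn}(1-\alpha)(x^\alpha-\alpha x+\alpha-1)\ \text{ with }\alpha\in(0,1)\cup(1,2].$$ Notation. $|\cdot|$ is the Euclidean norm, $R_n(i)=\min_{j\ne i,\,j\le n}|\xi_i-\xi_j|$, $B_n(\xi_i)$ is the closed ball with centre $\xi_i$ and radius $R_n(i)$, $P_\theta(B)=\int_B f_\theta(y)\,dy$, $z_{i,n}(\theta)=nP_\theta(B_n(\xi_i))$,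 $$\psi_n(\xi_i,\theta)=h'(z_{i,n}(\theta))\,z_{i,n}(\theta)\,\frac{1}{P_\theta(B_n(\xi_i))}\int_{B_n(\xi_i)}\nabla_\theta f_\theta(y)\,dy,$$ $\psi_n(\xi_i,\theta,K)=\psi_n(\xi_i,\theta)I_K(\xi_i)$ and $\lambda_n(\theta,K)=E[\psi_n(\xi_i,\theta,K)]$. Let $\Theta_n=\{\theta:|\theta-\theta_0|\le\alpha_n\}$ with $0<\alpha_n\to0$, and let $\theta_0^{(n)}\in\Theta_n$ (for example the maximizer of $E[h(z_{i,n}(\theta))]$). Let $A$ be an event on which, for every $i$, $R_n(i)\to0$ uniformly as $n\to\infty$. Put $$H_n(\xi_i,K)=q\Big[\sup_{\theta\in\Theta_n}|h''(z_{i,n}(\theta))z_{i,n}^2(\theta)|\,\big(f^{(1)}_{\max}(\xi_i)\big)^2+\sup_{\theta\in\Theta_n}|h'(z_{i,n}(\theta))z_{i,n}(\theta)|\,f^{(2)}_{\max}(\xi_i)\Big]I_A I_K(\xi_i),$$ $$f^{(1)}_{\max}(\xi_i)=\max_l\sup_{\theta\in\Theta_n}\frac{\int_{B_n(\xi_i)}|\partial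 f_\theta(y)/\partial\theta_l|\,dy}{P_\theta(B_n(\xi_i))},\qquad f^{(2)}_{\max}(\xi_i)=\max_{j,l}\sup_{\theta\in\Theta_n}\frac{\int_{B_n(\xi_i)}|\partial^2 f_\theta(y)/\partial\theta_j\partial\theta_l|\,dy}{P_\theta(B_n(\xi_i))}.$$ (1) There are finite constants $b_1,b_2$ and $m(\delta)$, $\delta>0$, which do not depend on $(\alpha_n)$, $(\theta_0^{(n)})$, $A$, $i$ or $n$, such that for every $i$ and all sufficiently large $n$: (a) $|\psi_n(\xi_i,\theta_s,K)-\psi_n(\xi_i,\theta_t,K)|I_A\le H_n(\xi_i,K)|\theta_s-\theta_t|$ for all $\theta_s,\theta_t\in\Theta_n$; (b) $H_n(\xi_i,K)$ is a random variable with $E[H_n(\xi_i,K)]<b_1$ and $E[H_n^2(\xi_i,K)]<b_2$; (c) (bracketing condition) for all $\delta,r>0$ the family $[\psi_n(\xi_i,\theta,K)-\psi_n(\xi_i,\theta_0^{(n)},K)]I_A$, $\theta\in\Theta_n$, $|\theta-\theta_0^{(n)}|\le r$, is covered, up to a null event, by at most $m(\delta)$ coordinatewise brackets whose end points are square integrable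 and the norm of whose width has expectation at most $\delta r$. (2) If moreover $\sup_{\theta\in\Theta_n}E|\psi_n(\xi_1,\theta,K)|<\infty$ for all sufficiently large $n$ (so that $\lambda_n(\cdot,K)$ is defined and bounded on $\Theta_n$), then $$\sup_{\theta\in\Theta_n}\frac{\left|\frac1{\sqrt n}\sum_{i=1}^n\big(\psi_n(\xi_i,\theta,K)-\psi_n(\xi_i,\theta_0^{(n)},K)\big)-\sqrt n\big(\lambda_n(\theta,K)-\lambda_n(\theta_0^{(n)},K)\big)\right|}{1+\sqrt n\,|\theta-\theta_0^{(n)}|}\ \stackrel{p}{\longrightarrow}\ 0 .$$ -/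

import Mathlib

open MeasureTheory ProbabilityTheory Filter Topology Set
open scoped ENNReal

namespace GMSP

noncomputable section

/-- `ℝ^k` with the Euclidean norm. -/
abbrev E (k : ℕ) : Type := EuclideanSpace ℝ (Fin k)

/-! ### The information-type functions -/

/-- `h₁(x) = ln x - x + 1`. -/
def h₁ (x : ℝ) : ℝ := Real.log x - x + 1

/-- `h₂(x) = (1 - x) ln x`. -/
def h₂ (x : ℝ) : ℝ := (1 - x) * Real.log x

/-- `h₅(x) = sgn(1 - α) (x^α - α x + α - 1)`. -/
def h₅ (a x : ℝ) : ℝ := Real.sign (1 - a) * (x ^ a - a * x + a - 1)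

/-- `h` is `h₁`, or `h₂`, or `h₅` with `α ∈ (0,1) ∪ (1,2]`. -/
def IsDivergence (h : ℝ → ℝ) : Prop :=
  h = h₁ ∨ h = h₂ ∨ ∃ a ∈ Ioo (0 : ℝ) 1 ∪ Ioc (1 : ℝ) 2, h = h₅ a

/-! ### The model -/

/-- `{f θ, θ ∈ Θ}` is a family of probability densities on `ℝ^d`. -/
structure IsDensityFamily {q d : ℕ} (Θ : Set (E q)) (f : E q → E d → ℝ) : Prop where
  measurable : ∀ θ ∈ Θ, Measurable (f θ)
  nonneg : ∀ θ ∈ Θ, ∀ x, 0 ≤ f θ x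
  lintegral_eq_one : ∀ θ ∈ Θ, ∫⁻ x, ENNReal.ofReal (f θ x) = 1

/-- The partial derivative `∂ f_θ(x) / ∂ θ_j`. -/
def pd {q d : ℕ} (f : E q → E d → ℝ) (j : Fin q) (θ : E q) (x : E d) : ℝ :=
  lineDeriv ℝ (fun t => f t x) θ (EuclideanSpace.single j 1)

/-- `θ₀` is an interior point of `Θ`, and `f_θ(x)` has first and second order partial derivatives
in `θ` which, like `f_θ(x)` itself, are continuous in `(θ, x) ∈ Θ₀ × ℝ^d`, where `Θ₀ ⊆ Θ` is an
(open) neighbourhood of `θ₀`. -/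
structure AssumptionA2 {q d : ℕ} (Θ Θ₀ : Set (E q)) (θ₀ : E q) (f : E q → E d → ℝ) : Prop where
  mem_interior : θ₀ ∈ interior Θ
  isOpen : IsOpen Θ₀
  mem : θ₀ ∈ Θ₀
  subset : Θ₀ ⊆ Θ
  contDiffOn : ∀ x, ContDiffOn ℝ 2 (fun θ => f θ x) Θ₀
  continuousOn : ContinuousOn (fun p : E q × E d => f p.1 p.2) (Θ₀ ×ˢ univ)
  continuousOn_pd : ∀ j, ContinuousOn (fun p : E q × E d => pd f j p.1 p.2) (Θ₀ ×ˢ univ)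
  continuousOn_pd_pd : ∀ j l,
    ContinuousOn (fun p : E q × E d => pd (pd f l) j p.1 p.2) (Θ₀ ×ˢ univ)

/-- `ξ 0, ξ 1, …` are independent random vectors, each with density `g` with respect to
Lebesgue measure. -/
structure IsIIDSample {Ω : Type*} [MeasurableSpace Ω] {d : ℕ} (P : Measure Ω)
    (ξ : ℕ → Ω → E d) (g : E d → ℝ) : Prop where
  measurable : ∀ i, Measurable (ξ i)
  indep : iIndepFun ξ P
  law : ∀ i, P.map (ξ i) = (volume : Measure (E d)).withDensity fun x => ENNReal.ofReal (g x)

/-! ### Nearest neighbour balls and the score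

The sample of size `n` consists of `ξ 0, …, ξ (n - 1)`. -/

section Score

variable {Ω : Type*} {q d : ℕ}

/-- The nearest neighbour distance `R_n(i)`. -/
def nnDist (ξ : ℕ → Ω → E d) (n i : ℕ) (ω : Ω) : ℝ :=
  ⨅ j : {j : ℕ // j < n ∧ j ≠ i}, dist (ξ i ω) (ξ j ω)

/-- The nearest neighbour ball `B_n(ξ_i)`. -/
def nnBall (ξ : ℕ → Ω → E d) (n i : ℕ) (ω : Ω) : Set (E d) :=
  Metric.closedBall (ξ i ω) (nnDist ξ n i ω)

/-- `P_θ(B)`. -/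
def modelProb (f : E q → E d → ℝ) (θ : E q) (B : Set (E d)) : ℝ := ∫ y in B, f θ y

/-- `z_{i,n}(θ) = n P_θ(B_n(ξ_i))`. -/
def zStat (f : E q → E d → ℝ) (ξ : ℕ → Ω → E d) (n i : ℕ) (θ : E q) (ω : Ω) : ℝ :=
  n * modelProb f θ (nnBall ξ n i ω)

/-- `ψ_n(ξ_i, θ)`, the vector with components
`h'(z_{i,n}(θ)) z_{i,n}(θ) P_θ(B_n(ξ_i))⁻¹ ∫_{B_n(ξ_i)} ∂f_θ(y)/∂θ_j dy`. -/
def psi (h : ℝ → ℝ) (f : E q → E d → ℝ) (ξ : ℕ → Ω → E d) (n i : ℕ) (θ : E q) (ω : Ω) : E q :=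
  WithLp.toLp 2 fun j =>
    deriv h (zStat f ξ n i θ ω) * zStat f ξ n i θ ω *
      ((1 / modelProb f θ (nnBall ξ n i ω)) * ∫ y in nnBall ξ n i ω, pd f j θ y)

/-- `ψ_n(ξ_i, θ, K) = ψ_n(ξ_i, θ) I_K(ξ_i)`. -/
def psiOn (h : ℝ → ℝ) (f : E q → E d → ℝ) (ξ : ℕ → Ω → E d) (K : Set (E d)) (n i : ℕ)
    (θ : E q) : Ω → E q :=
  (ξ i ⁻¹' K).indicator (psi h f ξ n i θ)

/-- `λ_n(θ, K) = E ψ_n(ξ_i, θ, K)`; the value is the same for all `i < n`. -/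
def lambdaOn [MeasurableSpace Ω] (P : Measure Ω) (h : ℝ → ℝ) (f : E q → E d → ℝ)
    (ξ : ℕ → Ω → E d) (K : Set (E d)) (n : ℕ) (θ : E q) : E q :=
  ∫ ω, psiOn h f ξ K n 0 θ ω ∂P

/-- The elements `[ψ_n(ξ_i, θ, K) - ψ_n(ξ_i, c, K)] I_A` of the family `F_n`
(with `c` in the role of `θ_0^{(n)}`). -/
def scoreDiff (h : ℝ → ℝ) (f : E q → E d → ℝ) (ξ : ℕ → Ω → E d) (K : Set (E d)) (A : Set Ω)
    (n i : ℕ) (c θ : E q) : Ω → E q :=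
  A.indicator fun ω => psiOn h f ξ K n i θ ω - psiOn h f ξ K n i c ω

/-! ### The envelope -/

/-- `sup_{θ ∈ T} P_θ(B_n(ξ_i))⁻¹ ∫_{B_n(ξ_i)} |u_θ(y)| dy`. -/
def supAverage (f u : E q → E d → ℝ) (ξ : ℕ → Ω → E d) (T : Set (E q)) (n i : ℕ) (ω : Ω) :
    ℝ≥0∞ :=
  ⨆ θ ∈ T, (∫⁻ y in nnBall ξ n i ω, ‖u θ y‖ₑ) / ENNReal.ofReal (modelProb f θ (nnBall ξ n i ω))

/-- `f_max^{(1)}(ξ_i)`. -/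
def fmax₁ (f : E q → E d → ℝ) (ξ : ℕ → Ω → E d) (T : Set (E q)) (n i : ℕ) (ω : Ω) : ℝ≥0∞ :=
  ⨆ l : Fin q, supAverage f (pd f l) ξ T n i ω

/-- `f_max^{(2)}(ξ_i)`. -/
def fmax₂ (f : E q → E d → ℝ) (ξ : ℕ → Ω → E d) (T : Set (E q)) (n i : ℕ) (ω : Ω) : ℝ≥0∞ :=
  ⨆ j : Fin q, ⨆ l : Fin q, supAverage f (pd (pd f l) j) ξ T n i ω

/-- The envelope `H_n(ξ_i, K)`, with `T` in the role of `Θ_n`; suprema are taken in `[0, ∞]`. -/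
def envelope (h : ℝ → ℝ) (f : E q → E d → ℝ) (ξ : ℕ → Ω → E d) (K : Set (E d)) (A : Set Ω)
    (T : Set (E q)) (n i : ℕ) : Ω → ℝ≥0∞ :=
  (A ∩ ξ i ⁻¹' K).indicator fun ω =>
    (q : ℝ≥0∞) *
      ((⨆ θ ∈ T, ‖deriv (deriv h) (zStat f ξ n i θ ω) * zStat f ξ n i θ ω ^ 2‖ₑ) *
          fmax₁ f ξ T n i ω ^ 2 +
        (⨆ θ ∈ T, ‖deriv h (zStat f ξ n i θ ω) * zStat f ξ n i θ ω‖ₑ) * fmax₂ f ξ T n i ω)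

/-- The random variable
`sup_{θ ∈ T} |n^{-1/2} ∑_{i<n} (ψ_n(ξ_i,θ,K) - ψ_n(ξ_i,c,K)) - √n (λ_n(θ,K) - λ_n(c,K))| /
(1 + √n |θ - c|)`, the supremum being taken in `[0, ∞]`. -/
def supRatio [MeasurableSpace Ω] (P : Measure Ω) (h : ℝ → ℝ) (f : E q → E d → ℝ)
    (ξ : ℕ → Ω → E d) (K : Set (E d)) (T : Set (E q)) (c : E q) (n : ℕ) (ω : Ω) : ℝ≥0∞ :=
  ⨆ θ ∈ T, ENNReal.ofReal
    (‖(1 / √(n : ℝ)) • ∑ i ∈ Finset.range n, (psiOn h f ξ K n i θ ω - psiOn h f ξ K n i c ω) -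
        √(n : ℝ) • (lambdaOn P h f ξ K n θ - lambdaOn P h f ξ K n c)‖ /
      (1 + √(n : ℝ) * ‖θ - c‖))

end Score

/-- The family `{D θ : θ ∈ T}` of random vectors can be covered by `m` (coordinatewise) brackets
`[lo k, hi k]` with square integrable end points and mean width at most `w`. -/
def HasBrackets {Ω : Type*} [MeasurableSpace Ω] {q : ℕ} (P : Measure Ω) (T : Set (E q))
    (D : E q → Ω → E q) (m : ℕ) (w : ℝ) : Prop :=
  ∃ (U : Fin m → Set (E q)) (lo hi : Fin m → Ω → E q), T ⊆ ⋃ k, U k ∧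
    ∀ k, MemLp (lo k) 2 P ∧ MemLp (hi k) 2 P ∧ ∫ ω, ‖hi k ω - lo k ω‖ ∂P ≤ w ∧
      ∀ᵐ ω ∂P, ∀ θ ∈ T ∩ U k, ∀ j, lo k ω j ≤ D θ ω j ∧ D θ ω j ≤ hi k ω j

/-- `Θ_n = {θ : |θ - θ₀| ≤ α_n}` with `0 < α_n → 0`, and `c n ∈ Θ_n` for every `n`. -/
structure IsShrinking {q : ℕ} (θ₀ : E q) (α : ℕ → ℝ) (c : ℕ → E q) : Prop where
  pos : ∀ n, 0 < α n
  tendsto : Tendsto α atTop (𝓝 0)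
  mem : ∀ n, c n ∈ Metric.closedBall θ₀ (α n)

/-- `A` is an event on which `R_n(i) → 0` uniformly as `n → ∞`, for every `i`. -/
structure IsUniformEvent {Ω : Type*} [MeasurableSpace Ω] {d : ℕ} (ξ : ℕ → Ω → E d)
    (A : Set Ω) : Prop where
  measurableSet : MeasurableSet A
  tendsto : ∀ i, TendstoUniformlyOn (fun n ω => nnDist ξ n i ω) (fun _ => 0) atTop A

end

end GMSP

open GMSP

/-! Since `z / P_θ(B) = n`, the score of a ball `B` is `h'(nP_θ(B)) n ∫_B ∂f`. Its Jacobian combines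
`h''(z) z²` and `h'(z) z` with the ratios `∫_B ∂f / P_θ(B)` and `∫_B ∂²f / P_θ(B)`. Uniformly for `x
∈ K`, small balls around `x` and `θ` near `θ₀`, these ratios are close to `∂f/f` and `∂²f/f` at
`(θ₀, x)`, and `P_θ(B) / P_{θ₀}(B)` is close to `1`. For each `h` considered, `h'(z) z` and `h''(z)
z²` grow at most quadratically and change little, relative to `1 + z²`, when `z` is multiplied by a
factor near `1` (`Admissible`). With `Z = n P_{θ₀}(B_n(ξ_i))`, the Jacobian is therefore within `ε
(1 + Z²)` of a matrix `limJac` which depends on `ξ_i` and `Z` but not on `θ` (`exists_scoreRegime`).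

Given `ξ_i = x`, the probability content of the ball around `x` reaching to another sample point is
uniformly distributed. Hence `Z` is independent of `ξ_i`, with tail `(1 - s/n)^(n-1) ≤ exp(-s/2)`,
and its fourth moments are bounded uniformly in `n` and `i` (`lintegral_nnZ_pow_four_le`). With the
mean value inequality this yields the Lipschitz bound and the moments of the envelope; the brackets
come from a rescaled finite cover of the unit ball (`hasBrackets_of_lipschitz`).

The convergence does not use the brackets. On small balls the score difference is, up to a small
error, linear in `θ - c` (`scoreLin`), so the supremum over `θ` reduces to finitely many laws of
large numbers for `a(ξ_i) φ(Z_i)`. These hold (`nnLaw_of_admissible`) because small balls around two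
distinct points are disjoint, so the events `Z_i > s` and `Z_j > s` decouple in the limit; this
settles indicators `φ`, and step functions lead on to admissible `φ`.

Large balls remain: there the derivatives of `f` are not controlled, and integrability of the score
is only a hypothesis. Exchanging the nearest neighbour with a point of fixed index compares sample
size `n` with a fixed size `N`, at the price of polynomial factors, while the other `n - N` points
must all be far away, which costs `p^(n-N)` with `p < 1` (`lintegral_lt_nnDist_le`,
`exists_norm_ballPsi_le`). This contribution is not proportional to `|θ - c|`; the `1` in the
denominator absorbs it. -/

namespace GMSP

/-! ### Admissible functions and the divergences. -/

/-- Continuous functions on `[0, ∞)` of at most quadratic growth which vary little, relative to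
`1 + z²`, under multiplication of the argument by a factor close to `1`. -/
structure Admissible (φ : ℝ → ℝ) : Prop where
  cont : ContinuousOn φ (Ici 0)
  growth : ∃ C, 0 ≤ C ∧ ∀ z, 0 ≤ z → |φ z| ≤ C * (1 + z ^ 2)
  scaling : ∀ ε > 0, ∀ᶠ t in 𝓝 (1 : ℝ), ∀ z, 0 ≤ z → |φ (t * z) - φ z| ≤ ε * (1 + z ^ 2)

namespace Admissible

theorem const (c : ℝ) : Admissible fun _ => c where
  cont := continuousOn_const
  growth := ⟨|c|, abs_nonneg _, fun z _ => by nlinarith [abs_nonneg c, sq_nonneg z]⟩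
  scaling ε hε := Eventually.of_forall fun t z _ => by simp; positivity

theorem add {φ χ : ℝ → ℝ} (h₁ : Admissible φ) (h₂ : Admissible χ) :
    Admissible fun z => φ z + χ z where
  cont := h₁.cont.add h₂.cont
  growth := by
    obtain ⟨C, hC, h⟩ := h₁.growth
    obtain ⟨D, hD, h'⟩ := h₂.growth
    refine ⟨C + D, by positivity, fun z hz => ?_⟩
    linarith [abs_add_le (φ z) (χ z), h z hz, h' z hz]
  scaling ε hε := by
    filter_upwards [h₁.scaling (ε / 2) (by positivity), h₂.scaling (ε / 2) (by positivity)]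
      with t h h' z hz
    have := abs_add_le (φ (t * z) - φ z) (χ (t * z) - χ z)
    rw [show φ (t * z) + χ (t * z) - (φ z + χ z) = φ (t * z) - φ z + (χ (t * z) - χ z) by ring]
    linarith [h z hz, h' z hz]

theorem const_mul {φ : ℝ → ℝ} (h₁ : Admissible φ) (c : ℝ) : Admissible fun z => c * φ z where
  cont := continuousOn_const.mul h₁.cont
  growth := by
    obtain ⟨C, hC, h⟩ := h₁.growth
    refine ⟨|c| * C, by positivity, fun z hz => ?_⟩
    rw [abs_mul, mul_assoc]
    exact mul_le_mul_of_nonneg_left (h z hz) (abs_nonneg c)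
  scaling ε hε := by
    filter_upwards [h₁.scaling (ε / (|c| + 1)) (by positivity)] with t h z hz
    rw [← mul_sub, abs_mul]
    calc |c| * |φ (t * z) - φ z| ≤ (|c| + 1) * (ε / (|c| + 1) * (1 + z ^ 2)) := by
          gcongr
          · linarith
          · exact h z hz
      _ = ε * (1 + z ^ 2) := by field_simp

/-- As `(tz)^a - z^a = (t^a - 1) z^a`, scaling is continuity of `t^a` at `1`. The condition `a ≤ 2`
keeps the growth quadratic. -/
theorem rpow {a : ℝ} (ha : 0 < a) (ha' : a ≤ 2) : Admissible fun z => z ^ a := by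
  have key : ∀ z : ℝ, 0 ≤ z → z ^ a ≤ 1 + z ^ 2 := fun z hz => by
    rcases le_total z 1 with h | h
    · nlinarith [Real.rpow_le_one hz h ha.le, sq_nonneg z]
    · have := Real.rpow_le_rpow_of_exponent_le h ha'
      rw [Real.rpow_two] at this
      linarith
  refine ⟨(Real.continuous_rpow_const ha.le).continuousOn, ⟨1, zero_le_one, fun z hz => ?_⟩,
    fun ε hε => ?_⟩
  · rw [abs_of_nonneg (Real.rpow_nonneg hz a), one_mul]
    exact key z hz
  · have hc : Tendsto (fun t : ℝ => t ^ a) (𝓝 1) (𝓝 1) := by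
      have := (Real.continuous_rpow_const ha.le).tendsto (1 : ℝ)
      rwa [Real.one_rpow] at this
    filter_upwards [Metric.tendsto_nhds.1 hc ε hε, lt_mem_nhds (zero_lt_one : (0 : ℝ) < 1)]
      with t ht ht0 z hz
    rw [Real.mul_rpow ht0.le hz, show t ^ a * z ^ a - z ^ a = (t ^ a - 1) * z ^ a by ring, abs_mul,
      abs_of_nonneg (Real.rpow_nonneg hz a)]
    rw [Real.dist_eq] at ht
    exact mul_le_mul ht.le (key z hz) (Real.rpow_nonneg hz a) hε.le

theorem id : Admissible fun z => z := by
  simpa using rpow zero_lt_one one_le_two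

/-- Scaling rests on `tz log(tz) - z log z = (t log t) z + (t - 1) z log z`, whose two coefficients
vanish at `t = 1`. -/
theorem mul_log : Admissible fun z => z * Real.log z := by
  have key : ∀ z : ℝ, 0 ≤ z → |z * Real.log z| ≤ 1 + z ^ 2 := fun z hz => by
    rcases hz.eq_or_lt with rfl | hz
    · simp
    rcases le_total z 1 with h | h
    · have := Real.abs_log_mul_self_lt z hz h
      rw [mul_comm]
      nlinarith [sq_nonneg z]
    · rw [abs_of_nonneg (mul_nonneg hz.le (Real.log_nonneg h))]
      nlinarith [Real.log_le_sub_one_of_pos hz]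
  refine ⟨Real.continuous_mul_log.continuousOn, ⟨1, zero_le_one, fun z hz => ?_⟩, fun ε hε => ?_⟩
  · rw [one_mul]
    exact key z hz
  · have hc : Tendsto (fun t : ℝ => t * Real.log t) (𝓝 1) (𝓝 0) := by
      have := Real.continuous_mul_log.tendsto (1 : ℝ)
      simpa using this
    have hd : Tendsto (fun t : ℝ => t) (𝓝 1) (𝓝 1) := tendsto_id
    filter_upwards [Metric.tendsto_nhds.1 hc (ε / 2) (by positivity),
      Metric.tendsto_nhds.1 hd (ε / 2) (by positivity),
      lt_mem_nhds (zero_lt_one : (0 : ℝ) < 1)] with t ht ht1 ht0 z hz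
    rcases hz.eq_or_lt with rfl | hz
    · simp; positivity
    rw [Real.log_mul ht0.ne' hz.ne',
      show t * z * (Real.log t + Real.log z) - z * Real.log z =
        t * Real.log t * z + (t - 1) * (z * Real.log z) by ring]
    refine (abs_add_le _ _).trans ?_
    rw [abs_mul, abs_mul (t - 1), abs_of_pos hz]
    rw [Real.dist_eq] at ht1
    rw [Real.dist_eq, sub_zero] at ht
    have hz2 : z ≤ 1 + z ^ 2 := by nlinarith [sq_nonneg (z - 1)]
    have e1 := mul_le_mul ht.le hz2 hz.le (by positivity)
    have e2 := mul_le_mul ht1.le (key z hz.le) (abs_nonneg _) (by positivity)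
    linarith

end Admissible

/-- The properties of `h` which are used: `h'(z) z` and `h''(z) z²` extend to admissible functions,
and `h'(z) z` is bounded away from zero for `z ≥ 2`. -/
structure IsRegularDivergence (h φ₁ φ₂ : ℝ → ℝ) : Prop where
  adm₁ : Admissible φ₁
  adm₂ : Admissible φ₂
  differentiableAt : ∀ z, 0 < z → DifferentiableAt ℝ (deriv h) z
  deriv_mul : ∀ z, 0 < z → deriv h z * z = φ₁ z
  deriv_deriv_mul : ∀ z, 0 < z → deriv (deriv h) z * z ^ 2 = φ₂ z
  away : ∃ c > 0, ∀ z, 2 ≤ z → c ≤ |φ₁ z|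

theorem isRegularDivergence_of_hasDerivAt {h k φ₁ φ₂ k' : ℝ → ℝ} (adm₁ : Admissible φ₁)
    (adm₂ : Admissible φ₂) (hk : ∀ z, 0 < z → HasDerivAt h (k z) z)
    (hk' : ∀ z, 0 < z → HasDerivAt k (k' z) z) (e₁ : ∀ z, 0 < z → k z * z = φ₁ z)
    (e₂ : ∀ z, 0 < z → k' z * z ^ 2 = φ₂ z) (away : ∃ c > 0, ∀ z, 2 ≤ z → c ≤ |φ₁ z|) :
    IsRegularDivergence h φ₁ φ₂ := by
  have hd : ∀ z, 0 < z → HasDerivAt (deriv h) (k' z) z := fun z hz =>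
    (hk' z hz).congr_of_eventuallyEq (by
      filter_upwards [lt_mem_nhds hz] with x hx using (hk x hx).deriv)
  exact ⟨adm₁, adm₂, fun z hz => (hd z hz).differentiableAt,
    fun z hz => by rw [(hk z hz).deriv, e₁ z hz], fun z hz => by rw [(hd z hz).deriv, e₂ z hz],
    away⟩

theorem isRegularDivergence_h₁ : IsRegularDivergence h₁ (fun z => 1 + -1 * z) fun _ => -1 := by
  refine isRegularDivergence_of_hasDerivAt (k := fun x => x⁻¹ - 1) (k' := fun x => -(x ^ 2)⁻¹)
    ((Admissible.const 1).add (Admissible.id.const_mul _)) (Admissible.const _)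
    (fun z hz => ?_) (fun z hz => ?_) (fun z hz => ?_) (fun z hz => ?_) ⟨1, one_pos, fun z hz => ?_⟩
  · exact ((Real.hasDerivAt_log hz.ne').sub (hasDerivAt_id z)).add_const 1
  · exact (hasDerivAt_inv hz.ne').sub_const 1
  · field_simp; ring
  · field_simp
  · rw [abs_of_nonpos (by linarith)]; linarith

theorem isRegularDivergence_h₂ :
    IsRegularDivergence h₂ (fun z => -1 * (z * Real.log z) + (1 + -1 * z))
      fun z => -1 + -1 * z := by
  refine isRegularDivergence_of_hasDerivAt (k := fun x => -Real.log x + (x⁻¹ - 1))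
    (k' := fun x => -x⁻¹ + -(x ^ 2)⁻¹)
    ((Admissible.mul_log.const_mul _).add ((Admissible.const 1).add (Admissible.id.const_mul _)))
    ((Admissible.const _).add (Admissible.id.const_mul _))
    (fun z hz => ?_) (fun z hz => ?_) (fun z hz => ?_) (fun z hz => ?_) ⟨1, one_pos, fun z hz => ?_⟩
  · refine (((hasDerivAt_id z).const_sub 1).mul (Real.hasDerivAt_log hz.ne')).congr_deriv ?_
    simp only [id]
    field_simp
  · exact (Real.hasDerivAt_log hz.ne').neg.add ((hasDerivAt_inv hz.ne').sub_const 1)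
  · field_simp; ring
  · field_simp; ring
  · have : 0 ≤ z * Real.log z := mul_nonneg (by linarith) (Real.log_nonneg (by linarith))
    rw [abs_of_nonpos (by linarith)]; linarith

/-- Away from zero: for `a < 1`, `z - z^a = (z^(1-a) - 1) z^a`, and for `a > 1`, `z^a - z = z
(z^(a-1) - 1)`. Both are products of positive increasing factors on `z ≥ 2`, so the value at `2` is
a lower bound. -/
theorem isRegularDivergence_h₅ {a : ℝ} (ha : a ∈ Ioo (0 : ℝ) 1 ∪ Ioc (1 : ℝ) 2) :
    IsRegularDivergence (h₅ a) (fun z => Real.sign (1 - a) * a * (z ^ a + -1 * z))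
      fun z => Real.sign (1 - a) * a * (a - 1) * z ^ a := by
  have ha0 : 0 < a := by rcases ha with h | h; exacts [h.1, by linarith [h.1]]
  have ha2 : a ≤ 2 := by rcases ha with h | h; exacts [by linarith [h.2], h.2]
  refine isRegularDivergence_of_hasDerivAt
    (k := fun x => Real.sign (1 - a) * (a * x ^ (a - 1) - a))
    (k' := fun x => Real.sign (1 - a) * (a * ((a - 1) * x ^ (a - 1 - 1))))
    (((Admissible.rpow ha0 ha2).add (Admissible.id.const_mul _)).const_mul _)
    ((Admissible.rpow ha0 ha2).const_mul _)
    (fun z hz => ?_) (fun z hz => ?_) (fun z hz => ?_) (fun z hz => ?_) ?_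
  · have h1 : HasDerivAt (fun x => a * x) a z := by simpa using (hasDerivAt_id z).const_mul a
    exact ((((Real.hasDerivAt_rpow_const (Or.inl hz.ne')).sub h1).add_const a).sub_const
      1).const_mul _
  · exact (((Real.hasDerivAt_rpow_const (Or.inl hz.ne')).const_mul a).sub_const a).const_mul _
  · have : z ^ a = z ^ (a - 1) * z := by
      rw [← Real.rpow_add_one hz.ne']; congr 1; ring
    simp only [this]; ring
  · have : z ^ a = z ^ (a - 1 - 1) * z ^ 2 := by
      rw [← Real.rpow_two, ← Real.rpow_add hz]; congr 1; ring
    simp only [this]; ring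
  · rcases ha with h | h
    · refine ⟨a * (2 ^ (1 - a) - 1) * 2 ^ a, ?_, fun z hz => ?_⟩
      · have : (1 : ℝ) < 2 ^ (1 - a) := Real.one_lt_rpow one_lt_two (by linarith [h.2])
        have : 0 < (2 : ℝ) ^ (1 - a) - 1 := by linarith
        positivity
      · have hz0 : 0 < z := by linarith
        rw [Real.sign_of_pos (by linarith [h.2])]
        have e : z = z ^ (1 - a) * z ^ a := by rw [← Real.rpow_add hz0]; simp
        have h1 : (2 : ℝ) ^ (1 - a) ≤ z ^ (1 - a) :=
          Real.rpow_le_rpow (by norm_num) hz (by linarith [h.2])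
        have h2 : (2 : ℝ) ^ a ≤ z ^ a := Real.rpow_le_rpow (by norm_num) hz ha0.le
        have h3 : (1 : ℝ) < 2 ^ (1 - a) := Real.one_lt_rpow one_lt_two (by linarith [h.2])
        have h4 : 1 * a * (z ^ a + -1 * z) = -(a * (z ^ (1 - a) - 1) * z ^ a) := by
          conv_lhs => rw [e]
          rw [← e]
          -- Only the bare `z` is expanded, not the base of `z ^ a`.
          nth_rewrite 2 [e]
          ring
        rw [h4, abs_neg]
        refine le_trans ?_ (le_abs_self _)
        have : 0 ≤ z ^ (1 - a) - 1 := by linarith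
        gcongr
    · refine ⟨a * (2 * (2 ^ (a - 1) - 1)), ?_, fun z hz => ?_⟩
      · have : (1 : ℝ) < 2 ^ (a - 1) := Real.one_lt_rpow one_lt_two (by linarith [h.1])
        have : 0 < (2 : ℝ) ^ (a - 1) - 1 := by linarith
        positivity
      · have hz0 : 0 < z := by linarith
        rw [Real.sign_of_neg (by linarith [h.1])]
        have e : z ^ a = z ^ (a - 1) * z := by
          rw [← Real.rpow_add_one hz0.ne']; congr 1; ring
        have h1 : (2 : ℝ) ^ (a - 1) ≤ z ^ (a - 1) :=
          Real.rpow_le_rpow (by norm_num) hz (by linarith [h.1])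
        have h3 : (1 : ℝ) < 2 ^ (a - 1) := Real.one_lt_rpow one_lt_two (by linarith [h.1])
        rw [show -1 * a * (z ^ a + -1 * z) = -(a * (z * (z ^ (a - 1) - 1))) by rw [e]; ring, abs_neg]
        refine le_trans ?_ (le_abs_self _)
        have : 0 ≤ z ^ (a - 1) - 1 := by linarith
        gcongr

theorem IsDivergence.exists_regular {h : ℝ → ℝ} (hh : IsDivergence h) :
    ∃ φ₁ φ₂, IsRegularDivergence h φ₁ φ₂ := by
  rcases hh with rfl | rfl | ⟨a, ha, rfl⟩
  exacts [⟨_, _, isRegularDivergence_h₁⟩, ⟨_, _, isRegularDivergence_h₂⟩,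
    ⟨_, _, isRegularDivergence_h₅ ha⟩]

end GMSP

/-! ### Differentiation under the integral in the parameter. -/

namespace GMSP

section Parametric

variable {q d : ℕ} {Θ₀ : Set (E q)} {u : E q → E d → ℝ}

theorem continuous_of_continuousOn_prod (hu : ContinuousOn (fun p : E q × E d => u p.1 p.2)
    (Θ₀ ×ˢ univ)) {θ : E q} (hθ : θ ∈ Θ₀) : Continuous (u θ) :=
  hu.comp_continuous (continuous_const.prodMk continuous_id) fun x => ⟨hθ, mem_univ x⟩

theorem integrableOn_of_continuousOn_prod (hu : ContinuousOn (fun p : E q × E d => u p.1 p.2)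
    (Θ₀ ×ˢ univ)) {θ : E q} (hθ : θ ∈ Θ₀) {B : Set (E d)} (hB : IsCompact B) :
    IntegrableOn (u θ) B :=
  (continuous_of_continuousOn_prod hu hθ).continuousOn.integrableOn_compact hB

/-- A closed ball around `θ` inside `Θ₀`, times `B`, is compact. The bound serves as the dominating
constant for continuity and differentiation of integrals over `B`. -/
theorem exists_local_bound (hΘ : IsOpen Θ₀) (hu : ContinuousOn (fun p : E q × E d => u p.1 p.2)
    (Θ₀ ×ˢ univ)) {θ : E q} (hθ : θ ∈ Θ₀) {B : Set (E d)} (hB : IsCompact B) :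
    ∃ C, ∀ᶠ θ' in 𝓝 θ, θ' ∈ Θ₀ ∧ ∀ y ∈ B, |u θ' y| ≤ C := by
  obtain ⟨ε, hε, hsub⟩ := Metric.nhds_basis_closedBall.mem_iff.1 (hΘ.mem_nhds hθ)
  obtain ⟨C, hC⟩ := ((isCompact_closedBall θ ε).prod hB).exists_bound_of_continuousOn
    (hu.mono (prod_mono hsub (subset_univ B)))
  refine ⟨C, ?_⟩
  filter_upwards [Metric.closedBall_mem_nhds θ hε] with θ' hθ'
  exact ⟨hsub hθ', fun y hy => hC (θ', y) ⟨hθ', hy⟩⟩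

theorem continuousOn_setIntegral (hΘ : IsOpen Θ₀)
    (hu : ContinuousOn (fun p : E q × E d => u p.1 p.2) (Θ₀ ×ˢ univ))
    {B : Set (E d)} (hB : IsCompact B) : ContinuousOn (fun θ => ∫ y in B, u θ y) Θ₀ := by
  intro θ hθ
  obtain ⟨C, hC⟩ := exists_local_bound hΘ hu hθ hB
  refine (continuousAt_of_dominated (bound := fun _ => C) ?_ ?_ ?_ ?_).continuousWithinAt
  · filter_upwards [hC] with θ' h
    exact (continuous_of_continuousOn_prod hu h.1).aestronglyMeasurable
  · filter_upwards [hC] with θ' h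
    exact (ae_restrict_iff' hB.measurableSet).2 (Eventually.of_forall fun y hy => h.2 y hy)
  · exact integrableOn_const hB.measure_lt_top.ne
  · refine Eventually.of_forall fun y => ?_
    exact ((hu.comp (continuousOn_id.prodMk continuousOn_const)
      fun x hx => ⟨hx, mem_univ y⟩).continuousAt (hΘ.mem_nhds hθ) :
        ContinuousAt (fun θ => u θ y) θ)

theorem fderiv_eq_sum_pd {x : E d} {θ : E q} (hd : DifferentiableAt ℝ (fun θ => u θ x) θ) :
    fderiv ℝ (fun θ => u θ x) θ =
      ∑ l, pd u l θ x • (EuclideanSpace.proj l : E q →L[ℝ] ℝ) := by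
  ext v
  conv_lhs => rw [← (EuclideanSpace.basisFun (Fin q) ℝ).sum_repr v]
  simp [map_sum, pd, hd.lineDeriv_eq_fderiv, mul_comm]

theorem hasFDerivAt_setIntegral (hΘ : IsOpen Θ₀)
    (hu : ContinuousOn (fun p : E q × E d => u p.1 p.2) (Θ₀ ×ˢ univ))
    (hd : ∀ x, DifferentiableOn ℝ (fun θ => u θ x) Θ₀)
    (hpd : ∀ l, ContinuousOn (fun p : E q × E d => pd u l p.1 p.2) (Θ₀ ×ˢ univ))
    {B : Set (E d)} (hB : IsCompact B) {θ : E q} (hθ : θ ∈ Θ₀) :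
    HasFDerivAt (fun θ => ∫ y in B, u θ y)
      (∑ l, (∫ y in B, pd u l θ y) • (EuclideanSpace.proj l : E q →L[ℝ] ℝ)) θ := by
  choose C hC using fun l => exists_local_bound hΘ (hpd l) hθ hB
  have hC' := eventually_all.2 hC
  have key := hasFDerivAt_integral_of_dominated_of_fderiv_le (μ := volume.restrict B) (𝕜 := ℝ)
    (F := u) (x₀ := θ) (bound := fun _ => ∑ l, C l * ‖(EuclideanSpace.proj l : E q →L[ℝ] ℝ)‖)
    (F' := fun θ y => ∑ l, pd u l θ y • (EuclideanSpace.proj l : E q →L[ℝ] ℝ))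
    -- Membership in `Θ₀` is recorded separately because the condition over `l` is empty when `q =
    -- 0`.
    (s := {θ' | θ' ∈ Θ₀ ∧ ∀ l, θ' ∈ Θ₀ ∧ ∀ y ∈ B, |pd u l θ' y| ≤ C l})
    (by filter_upwards [hC', hΘ.mem_nhds hθ] with θ' h h' using ⟨h', h⟩)
    (by
      filter_upwards [hΘ.mem_nhds hθ] with θ' h
      exact (continuous_of_continuousOn_prod hu h).aestronglyMeasurable)
    (integrableOn_of_continuousOn_prod hu hθ hB)
    (Continuous.aestronglyMeasurable (continuous_finsetSum _ fun l _ =>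
      (continuous_of_continuousOn_prod (hpd l) hθ).smul continuous_const))
    ((ae_restrict_iff' hB.measurableSet).2 (Eventually.of_forall fun y hy θ' h => by
      refine (norm_sum_le _ _).trans (Finset.sum_le_sum fun l _ => ?_)
      rw [norm_smul]
      exact mul_le_mul_of_nonneg_right ((h.2 l).2 y hy) (norm_nonneg _)))
    (integrableOn_const hB.measure_lt_top.ne)
    (Eventually.of_forall fun y θ' h => by
      have := (hd y).differentiableAt (hΘ.mem_nhds h.1)
      rw [← fderiv_eq_sum_pd this]
      exact this.hasFDerivAt)
  refine key.congr_fderiv ?_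
  rw [integral_finsetSum _ fun l _ =>
    (integrableOn_of_continuousOn_prod (hpd l) hθ hB).smul_const _]
  exact Finset.sum_congr rfl fun l _ => integral_smul_const _ _

end Parametric

namespace AssumptionA2

variable {q d : ℕ} {Θ Θ₀ : Set (E q)} {θ₀ : E q} {f : E q → E d → ℝ}

theorem differentiableOn (hA : AssumptionA2 Θ Θ₀ θ₀ f) (x : E d) :
    DifferentiableOn ℝ (fun θ => f θ x) Θ₀ :=
  (hA.contDiffOn x).differentiableOn (by norm_num)

/-- On the open set `Θ₀` the line derivative is the Fréchet derivative evaluated at a basis vector,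
which is `C¹` since `f` is `C²` in the parameter. -/
theorem differentiableOn_pd (hA : AssumptionA2 Θ Θ₀ θ₀ f) (l : Fin q) (x : E d) :
    DifferentiableOn ℝ (fun θ => pd f l θ x) Θ₀ := by
  have h1 : ContDiffOn ℝ 1 (fderiv ℝ fun θ => f θ x) Θ₀ :=
    (hA.contDiffOn x).fderiv_of_isOpen hA.isOpen (by norm_num)
  have h2 : DifferentiableOn ℝ
      (fun θ => fderiv ℝ (fun θ => f θ x) θ (EuclideanSpace.single l 1)) Θ₀ :=
    (h1.differentiableOn (by norm_num)).clm_apply (differentiableOn_const _)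
  refine h2.congr fun θ hθ => ?_
  exact ((hA.differentiableOn x).differentiableAt (hA.isOpen.mem_nhds hθ)).lineDeriv_eq_fderiv

end AssumptionA2

/-! ### The mean value inequality with entrywise bounds. -/

section MeanValue

variable {q : ℕ}

theorem sum_abs_le_sqrt_mul_norm (v : E q) : ∑ l, |v l| ≤ √q * ‖v‖ := by
  rw [EuclideanSpace.norm_eq, ← Real.sqrt_mul (Nat.cast_nonneg q)]
  refine Real.le_sqrt_of_sq_le ?_
  simpa using sq_sum_le_card_mul_sum_sq (s := Finset.univ) (f := fun l => |v l|)

theorem norm_le_sqrt_mul_of_abs_le {v : E q} {M : ℝ} (hM : 0 ≤ M) (h : ∀ j, |v j| ≤ M) :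
    ‖v‖ ≤ √q * M := by
  rw [EuclideanSpace.norm_eq, ← Real.sqrt_sq hM, ← Real.sqrt_mul (Nat.cast_nonneg q)]
  refine Real.sqrt_le_sqrt ?_
  calc ∑ i, ‖v i‖ ^ 2 ≤ ∑ _i : Fin q, M ^ 2 :=
        Finset.sum_le_sum fun i _ => pow_le_pow_left₀ (norm_nonneg _) (h i) 2
    _ = q * M ^ 2 := by simp

/-- The mean value inequality for a vector field whose Jacobian matrix has entries bounded
by `M`. -/
theorem norm_sub_le_of_jacobian_le {T : Set (E q)} (hT : Convex ℝ T) {Φ : E q → E q}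
    {J : Fin q → Fin q → E q → ℝ} {M : ℝ} (hM : 0 ≤ M)
    (hΦ : ∀ θ ∈ T, ∀ j, HasFDerivAt (fun θ => Φ θ j)
      (∑ l, J j l θ • (EuclideanSpace.proj l : E q →L[ℝ] ℝ)) θ)
    (hJ : ∀ θ ∈ T, ∀ j l, |J j l θ| ≤ M) {s t : E q} (hs : s ∈ T) (ht : t ∈ T) :
    ‖Φ s - Φ t‖ ≤ q * M * ‖s - t‖ := by
  have h1 : ∀ j, |(Φ s - Φ t) j| ≤ √q * M * ‖s - t‖ := fun j => by
    refine hT.norm_image_sub_le_of_norm_hasFDerivWithin_le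
      (f := fun θ => Φ θ j) (fun θ hθ => (hΦ θ hθ j).hasFDerivWithinAt) (fun θ hθ => ?_) ht hs
    refine ContinuousLinearMap.opNorm_le_bound _ (by positivity) fun v => ?_
    simp only [sum_apply, smul_apply, smul_eq_mul]
    calc ‖∑ l, J j l θ * (EuclideanSpace.proj l : E q →L[ℝ] ℝ) v‖ ≤ ∑ l, M * |v l| := by
          refine (norm_sum_le _ _).trans (Finset.sum_le_sum fun l _ => ?_)
          rw [norm_mul]
          exact mul_le_mul_of_nonneg_right (hJ θ hθ j l) (norm_nonneg _)
      _ = M * ∑ l, |v l| := by rw [Finset.mul_sum]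
      _ ≤ M * (√q * ‖v‖) := by gcongr; exact sum_abs_le_sqrt_mul_norm v
      _ = √q * M * ‖v‖ := by ring
  -- One factor `√q` stems from Cauchy–Schwarz in the direction `s - t`, the other from passing from
  -- components to the norm. Their product is the factor `q` of the envelope.
  refine (norm_le_sqrt_mul_of_abs_le (by positivity) h1).trans_eq ?_
  rw [← mul_assoc, ← mul_assoc, Real.mul_self_sqrt (Nat.cast_nonneg q)]

end MeanValue

end GMSP

/-! ### Uniform approximation of the model on small balls. -/

namespace GMSP

variable {q d : ℕ}

/-- The logarithmic derivative `(∂ f_θ(x) / ∂θ_l) / f_θ(x)`. -/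
noncomputable def relDeriv (f : E q → E d → ℝ) (l : Fin q) (θ : E q) (x : E d) : ℝ :=
  pd f l θ x / f θ x

/-- The relative second derivative `(∂² f_θ(x) / ∂θ_j ∂θ_l) / f_θ(x)`. -/
noncomputable def relDeriv₂ (f : E q → E d → ℝ) (j l : Fin q) (θ : E q) (x : E d) : ℝ :=
  pd (pd f l) j θ x / f θ x

/-- Near `K` and `θ₀`, the model density and its derivatives are uniformly close to their values
at the centre, with relative error `κ`. -/
structure IsUniformRegime (f : E q → E d → ℝ) (θ₀ : E q) (x : E d) (κ : ℝ) (θ : E q)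
    (y : E d) : Prop where
  pos : 0 < f θ y
  base : |f θ y - f θ₀ y| ≤ κ * f θ₀ y
  low : f θ₀ x / 2 ≤ f θ y
  fst : ∀ l, |pd f l θ y - relDeriv f l θ₀ x * f θ y| ≤ κ * f θ y
  snd : ∀ j l, |pd (pd f l) j θ y - relDeriv₂ f j l θ₀ x * f θ y| ≤ κ * f θ y

variable {Θ Θ₀ : Set (E q)} {θ₀ : E q} {f : E q → E d → ℝ} {K : Set (E d)}

/-- At `θ = θ₀` and `y = x` every left-hand difference vanishes while `f θ₀ x > 0`, so the
inequalities hold strictly there and persist nearby by continuity. Compactness of `K` makes the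
neighbourhood uniform in `x`. -/
theorem AssumptionA2.eventually_regime (hA : AssumptionA2 Θ Θ₀ θ₀ f) (hK : IsCompact K)
    (hKpos : ∀ x ∈ K, 0 < f θ₀ x) {κ : ℝ} (hκ : 0 < κ) :
    ∃ ε > 0, ∀ θ ∈ Metric.closedBall θ₀ ε, θ ∈ Θ₀ ∧
      ∀ x ∈ K, ∀ y ∈ Metric.closedBall x ε, IsUniformRegime f θ₀ x κ θ y := by
  -- The point `y` is written as `x` plus a displacement, so that a single neighbourhood of `(θ₀,
  -- 0)` can serve all `x ∈ K`.
  have key : ∀ x₀ ∈ K, ∀ᶠ p : (E q × E d) × E d in 𝓝 ((θ₀, 0), x₀),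
      IsUniformRegime f θ₀ p.2 κ p.1.1 (p.2 + p.1.2) := by
    intro x₀ hx₀
    have hpair : ∀ x : E d, Θ₀ ×ˢ univ ∈ 𝓝 (θ₀, x) := fun x =>
      prod_mem_nhds (hA.isOpen.mem_nhds hA.mem) univ_mem
    have c1 : ∀ u : E q → E d → ℝ, ContinuousOn (fun p : E q × E d => u p.1 p.2) (Θ₀ ×ˢ univ) →
        ContinuousAt (fun p : (E q × E d) × E d => u p.1.1 (p.2 + p.1.2)) ((θ₀, 0), x₀) :=
      fun u hu => by
        have hc : ContinuousAt (fun p : (E q × E d) × E d => (p.1.1, p.2 + p.1.2))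
          ((θ₀, 0), x₀) := by fun_prop
        have h2 : ContinuousAt (fun p : E q × E d => u p.1 p.2) (θ₀, x₀ + 0) :=
          hu.continuousAt (hpair _)
        exact ContinuousAt.comp (f := fun p : (E q × E d) × E d => (p.1.1, p.2 + p.1.2))
          (g := fun p : E q × E d => u p.1 p.2) h2 hc
    have c2 : ∀ u : E q → E d → ℝ, ContinuousOn (fun p : E q × E d => u p.1 p.2) (Θ₀ ×ˢ univ) →
        ContinuousAt (fun p : (E q × E d) × E d => u θ₀ p.2) ((θ₀, 0), x₀) := fun u hu =>
      (continuous_of_continuousOn_prod hu hA.mem).continuousAt.comp continuousAt_snd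
    have c3 : ContinuousAt (fun p : (E q × E d) × E d => f θ₀ (p.2 + p.1.2)) ((θ₀, 0), x₀) :=
      ((continuous_of_continuousOn_prod hA.continuousOn hA.mem).comp
        (by fun_prop : Continuous fun p : (E q × E d) × E d => p.2 + p.1.2)).continuousAt
    have c := c1 _ hA.continuousOn
    have c' := c2 _ hA.continuousOn
    have hpos := hKpos x₀ hx₀
    have e1 := (continuousAt_const (y := (0 : ℝ))).eventually_lt c (by simpa using hpos)
    have e2 := ((c.sub c3).abs).eventually_lt (c3.const_mul κ)
      (by simpa using mul_pos hκ hpos)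
    have e3 := (c'.div_const 2).eventually_lt c (by simpa using half_lt_self hpos)
    have e4 : ∀ l, ∀ᶠ p : (E q × E d) × E d in 𝓝 ((θ₀, 0), x₀),
        |pd f l p.1.1 (p.2 + p.1.2) - relDeriv f l θ₀ p.2 * f p.1.1 (p.2 + p.1.2)| <
          κ * f p.1.1 (p.2 + p.1.2) := fun l => by
      refine (((c1 _ (hA.continuousOn_pd l)).sub
        (((c2 _ (hA.continuousOn_pd l)).div c' hpos.ne').mul c)).abs).eventually_lt
          (c.const_mul κ) ?_
      simpa [div_mul_cancel₀ _ hpos.ne'] using mul_pos hκ hpos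
    have e5 : ∀ j l, ∀ᶠ p : (E q × E d) × E d in 𝓝 ((θ₀, 0), x₀),
        |pd (pd f l) j p.1.1 (p.2 + p.1.2) - relDeriv₂ f j l θ₀ p.2 * f p.1.1 (p.2 + p.1.2)| <
          κ * f p.1.1 (p.2 + p.1.2) := fun j l => by
      refine (((c1 _ (hA.continuousOn_pd_pd j l)).sub
        (((c2 _ (hA.continuousOn_pd_pd j l)).div c' hpos.ne').mul c)).abs).eventually_lt
          (c.const_mul κ) ?_
      simpa [div_mul_cancel₀ _ hpos.ne'] using mul_pos hκ hpos
    filter_upwards [e1, e2, e3, eventually_all.2 e4, eventually_all.2 fun j => eventually_all.2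
      fun l => e5 j l] with p h1 h2 h3 h4 h5
    exact ⟨h1, h2.le, h3.le, fun l => (h4 l).le, fun j l => (h5 j l).le⟩
  have h1 := hK.eventually_forall_of_forall_eventually
    (P := fun (p : E q × E d) x => IsUniformRegime f θ₀ x κ p.1 (x + p.2)) key
  have h2 : ∀ᶠ p : E q × E d in 𝓝 (θ₀, 0), p.1 ∈ Θ₀ :=
    continuousAt_fst.eventually_mem (hA.isOpen.mem_nhds hA.mem)
  obtain ⟨ε, hε, h⟩ := Metric.nhds_basis_closedBall.eventually_iff.1 (h2.and h1)
  refine ⟨ε, hε, fun θ hθ => ⟨(h (x := (θ, 0)) ?_).1, fun x hx y hy => ?_⟩⟩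
  · simpa [Metric.mem_closedBall, Prod.dist_eq, hε.le] using hθ
  · have := (h (x := (θ, y - x)) ?_).2 x hx
    · simpa using this
    · rw [Metric.mem_closedBall, Prod.dist_eq]
      rw [Metric.mem_closedBall, dist_eq_norm] at hy
      exact max_le hθ (by simpa using hy)

theorem abs_setIntegral_sub_le {α : Type*} [MeasurableSpace α] {μ : Measure α} {B : Set α}
    (hB : MeasurableSet B) {u w : α → ℝ} (hu : IntegrableOn u B μ) (hw : IntegrableOn w B μ)
    {k κ : ℝ} (h : ∀ y ∈ B, |u y - k * w y| ≤ κ * w y) :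
    |∫ y in B, u y ∂μ - k * ∫ y in B, w y ∂μ| ≤ κ * ∫ y in B, w y ∂μ := by
  rw [← integral_const_mul, ← integral_const_mul, ← integral_sub hu (hw.const_mul k)]
  refine (abs_integral_le_integral_abs).trans ?_
  exact setIntegral_mono_on (hu.sub (hw.const_mul k)).abs (hw.const_mul κ) hB h

/-- The score associated with the ball `B`. -/
noncomputable def ballPsi (h : ℝ → ℝ) (f : E q → E d → ℝ) (n : ℕ) (B : Set (E d)) (θ : E q) :
    E q :=
  WithLp.toLp 2 fun j =>
    deriv h (n * modelProb f θ B) * (n * modelProb f θ B) *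
      ((1 / modelProb f θ B) * ∫ y in B, pd f j θ y)

/-- The Jacobian matrix of the score associated with the ball `B`. -/
noncomputable def ballJac (h : ℝ → ℝ) (f : E q → E d → ℝ) (n : ℕ) (B : Set (E d))
    (j l : Fin q) (θ : E q) : ℝ :=
  deriv (deriv h) (n * modelProb f θ B) * (n * modelProb f θ B) ^ 2 *
      (((∫ y in B, pd f l θ y) / modelProb f θ B) * ((∫ y in B, pd f j θ y) / modelProb f θ B)) +
    deriv h (n * modelProb f θ B) * (n * modelProb f θ B) *
      ((∫ y in B, pd (pd f j) l θ y) / modelProb f θ B)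

/-- Where `P_θ(B) > 0`, the factor `z / P_θ(B)` is the constant `n`. The score component is then the
product of `h'(nP_θ(B))` and `n ∫_B ∂_j f`, to which the chain and product rules apply; powers of
`P_θ(B)` reappear only on rewriting the result in terms of `z`. -/
theorem hasFDerivAt_ballPsi {h φ₁ φ₂ : ℝ → ℝ} (hh : IsRegularDivergence h φ₁ φ₂)
    (hA : AssumptionA2 Θ Θ₀ θ₀ f) {n : ℕ} (hn : 0 < n) {B : Set (E d)} (hB : IsCompact B)
    {θ : E q} (hθ : θ ∈ Θ₀) (hp : 0 < modelProb f θ B) (j : Fin q) :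
    HasFDerivAt (fun θ => ballPsi h f n B θ j)
      (∑ l, ballJac h f n B j l θ • (EuclideanSpace.proj l : E q →L[ℝ] ℝ)) θ := by
  have hn' : (0 : ℝ) < n := Nat.cast_pos.2 hn
  have d1 : HasFDerivAt (fun θ => modelProb f θ B)
      (∑ l, (∫ y in B, pd f l θ y) • (EuclideanSpace.proj l : E q →L[ℝ] ℝ)) θ :=
    hasFDerivAt_setIntegral hA.isOpen hA.continuousOn hA.differentiableOn hA.continuousOn_pd hB hθ
  have d2 := hasFDerivAt_setIntegral hA.isOpen (hA.continuousOn_pd j) (hA.differentiableOn_pd j)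
    (fun l => hA.continuousOn_pd_pd l j) hB hθ
  have d3 : HasDerivAt (deriv h) _ (n * modelProb f θ B) :=
    (hh.differentiableAt _ (mul_pos hn' hp)).hasDerivAt
  have d4 := (d3.comp_hasFDerivAt θ (d1.const_mul (n : ℝ))).mul (d2.const_mul (n : ℝ))
  refine (d4.congr_of_eventuallyEq ?_).congr_fderiv ?_
  · filter_upwards [d1.continuousAt.tendsto.eventually_const_lt hp] with θ' hθ'
    simp only [ballPsi, Function.comp, Pi.mul_apply]
    field_simp
  · ext v
    simp only [ballJac, Function.comp, add_apply, smul_apply, sum_apply, smul_eq_mul,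
      Finset.mul_sum, ← Finset.sum_add_distrib]
    refine Finset.sum_congr rfl fun l _ => ?_
    field_simp
    ring

end GMSP

/-! ### The limit of the Jacobian of the score. -/

namespace GMSP

variable {q d : ℕ}

/-- The limit of the Jacobian matrix of the score for small balls around `x` whose normalized
probability is `z`. -/
noncomputable def limJac (φ₁ φ₂ : ℝ → ℝ) (f : E q → E d → ℝ) (θ₀ : E q) (x : E d)
    (j l : Fin q) (z : ℝ) : ℝ :=
  φ₂ z * (relDeriv f l θ₀ x * relDeriv f j θ₀ x) + φ₁ z * relDeriv₂ f l j θ₀ x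

/-- Bounds for the ingredients of the score of a small ball `B` around `x`, for parameters
near `θ₀`. -/
structure IsScoreRegime (h φ₁ φ₂ : ℝ → ℝ) (f : E q → E d → ℝ) (θ₀ : E q) (x : E d) (C ε : ℝ)
    (θ : E q) (B : Set (E d)) : Prop where
  pos : 0 < modelProb f θ B
  phi₁ : ∀ n : ℕ, |φ₁ (n * modelProb f θ B)| ≤ C * (1 + (n * modelProb f θ₀ B) ^ 2)
  phi₂ : ∀ n : ℕ, |φ₂ (n * modelProb f θ B)| ≤ C * (1 + (n * modelProb f θ₀ B) ^ 2)
  fst : ∀ l, (∫⁻ y in B, ‖pd f l θ y‖ₑ) / ENNReal.ofReal (modelProb f θ B) ≤ ENNReal.ofReal C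
  snd : ∀ j l,
    (∫⁻ y in B, ‖pd (pd f l) j θ y‖ₑ) / ENNReal.ofReal (modelProb f θ B) ≤ ENNReal.ofReal C
  jac : ∀ n : ℕ, 0 < n → ∀ j l,
    |ballJac h f n B j l θ - limJac φ₁ φ₂ f θ₀ x j l (n * modelProb f θ₀ B)| ≤
      ε * (1 + (n * modelProb f θ₀ B) ^ 2)

/-- Pointwise `|u| ≤ (|k| + κ) w ≤ C w` on `B`; integrating and dividing gives the bound. -/
theorem lintegral_enorm_div_le {B : Set (E d)} (hB : MeasurableSet B) {u w : E d → ℝ}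
    (hw : IntegrableOn w B) (hpos : 0 < ∫ y in B, w y) {k C κ : ℝ}
    (h : ∀ y ∈ B, 0 < w y ∧ |u y - k * w y| ≤ κ * w y) (hk : |k| + κ ≤ C) :
    (∫⁻ y in B, ‖u y‖ₑ) / ENNReal.ofReal (∫ y in B, w y) ≤ ENNReal.ofReal C := by
  rw [ENNReal.div_le_iff (by simpa using hpos) ENNReal.ofReal_ne_top]
  rcases B.eq_empty_or_nonempty with rfl | ⟨y₀, hy₀⟩
  · simp
  have hC : 0 ≤ C := by
    have h1 := (abs_nonneg _).trans (h y₀ hy₀).2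
    have := nonneg_of_mul_nonneg_left h1 (h y₀ hy₀).1
    linarith [abs_nonneg k]
  rw [← ENNReal.ofReal_mul hC, ← integral_const_mul, ofReal_integral_eq_lintegral_ofReal
    (hw.const_mul C) ((ae_restrict_iff' hB).2 (Eventually.of_forall fun y hy =>
      mul_nonneg hC (h y hy).1.le))]
  refine setLIntegral_mono' hB fun y hy => ?_
  rw [← ofReal_norm]
  refine ENNReal.ofReal_le_ofReal ?_
  have h1 : |u y| ≤ |u y - k * w y| + |k * w y| := by
    simpa using abs_add_le (u y - k * w y) (k * w y)
  rw [abs_mul, abs_of_pos (h y hy).1] at h1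
  rw [Real.norm_eq_abs]
  nlinarith [(h y hy).1, (h y hy).2]

/-- Telescoping: one factor is replaced at a time, giving five differences. The perturbed ratios
stay below `L + 1` because `κ ≤ 1`. -/
theorem abs_jac_sub_le {p₁ p₂ p₁' p₂' A A' a a' b β C L ε κ s : ℝ} (hs : 0 ≤ s)
    (hκ : 0 ≤ κ) (hκ1 : κ ≤ 1) (hε : 0 ≤ ε) (hC : 0 ≤ C)
    (hp₁ : |p₁ - p₁'| ≤ ε * s) (hp₂ : |p₂ - p₂'| ≤ ε * s) (h₁ : |p₁'| ≤ C * s)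
    (h₂ : |p₂'| ≤ C * s) (hA : |A - a| ≤ κ) (hA' : |A' - a'| ≤ κ) (hβ : |β - b| ≤ κ)
    (ha : |a| ≤ L) (ha' : |a'| ≤ L) (hb : |b| ≤ L) :
    |(p₂ * (A * A') + p₁ * β) - (p₂' * (a * a') + p₁' * b)| ≤
      (ε * ((L + 1) ^ 2 + (L + 1)) + κ * (C * (2 * L + 2))) * s := by
  have hL : 0 ≤ L := (abs_nonneg _).trans ha
  have bA : |A| ≤ L + 1 := by
    have := abs_sub_abs_le_abs_sub A a
    linarith
  have bA' : |A'| ≤ L + 1 := by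
    have := abs_sub_abs_le_abs_sub A' a'
    linarith
  have bβ : |β| ≤ L + 1 := by
    have := abs_sub_abs_le_abs_sub β b
    linarith
  have e1 : |(p₂ - p₂') * (A * A')| ≤ ε * s * ((L + 1) * (L + 1)) := by
    rw [abs_mul, abs_mul]
    gcongr
  have e2 : |p₂' * ((A - a) * A')| ≤ C * s * (κ * (L + 1)) := by
    rw [abs_mul, abs_mul]
    gcongr
  have e3 : |p₂' * (a * (A' - a'))| ≤ C * s * (L * κ) := by
    rw [abs_mul, abs_mul]
    gcongr
  have e4 : |(p₁ - p₁') * β| ≤ ε * s * (L + 1) := by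
    rw [abs_mul]
    gcongr
  have e5 : |p₁' * (β - b)| ≤ C * s * κ := by
    rw [abs_mul]
    gcongr
  have := abs_add_le ((p₂ - p₂') * (A * A')) (p₂' * ((A - a) * A'))
  have := abs_add_le ((p₂ - p₂') * (A * A') + p₂' * ((A - a) * A')) (p₂' * (a * (A' - a')))
  have := abs_add_le ((p₂ - p₂') * (A * A') + p₂' * ((A - a) * A') + p₂' * (a * (A' - a')))
    ((p₁ - p₁') * β)
  have := abs_add_le ((p₂ - p₂') * (A * A') + p₂' * ((A - a) * A') + p₂' * (a * (A' - a')) +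
    (p₁ - p₁') * β) (p₁' * (β - b))
  have e : (p₂ * (A * A') + p₁ * β) - (p₂' * (a * a') + p₁' * b) =
    (p₂ - p₂') * (A * A') + p₂' * ((A - a) * A') + p₂' * (a * (A' - a')) +
    (p₁ - p₁') * β + p₁' * (β - b) := by ring
  rw [e]
  nlinarith

variable {Θ Θ₀ : Set (E q)} {θ₀ : E q} {f : E q → E d → ℝ} {K : Set (E d)}

theorem AssumptionA2.exists_relDeriv_bound (hA : AssumptionA2 Θ Θ₀ θ₀ f) (hK : IsCompact K)
    (hKpos : ∀ x ∈ K, 0 < f θ₀ x) :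
    ∃ L, 0 ≤ L ∧ (∀ l, ContinuousOn (relDeriv f l θ₀) K) ∧
      (∀ j l, ContinuousOn (relDeriv₂ f j l θ₀) K) ∧ ∀ x ∈ K, (∀ l, |relDeriv f l θ₀ x| ≤ L) ∧
      ∀ j l, |relDeriv₂ f j l θ₀ x| ≤ L := by
  have hf := (continuous_of_continuousOn_prod hA.continuousOn hA.mem).continuousOn (s := K)
  have c1 : ∀ l, ContinuousOn (relDeriv f l θ₀) K := fun l =>
    (continuous_of_continuousOn_prod (hA.continuousOn_pd l) hA.mem).continuousOn.div hf
      fun x hx => (hKpos x hx).ne'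
  have c2 : ∀ j l, ContinuousOn (relDeriv₂ f j l θ₀) K := fun j l =>
    (continuous_of_continuousOn_prod (hA.continuousOn_pd_pd j l) hA.mem).continuousOn.div hf
      fun x hx => (hKpos x hx).ne'
  choose L₁ hL₁ using fun l => hK.exists_bound_of_continuousOn (c1 l)
  choose L₂ hL₂ using fun j l => hK.exists_bound_of_continuousOn (c2 j l)
  refine ⟨∑ l, |L₁ l| + ∑ j, ∑ l, |L₂ j l|, by positivity, c1, c2, fun x hx =>
    ⟨fun l => ?_, fun j l => ?_⟩⟩
  · have h1 : |relDeriv f l θ₀ x| ≤ |L₁ l| := (hL₁ l x hx).trans (le_abs_self _)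
    have h2 := Finset.single_le_sum (f := fun l => |L₁ l|) (fun i _ => abs_nonneg _)
      (Finset.mem_univ l)
    have h3 : 0 ≤ ∑ j, ∑ l, |L₂ j l| := by positivity
    linarith
  · have h1 : |relDeriv₂ f j l θ₀ x| ≤ |L₂ j l| := (hL₂ j l x hx).trans (le_abs_self _)
    have h2 := Finset.single_le_sum (f := fun l => |L₂ j l|) (fun i _ => abs_nonneg _)
      (Finset.mem_univ l)
    have h3 := Finset.single_le_sum (f := fun j => ∑ l, |L₂ j l|)
      (fun i _ => Finset.sum_nonneg fun l _ => abs_nonneg _) (Finset.mem_univ j)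
    have h4 : 0 ≤ ∑ l, |L₁ l| := by positivity
    linarith

/-- The pointwise relative approximation of the density and its derivatives integrates to the ratios
over the ball, and the ratio of the two ball probabilities is within the range where `φ₁` and `φ₂`
scale well. The constant `C` is fixed before `ε`: only the radius `ρ` shrinks with the required
precision. -/
theorem exists_scoreRegime {h φ₁ φ₂ : ℝ → ℝ} (hh : IsRegularDivergence h φ₁ φ₂)
    (hA : AssumptionA2 Θ Θ₀ θ₀ f) (hK : IsCompact K) (hKpos : ∀ x ∈ K, 0 < f θ₀ x) :
    ∃ C, 0 ≤ C ∧ (∀ x ∈ K, ∀ j l z, 0 ≤ z → |limJac φ₁ φ₂ f θ₀ x j l z| ≤ C * (1 + z ^ 2)) ∧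
      ∀ ε > 0, ∃ ρ > 0, ∀ θ ∈ Metric.closedBall θ₀ ρ, θ ∈ Θ₀ ∧ ∀ x ∈ K,
        (∀ y ∈ Metric.closedBall x ρ, f θ₀ x / 2 ≤ f θ y) ∧ ∀ r, 0 < r → r ≤ ρ →
        IsScoreRegime h φ₁ φ₂ f θ₀ x C ε θ (Metric.closedBall x r) := by
  obtain ⟨L, hL, -, -, hLK⟩ := hA.exists_relDeriv_bound hK hKpos
  obtain ⟨C₁, hC₁, hg₁⟩ := hh.adm₁.growth
  obtain ⟨C₂, hC₂, hg₂⟩ := hh.adm₂.growth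
  -- This constant dominates `C₂ L² + C₁ L` (the limit matrix), `C₁ + 1` and `C₂ + 1` (the values of
  -- `φ₁`, `φ₂` after a perturbation with `ε' ≤ 1`) and `L + 1` (the ratios).
  refine ⟨(C₁ + C₂ + 1) * (L * L + L + 1), by positivity, fun x hx j l z hz => ?_,
    fun ε hε => ?_⟩
  · have e1 : |φ₂ z * (relDeriv f l θ₀ x * relDeriv f j θ₀ x)| ≤ C₂ * (1 + z ^ 2) * (L * L) := by
      rw [abs_mul, abs_mul]
      exact mul_le_mul (hg₂ z hz) (mul_le_mul ((hLK x hx).1 l) ((hLK x hx).1 j) (abs_nonneg _) hL)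
        (by positivity) (by positivity)
    have e2 : |φ₁ z * relDeriv₂ f l j θ₀ x| ≤ C₁ * (1 + z ^ 2) * L := by
      rw [abs_mul]
      exact mul_le_mul (hg₁ z hz) ((hLK x hx).2 l j) (abs_nonneg _) (by positivity)
    refine (abs_add_le _ _).trans ((add_le_add e1 e2).trans ?_)
    have h1 : C₂ * (L * L) + C₁ * L ≤ (C₁ + C₂ + 1) * (L * L + L + 1) := by
      have := mul_nonneg hC₁ (mul_nonneg hL hL)
      have := mul_nonneg hC₂ hL
      nlinarith [mul_nonneg hL hL]
    nlinarith [sq_nonneg z]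
  -- The factor produced by `abs_jac_sub_le` when both tolerances there are at most `ε'`, so that
  -- `ε' * D ≤ ε` is what is needed.
  set D : ℝ := ((L + 1) ^ 2 + (L + 1)) + (C₁ + C₂) * (2 * L + 2) with hD
  have hDpos : 0 < D := by positivity
  set ε' : ℝ := min 1 (ε / D) with hε'
  have hε'pos : 0 < ε' := by positivity
  obtain ⟨κ₀, hκ₀, hs⟩ := Metric.nhds_basis_closedBall.eventually_iff.1
    ((hh.adm₁.scaling ε' hε'pos).and (hh.adm₂.scaling ε' hε'pos))
  set κ : ℝ := min κ₀ ε' with hκ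
  have hκpos : 0 < κ := by positivity
  have hκ1 : κ ≤ 1 := (min_le_right _ _).trans (min_le_left _ _)
  obtain ⟨ρ, hρ, hreg⟩ := hA.eventually_regime hK hKpos hκpos
  refine ⟨ρ, hρ, fun θ hθ => ⟨(hreg θ hθ).1, fun x hx => ⟨fun y hy => ((hreg θ hθ).2 x hx y hy).low,
    fun r hr hrρ => ?_⟩⟩⟩
  set B := Metric.closedBall x r with hB
  have hBc : IsCompact B := isCompact_closedBall x r
  have hBm : MeasurableSet B := hBc.measurableSet
  have hθ₀ : θ₀ ∈ Metric.closedBall θ₀ ρ := Metric.mem_closedBall_self hρ.le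
  have hreg' : ∀ θ ∈ Metric.closedBall θ₀ ρ, ∀ y ∈ B, IsUniformRegime f θ₀ x κ θ y :=
    fun θ hθ y hy => (hreg θ hθ).2 x hx y (Metric.closedBall_subset_closedBall hrρ hy)
  have hint : ∀ θ ∈ Metric.closedBall θ₀ ρ, IntegrableOn (f θ) B := fun θ hθ =>
    integrableOn_of_continuousOn_prod hA.continuousOn (hreg θ hθ).1 hBc
  have hpos : ∀ θ ∈ Metric.closedBall θ₀ ρ, 0 < modelProb f θ B := fun θ hθ => by
    have hvol : 0 < volume.real B :=
      ENNReal.toReal_pos (Metric.measure_closedBall_pos _ _ hr).ne' hBc.measure_lt_top.ne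
    have h1 : f θ₀ x / 2 * volume.real B ≤ modelProb f θ B := by
      have := setIntegral_mono_on (integrableOn_const (C := f θ₀ x / 2) hBc.measure_lt_top.ne)
        (hint θ hθ) hBm fun y hy => (hreg' θ hθ y hy).low
      rwa [setIntegral_const, smul_eq_mul, mul_comm] at this
    exact (mul_pos (half_pos (hKpos x hx)) hvol).trans_le h1
  have hp := hpos θ hθ
  have hp₀ := hpos θ₀ hθ₀
  have i1 : ∀ l, IntegrableOn (pd f l θ) B := fun l =>
    integrableOn_of_continuousOn_prod (hA.continuousOn_pd l) (hreg θ hθ).1 hBc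
  have i2 : ∀ j l, IntegrableOn (pd (pd f l) j θ) B := fun j l =>
    integrableOn_of_continuousOn_prod (hA.continuousOn_pd_pd j l) (hreg θ hθ).1 hBc
  have r1 : ∀ l, |(∫ y in B, pd f l θ y) / modelProb f θ B - relDeriv f l θ₀ x| ≤ κ := fun l => by
    have := abs_setIntegral_sub_le hBm (i1 l) (hint θ hθ) fun y hy => (hreg' θ hθ y hy).fst l
    rw [div_sub' hp.ne', abs_div, abs_of_pos hp, div_le_iff₀ hp, mul_comm (modelProb f θ B)]
    exact this
  have r2 : ∀ j l, |(∫ y in B, pd (pd f l) j θ y) / modelProb f θ B - relDeriv₂ f j l θ₀ x| ≤ κ :=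
    fun j l => by
    have := abs_setIntegral_sub_le hBm (i2 j l) (hint θ hθ) fun y hy => (hreg' θ hθ y hy).snd j l
    rw [div_sub' hp.ne', abs_div, abs_of_pos hp, div_le_iff₀ hp, mul_comm (modelProb f θ B)]
    exact this
  have r0 : modelProb f θ B / modelProb f θ₀ B ∈ Metric.closedBall (1 : ℝ) κ₀ := by
    have := abs_setIntegral_sub_le hBm (hint θ hθ) (hint θ₀ hθ₀) (k := 1) (κ := κ)
      fun y hy => by simpa using (hreg' θ hθ y hy).base
    rw [Metric.mem_closedBall, Real.dist_eq, div_sub' hp₀.ne', abs_div, abs_of_pos hp₀,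
      div_le_iff₀ hp₀, mul_comm (modelProb f θ₀ B)]
    exact this.trans (mul_le_mul_of_nonneg_right (min_le_left _ _) hp₀.le)
  have hz : ∀ n : ℕ, 0 ≤ n * modelProb f θ₀ B := fun n => by positivity
  have hzθ : ∀ n : ℕ, (n : ℝ) * modelProb f θ B =
      modelProb f θ B / modelProb f θ₀ B * (n * modelProb f θ₀ B) := fun n => by field_simp
  have s1 : ∀ n : ℕ, |φ₁ (n * modelProb f θ B) - φ₁ (n * modelProb f θ₀ B)| ≤
      ε' * (1 + (n * modelProb f θ₀ B) ^ 2) := fun n => by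
    rw [hzθ n]; exact (hs r0).1 _ (hz n)
  have s2 : ∀ n : ℕ, |φ₂ (n * modelProb f θ B) - φ₂ (n * modelProb f θ₀ B)| ≤
      ε' * (1 + (n * modelProb f θ₀ B) ^ 2) := fun n => by
    rw [hzθ n]; exact (hs r0).2 _ (hz n)
  have hε'1 : ε' ≤ 1 := min_le_left _ _
  have hCC : C₁ + C₂ + 1 ≤ (C₁ + C₂ + 1) * (L * L + L + 1) := by
    nlinarith [mul_nonneg hL hL, mul_nonneg hC₁ hL, mul_nonneg hC₂ hL]
  have hCL : L + 1 ≤ (C₁ + C₂ + 1) * (L * L + L + 1) := by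
    nlinarith [mul_nonneg hL hL, mul_nonneg hC₁ hL, mul_nonneg hC₂ hL,
      mul_nonneg hC₁ (mul_nonneg hL hL), mul_nonneg hC₂ (mul_nonneg hL hL)]
  refine ⟨hp, fun n => ?_, fun n => ?_, fun l => ?_, fun j l => ?_, fun n hn j l => ?_⟩
  · have h1 := abs_sub_abs_le_abs_sub (φ₁ (n * modelProb f θ B)) (φ₁ (n * modelProb f θ₀ B))
    have h2 := hg₁ _ (hz n)
    have h3 := s1 n
    have h4 : 0 ≤ 1 + (n * modelProb f θ₀ B) ^ 2 := by positivity
    nlinarith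
  · have h1 := abs_sub_abs_le_abs_sub (φ₂ (n * modelProb f θ B)) (φ₂ (n * modelProb f θ₀ B))
    have h2 := hg₂ _ (hz n)
    have h3 := s2 n
    have h4 : 0 ≤ 1 + (n * modelProb f θ₀ B) ^ 2 := by positivity
    nlinarith
  · refine lintegral_enorm_div_le hBm (hint θ hθ) hp (fun y hy => ⟨(hreg' θ hθ y hy).pos,
      (hreg' θ hθ y hy).fst l⟩) ?_
    linarith [(hLK x hx).1 l]
  · refine lintegral_enorm_div_le hBm (hint θ hθ) hp (fun y hy => ⟨(hreg' θ hθ y hy).pos,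
      (hreg' θ hθ y hy).snd j l⟩) ?_
    linarith [(hLK x hx).2 j l]
  · have hzn : (0 : ℝ) < n * modelProb f θ B := mul_pos (Nat.cast_pos.2 hn) hp
    rw [ballJac, limJac, hh.deriv_mul _ hzn, hh.deriv_deriv_mul _ hzn]
    have h4 : 0 ≤ 1 + (n * modelProb f θ₀ B) ^ 2 := by positivity
    refine (abs_jac_sub_le (C := C₁ + C₂) (L := L) (ε := ε') (κ := κ) h4 hκpos.le hκ1 hε'pos.le
      (by positivity) (s1 n) (s2 n) ((hg₁ _ (hz n)).trans ?_) ((hg₂ _ (hz n)).trans ?_)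
      (r1 l) (r1 j) (r2 l j) ((hLK x hx).1 l) ((hLK x hx).1 j) ((hLK x hx).2 l j)).trans ?_
    · exact mul_le_mul_of_nonneg_right (by linarith) h4
    · exact mul_le_mul_of_nonneg_right (by linarith) h4
    · refine mul_le_mul_of_nonneg_right ?_ h4
      have h5 : κ * ((C₁ + C₂) * (2 * L + 2)) ≤ ε' * ((C₁ + C₂) * (2 * L + 2)) :=
        mul_le_mul_of_nonneg_right (min_le_right _ _) (by positivity)
      have h6 : ε' * D ≤ ε := by
        rw [← le_div_iff₀ hDpos]; exact min_le_right _ _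
      rw [hD] at h6
      linarith

end GMSP

namespace GMSP

/-! ### Probability integral transform -/

theorem continuous_cdf (m : Measure ℝ) [IsProbabilityMeasure m] [NullSingletonClass m] :
    Continuous (cdf m) := by
  refine continuous_iff_continuousAt.2 fun x => ?_
  rw [(cdf m).mono.continuousAt_iff_leftLim_eq_rightLim, (cdf m).rightLim_eq]
  have h : m {x} = 0 := measure_singleton x
  rw [← measure_cdf (μ := m), StieltjesFunction.measure_singleton, ENNReal.ofReal_eq_zero] at h
  exact le_antisymm ((cdf m).mono.leftLim_le le_rfl) (by linarith)

/-- A continuous distribution function evaluated at its own variable is uniform. The sublevel set is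
empty or a half-line, bounded because `t < 1`; by the intermediate value theorem the function equals
`t` at its end point. -/
theorem measure_cdf_le (m : Measure ℝ) [IsProbabilityMeasure m] [NullSingletonClass m] {t : ℝ}
    (ht1 : t < 1) : m {r | cdf m r ≤ t} = ENNReal.ofReal t := by
  have hc := continuous_cdf m
  set S := {r | cdf m r ≤ t} with hS
  obtain ⟨M, hM⟩ := ((tendsto_cdf_atTop m).eventually_const_lt ht1).exists
  have hbdd : BddAbove S := ⟨M, fun r hr => by
    by_contra hlt
    exact absurd (hM.trans_le ((cdf m).mono (not_le.1 hlt).le)) (not_lt.2 hr)⟩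
  have hclosed : IsClosed S := isClosed_le hc continuous_const
  rcases S.eq_empty_or_nonempty with he | hne
  · have h0 : t ≤ 0 := ge_of_tendsto (tendsto_cdf_atBot m) (Eventually.of_forall fun r => by
      by_contra hlt
      have : r ∈ S := (not_le.1 hlt).le
      rw [he] at this
      exact this)
    rw [he, measure_empty, ENNReal.ofReal_of_nonpos h0]
  · have hmem : sSup S ∈ S := hclosed.csSup_mem hne hbdd
    have hSeq : S = Iic (sSup S) := by
      ext r
      exact ⟨fun hr => le_csSup hbdd hr, fun hr => ((cdf m).mono hr).trans hmem⟩
    have hval : cdf m (sSup S) = t := by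
      refine le_antisymm hmem ?_
      have hlt : sSup S ≤ M := by
        by_contra hlt
        exact absurd (hM.trans_le ((cdf m).mono (not_le.1 hlt).le)) (not_lt.2 hmem)
      obtain ⟨r, hr, hrt⟩ := intermediate_value_Icc hlt hc.continuousOn ⟨hmem, hM.le⟩
      exact hrt.symm.le.trans ((cdf m).mono (le_csSup hbdd hrt.le))
    rw [hSeq, ← ofReal_cdf, hval]

variable {d : ℕ}

theorem measurable_measureReal_closedBall (μ : Measure (E d)) [IsFiniteMeasure μ] :
    Measurable fun p : E d × ℝ => μ.real (Metric.closedBall p.1 p.2) := by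
  have hs : MeasurableSet {q : (E d × ℝ) × E d | dist q.2 q.1.1 ≤ q.1.2} :=
    measurableSet_le (by fun_prop) (by fun_prop)
  exact (measurable_measure_prodMk_left (ν := μ) hs).ennreal_toReal

/-- The pairs `(x, y)` such that the ball around `x` with `y` on its boundary has probability
at most `t`. -/
def nearSet (μ : Measure (E d)) (t : ℝ) : Set (E d × E d) :=
  {p | μ.real (Metric.closedBall p.1 (dist p.1 p.2)) ≤ t}

theorem measurableSet_nearSet (μ : Measure (E d)) [IsFiniteMeasure μ] (t : ℝ) :
    MeasurableSet (nearSet μ t) := by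
  have hs : MeasurableSet {q : (E d × E d) × E d | dist q.2 q.1.1 ≤ dist q.1.1 q.1.2} :=
    measurableSet_le (by fun_prop) (by fun_prop)
  have h := (measurable_measure_prodMk_left (ν := μ) hs).ennreal_toReal
  exact h measurableSet_Iic

/-- The distance to `x` has no atoms since spheres are null, and its distribution function at `r` is
the probability of the ball of radius `r`. The probability of the ball reaching to a random point is
therefore uniform, whatever `x` is. -/
theorem measure_nearSet (μ : Measure (E d)) [IsProbabilityMeasure μ]
    (hμ : ∀ x r, μ (Metric.sphere x r) = 0) (x : E d) {t : ℝ} (ht1 : t < 1) :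
    μ (Prod.mk x ⁻¹' nearSet μ t) = ENNReal.ofReal t := by
  have hd : Measurable (dist x) := by fun_prop
  have : IsProbabilityMeasure (μ.map (dist x)) := Measure.isProbabilityMeasure_map hd.aemeasurable
  have : NullSingletonClass (μ.map (dist x)) := ⟨fun r => by
    rw [Measure.map_apply hd (measurableSet_singleton r), ← hμ x r]
    congr 1
    ext y
    simp only [mem_preimage, mem_singleton_iff, Metric.mem_sphere, dist_comm]⟩
  have hcdf : ∀ r, cdf (μ.map (dist x)) r = μ.real (Metric.closedBall x r) := fun r => by
    rw [cdf_eq_real, measureReal_def, measureReal_def, Measure.map_apply hd measurableSet_Iic]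
    congr 2
    ext y
    simp only [mem_preimage, mem_Iic, Metric.mem_closedBall, dist_comm]
  have key := measure_cdf_le (μ.map (dist x)) ht1
  rw [Measure.map_apply hd (measurableSet_le (continuous_cdf _).measurable measurable_const)] at key
  rw [← key]
  congr 1
  ext y
  simp [nearSet, hcdf]

theorem measure_nearSet_compl (μ : Measure (E d)) [IsProbabilityMeasure μ]
    (hμ : ∀ x r, μ (Metric.sphere x r) = 0) (x : E d) {t : ℝ} (ht : 0 ≤ t)
    (ht1 : t < 1) :
    μ (Prod.mk x ⁻¹' (nearSet μ t)ᶜ) = ENNReal.ofReal (1 - t) := by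
  rw [preimage_compl, prob_compl_eq_one_sub (measurable_prodMk_left (measurableSet_nearSet μ t)),
    measure_nearSet μ hμ x ht1, ENNReal.ofReal_sub _ ht, ENNReal.ofReal_one]

/-! ### Independent samples -/

variable {Ω : Type*} [MeasurableSpace Ω] {P : Measure Ω}
  {ξ : ℕ → Ω → E d} {μ : Measure (E d)}

/-- `ξ 0, ξ 1, …` are independent with common law `μ`. -/
structure IsIID (P : Measure Ω) (ξ : ℕ → Ω → E d) (μ : Measure (E d)) : Prop where
  measurable : ∀ i, Measurable (ξ i)
  indep : iIndepFun ξ P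
  law : ∀ i, P.map (ξ i) = μ

namespace IsIID

theorem precomp (hξ : IsIID P ξ μ) {σ : ℕ → ℕ} (hσ : σ.Injective) :
    IsIID P (fun i => ξ (σ i)) μ :=
  ⟨fun _ => hξ.measurable _, hξ.indep.precomp hσ, fun _ => hξ.law _⟩

theorem isProbabilityMeasure [IsProbabilityMeasure P] (hξ : IsIID P ξ μ) : IsProbabilityMeasure μ :=
  hξ.law 0 ▸ Measure.isProbabilityMeasure_map (hξ.measurable 0).aemeasurable

theorem map_finset [IsProbabilityMeasure P] (hξ : IsIID P ξ μ) (J : Finset ℕ) :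
    P.map (fun ω (i : J) => ξ i ω) = Measure.pi fun _ => μ := by
  have h := iIndepFun.map_fun_eq_pi_map (f := fun i : J => ξ i)
    (fun i => (hξ.measurable i).aemeasurable) (hξ.indep.precomp Subtype.val_injective)
  simpa only [hξ.law] using h

theorem map_pair [IsProbabilityMeasure P] (hξ : IsIID P ξ μ) {i j : ℕ} (hij : i ≠ j) :
    P.map (fun ω => (ξ i ω, ξ j ω)) = μ.prod μ := by
  have := (hξ.indep.indepFun hij).map_prod_eq_prod_map_map (hξ.measurable i).aemeasurable
    (hξ.measurable j).aemeasurable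
  rw [this, hξ.law, hξ.law]

/-- Conditioning on `U`, which is independent of the `ξ k`, `k ∈ J`. -/
theorem map_restrict [IsProbabilityMeasure P] (hξ : IsIID P ξ μ) {β : Type*} [MeasurableSpace β]
    {U : Ω → β} (hU : Measurable U) {J : Finset ℕ} (hind : IndepFun U (fun ω (j : J) => ξ j ω) P)
    {A : Set (β × E d)} (hA : MeasurableSet A) :
    (P.restrict {ω | ∀ k ∈ J, (U ω, ξ k ω) ∈ A}).map U =
      (P.map U).withDensity fun u => μ (Prod.mk u ⁻¹' A) ^ J.card := by
  have := hξ.isProbabilityMeasure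
  have hV : Measurable fun ω (j : J) => ξ j ω := measurable_pi_lambda _ fun j => hξ.measurable j
  ext s hs
  have hS : MeasurableSet {p : β × (J → E d) | p.1 ∈ s ∧ ∀ k, (p.1, p.2 k) ∈ A} := by
    have h1 : MeasurableSet (⋂ k : J, (fun p : β × (J → E d) => (p.1, p.2 k)) ⁻¹' A) :=
      MeasurableSet.iInter fun k =>
        (measurable_fst.prodMk ((measurable_pi_apply k).comp measurable_snd)) hA
    convert (measurable_fst hs).inter h1 using 1
    ext p
    simp
  have hlaw : P.map (fun ω => (U ω, fun j : J => ξ j ω)) =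
      (P.map U).prod (Measure.pi fun _ : J => μ) := by
    rw [hind.map_prod_eq_prod_map_map hU.aemeasurable hV.aemeasurable, hξ.map_finset]
  have : IsProbabilityMeasure (P.map U) := Measure.isProbabilityMeasure_map hU.aemeasurable
  rw [Measure.map_apply hU hs, Measure.restrict_apply (hU hs), withDensity_apply _ hs,
    ← lintegral_indicator hs]
  have h1 : U ⁻¹' s ∩ {ω | ∀ k ∈ J, (U ω, ξ k ω) ∈ A} =
      (fun ω => (U ω, fun j : J => ξ j ω)) ⁻¹'
        {p : β × (J → E d) | p.1 ∈ s ∧ ∀ k, (p.1, p.2 k) ∈ A} := by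
    ext ω
    simp
  rw [h1, ← Measure.map_apply (hU.prodMk hV) hS, hlaw, Measure.prod_apply hS]
  refine lintegral_congr fun u => ?_
  by_cases hu : u ∈ s
  · rw [indicator_of_mem hu]
    have h2 : Prod.mk u ⁻¹' {p : β × (J → E d) | p.1 ∈ s ∧ ∀ k, (p.1, p.2 k) ∈ A} =
        univ.pi fun _ => Prod.mk u ⁻¹' A := by
      ext v
      simp [hu]
    rw [h2, Measure.pi_pi]
    simp
  · rw [indicator_of_notMem hu]
    have h2 : Prod.mk u ⁻¹' {p : β × (J → E d) | p.1 ∈ s ∧ ∀ k, (p.1, p.2 k) ∈ A} = ∅ := by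
      ext v
      simp [hu]
    rw [h2, measure_empty]

theorem indepFun_of_finset (hξ : IsIID P ξ μ) {β : Type*} [MeasurableSpace β] {S J : Finset ℕ}
    (hSJ : Disjoint S J) {g : (S → E d) → β} (hg : Measurable g) :
    IndepFun (fun ω => g fun i => ξ i ω) (fun ω (j : J) => ξ j ω) P :=
  (hξ.indep.indepFun_finset S J hSJ hξ.measurable).comp hg measurable_id

end IsIID

/-! ### Nearest neighbour distances -/

theorem nonempty_others {n : ℕ} (hn : 2 ≤ n) (i : ℕ) : Nonempty {j : ℕ // j < n ∧ j ≠ i} := by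
  rcases eq_or_ne i 0 with rfl | h
  · exact ⟨⟨1, by omega, by omega⟩⟩
  · exact ⟨⟨0, by omega, h.symm⟩⟩

end GMSP

/-! ### The law of the probability content of nearest neighbour balls. -/

namespace GMSP

variable {d : ℕ} {Ω : Type*} {ξ : ℕ → Ω → E d}

theorem nnDist_nonneg (ξ : ℕ → Ω → E d) (n i : ℕ) (ω : Ω) : 0 ≤ nnDist ξ n i ω :=
  Real.iInf_nonneg fun _ => dist_nonneg

theorem finite_others (n i : ℕ) : Finite {j : ℕ // j < n ∧ j ≠ i} :=
  ((finite_lt_nat n).subset fun _ h => h.1).to_subtype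

theorem exists_dist_eq_nnDist {n : ℕ} (hn : 2 ≤ n) (i : ℕ) (ω : Ω) :
    ∃ j, j < n ∧ j ≠ i ∧ dist (ξ i ω) (ξ j ω) = nnDist ξ n i ω := by
  have := nonempty_others hn i
  have := finite_others n i
  obtain ⟨j, hj⟩ := exists_eq_ciInf_of_finite
    (f := fun j : {j : ℕ // j < n ∧ j ≠ i} => dist (ξ i ω) (ξ j ω))
  exact ⟨j, j.2.1, j.2.2, hj⟩

theorem nnDist_le {n i j : ℕ} (hj : j < n) (hji : j ≠ i) (ω : Ω) :
    nnDist ξ n i ω ≤ dist (ξ i ω) (ξ j ω) := by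
  have := finite_others n i
  exact ciInf_le (f := fun j : {j : ℕ // j < n ∧ j ≠ i} => dist (ξ i ω) (ξ j ω))
    (finite_range _).bddBelow ⟨j, hj, hji⟩

theorem lt_nnDist_iff {n : ℕ} (hn : 2 ≤ n) (i : ℕ) (ω : Ω) (r : ℝ) :
    r < nnDist ξ n i ω ↔ ∀ j, j < n → j ≠ i → r < dist (ξ i ω) (ξ j ω) := by
  refine ⟨fun h j hj hji => h.trans_le (nnDist_le hj hji ω), fun h => ?_⟩
  obtain ⟨j, hj, hji, e⟩ := exists_dist_eq_nnDist (ξ := ξ) hn i ω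
  exact e ▸ h j hj hji

/-- The normalized probability `n μ(B_n(ξ_i))` of the nearest neighbour ball. -/
noncomputable def nnZ (μ : Measure (E d)) (ξ : ℕ → Ω → E d) (n i : ℕ) (ω : Ω) : ℝ :=
  n * μ.real (nnBall ξ n i ω)

theorem nnZ_nonneg (μ : Measure (E d)) (ξ : ℕ → Ω → E d) (n i : ℕ) (ω : Ω) :
    0 ≤ nnZ μ ξ n i ω := by
  unfold nnZ; positivity

theorem nnZ_le (μ : Measure (E d)) [IsProbabilityMeasure μ] (ξ : ℕ → Ω → E d) (n i : ℕ) (ω : Ω) :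
    nnZ μ ξ n i ω ≤ n :=
  mul_le_of_le_one_right (Nat.cast_nonneg n) measureReal_le_one

/-- The minimal distance is attained and ball probabilities increase with the radius, so a condition
on the minimum is the same condition on every other point. Given `ξ_i`, it becomes an intersection
of independent events. -/
theorem lt_nnZ_iff {μ : Measure (E d)} [IsFiniteMeasure μ] {n : ℕ} (hn : 2 ≤ n) (i : ℕ) (ω : Ω)
    (s : ℝ) : s < nnZ μ ξ n i ω ↔
      ∀ j ∈ (Finset.range n).erase i, (ξ i ω, ξ j ω) ∈ (nearSet μ (s / n))ᶜ := by
  have hn0 : (0 : ℝ) < n := by positivity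
  have key : ∀ r, (s < n * μ.real (Metric.closedBall (ξ i ω) r)) ↔
      s / n < μ.real (Metric.closedBall (ξ i ω) r) := fun r => by rw [div_lt_iff₀' hn0]
  rw [nnZ, nnBall, key]
  simp only [nearSet, mem_compl_iff, mem_ofPred_eq, not_le, Finset.mem_erase, Finset.mem_range]
  refine ⟨fun h j hj => h.trans_le (measureReal_mono (Metric.closedBall_subset_closedBall
    (nnDist_le hj.2 hj.1 ω))), fun h => ?_⟩
  obtain ⟨j, hj, hji, e⟩ := exists_dist_eq_nnDist (ξ := ξ) hn i ω
  exact e ▸ h j ⟨hji, hj⟩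

/-- Besides `1 - u ≤ exp(-u)`, this uses `(n - 1) / n ≥ 1/2`; the resulting tail bound does not
depend on `n`. -/
theorem one_sub_div_pow_le {n : ℕ} (hn : 2 ≤ n) {s : ℝ} (hs : 0 ≤ s) (hsn : s < n) :
    (1 - s / n) ^ (n - 1) ≤ Real.exp (-(s / 2)) := by
  have hn0 : (0 : ℝ) < n := by positivity
  have h1 : 0 ≤ 1 - s / n := by
    rw [sub_nonneg, div_le_one hn0]; exact hsn.le
  have h2 : 1 - s / n ≤ Real.exp (-(s / n)) := by
    have := Real.add_one_le_exp (-(s / n)); linarith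
  refine (pow_le_pow_left₀ h1 h2 _).trans ?_
  rw [← Real.exp_nat_mul]
  refine Real.exp_le_exp.2 ?_
  have h3 : (2 : ℝ) ≤ n := by exact_mod_cast hn
  rw [Nat.cast_sub (by omega), Nat.cast_one, mul_neg, neg_le_neg_iff, div_le_iff₀ two_pos]
  have : (n - 1 : ℝ) * (s / n) * 2 = s + s * ((n - 2) / n) := by field_simp; ring
  rw [this]
  have : 0 ≤ s * ((n - 2) / n) := mul_nonneg hs (div_nonneg (by linarith) hn0.le)
  linarith

variable [MeasurableSpace Ω] {P : Measure Ω} {μ : Measure (E d)}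

namespace IsIID

theorem measurable_nnDist (hξ : IsIID P ξ μ) (n i : ℕ) : Measurable (nnDist ξ n i) :=
  Measurable.iInf fun j => (hξ.measurable i).dist (hξ.measurable j)

theorem measurable_nnZ [IsFiniteMeasure μ] (hξ : IsIID P ξ μ) (n i : ℕ) :
    Measurable (nnZ μ ξ n i) :=
  ((measurable_measureReal_closedBall μ).comp
    ((hξ.measurable i).prodMk (hξ.measurable_nnDist n i))).const_mul _

variable [IsProbabilityMeasure P]

/-- Each of the other `n - 1` points lies outside the small ball with probability `1 - s/n`,
whatever the value of `ξ_i`. Hence conditioning on the event leaves the law of `ξ_i` unchanged: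
`ξ_i` and `nnZ` are independent. -/
theorem map_restrict_lt_nnZ (hξ : IsIID P ξ μ) (hμ : ∀ x r, μ (Metric.sphere x r) = 0) {n i : ℕ}
    (hn : 2 ≤ n) (hi : i < n) {s : ℝ} (hs : 0 ≤ s) (hsn : s < n) :
    (P.restrict {ω | s < nnZ μ ξ n i ω}).map (ξ i) =
      ENNReal.ofReal ((1 - s / n) ^ (n - 1)) • μ := by
  have := hξ.isProbabilityMeasure
  have hn0 : (0 : ℝ) < n := by positivity
  have hset : {ω | s < nnZ μ ξ n i ω} =
      {ω | ∀ k ∈ (Finset.range n).erase i, (ξ i ω, ξ k ω) ∈ (nearSet μ (s / n))ᶜ} := by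
    ext ω; exact lt_nnZ_iff hn i ω s
  have hind : IndepFun (ξ i) (fun ω (j : (Finset.range n).erase i) => ξ j ω) P := by
    refine hξ.indepFun_of_finset (S := {i}) (J := (Finset.range n).erase i) (by simp)
      (g := fun x => x ⟨i, by simp⟩) (measurable_pi_apply _)
  have hsn1 : s / n < 1 := (div_lt_one hn0).2 hsn
  rw [hset, hξ.map_restrict (hξ.measurable i) hind (measurableSet_nearSet μ _).compl, hξ.law]
  simp_rw [measure_nearSet_compl μ hμ _ (div_nonneg hs hn0.le) hsn1]
  rw [withDensity_const, Finset.card_erase_of_mem (Finset.mem_range.2 hi), Finset.card_range,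
    ENNReal.ofReal_pow (by linarith)]

theorem measure_lt_nnZ_le (hξ : IsIID P ξ μ) (hμ : ∀ x r, μ (Metric.sphere x r) = 0) {n i : ℕ}
    (hn : 2 ≤ n) (hi : i < n) {s : ℝ} (hs : 0 ≤ s) :
    P {ω | s < nnZ μ ξ n i ω} ≤ ENNReal.ofReal (Real.exp (-(s / 2))) := by
  have := hξ.isProbabilityMeasure
  rcases lt_or_ge s n with hsn | hsn
  · have h := congrArg (fun m => m univ) (hξ.map_restrict_lt_nnZ hμ hn hi hs hsn)
    simp only [Measure.map_apply (hξ.measurable i) MeasurableSet.univ, preimage_univ,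
      Measure.restrict_apply_univ, Measure.smul_apply, measure_univ, smul_eq_mul, mul_one] at h
    rw [h]
    exact ENNReal.ofReal_le_ofReal (one_sub_div_pow_le hn hs hsn)
  · have : {ω | s < nnZ μ ξ n i ω} = ∅ := by
      ext ω
      simpa using (nnZ_le μ ξ n i ω).trans hsn
    rw [this, measure_empty]
    exact zero_le

theorem ae_ne (hξ : IsIID P ξ μ) (hμ : ∀ x r, μ (Metric.sphere x r) = 0) {i j : ℕ} (hij : i ≠ j) :
    ∀ᵐ ω ∂P, ξ i ω ≠ ξ j ω := by
  have := hξ.isProbabilityMeasure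
  have hm : MeasurableSet {p : E d × E d | p.1 = p.2} :=
    measurableSet_eq_fun measurable_fst measurable_snd
  have h : (μ.prod μ) {p : E d × E d | p.1 = p.2} = 0 := by
    rw [Measure.measure_prod_null hm]
    refine Eventually.of_forall fun x => ?_
    have : Prod.mk x ⁻¹' {p : E d × E d | p.1 = p.2} = Metric.sphere x 0 := by
      ext y; simp [eq_comm]
    simp only [this, hμ, Pi.zero_apply]
  rw [← hξ.map_pair hij, Measure.map_apply ((hξ.measurable i).prodMk (hξ.measurable j)) hm] at h
  exact measure_eq_zero_iff_ae_notMem.1 h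

theorem ae_nnDist_pos (hξ : IsIID P ξ μ) (hμ : ∀ x r, μ (Metric.sphere x r) = 0) {n : ℕ}
    (hn : 2 ≤ n) (i : ℕ) : ∀ᵐ ω ∂P, 0 < nnDist ξ n i ω := by
  have : ∀ᵐ ω ∂P, ∀ j, j ≠ i → ξ i ω ≠ ξ j ω := by
    refine ae_all_iff.2 fun j => ?_
    by_cases h : j = i
    · simp [h]
    · filter_upwards [hξ.ae_ne hμ (Ne.symm h)] with ω hω _ using hω
  filter_upwards [this] with ω hω
  exact (lt_nnDist_iff hn i ω 0).2 fun j _ hji => dist_pos.2 (hω j hji)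

theorem ae_nnZ_pos (hξ : IsIID P ξ μ) (hμ : ∀ x r, μ (Metric.sphere x r) = 0) {n i : ℕ}
    (hn : 2 ≤ n) (hi : i < n) : ∀ᵐ ω ∂P, 0 < nnZ μ ξ n i ω := by
  have := hξ.isProbabilityMeasure
  have hn0 : (0 : ℝ) < n := by positivity
  have h := congrArg (fun m => m univ) (hξ.map_restrict_lt_nnZ hμ hn hi le_rfl hn0)
  simp only [Measure.map_apply (hξ.measurable i) MeasurableSet.univ, preimage_univ,
    Measure.restrict_apply_univ, Measure.smul_apply, measure_univ, smul_eq_mul, mul_one, zero_div,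
    sub_zero, one_pow, ENNReal.ofReal_one] at h
  exact (prob_compl_eq_zero_iff (measurableSet_lt measurable_const (hξ.measurable_nnZ n i))).2 h

end IsIID

theorem summable_fourth_moment :
    Summable fun m : ℕ => ((m : ℝ) + 1) ^ 4 * Real.exp (-((m : ℝ) / 2)) := by
  have h := (summable_nat_add_iff 1).2
    (Real.summable_pow_mul_exp_neg_nat_mul 4 (r := 1 / 2) (by norm_num))
  refine (h.mul_right (Real.exp (1 / 2))).congr fun m => ?_
  rw [mul_assoc, ← Real.exp_add]
  push_cast
  ring_nf

/-- A bound for the fourth moments of the normalized probabilities of nearest neighbour balls. -/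
noncomputable def fourthMoment : ℝ := ∑' m : ℕ, ((m : ℝ) + 1) ^ 4 * Real.exp (-((m : ℝ) / 2))

theorem fourthMoment_nonneg : 0 ≤ fourthMoment := tsum_nonneg fun m => by positivity

/-- The envelope is of order `1 + nnZ²` and must be square integrable, hence the exponent `4`. The
moment is dominated by a sum over unit layers, weighted by the exponential tails. -/
theorem IsIID.lintegral_nnZ_pow_four_le [IsProbabilityMeasure P] (hξ : IsIID P ξ μ)
    (hμ : ∀ x r, μ (Metric.sphere x r) = 0) {n i : ℕ} (hn : 2 ≤ n) (hi : i < n) :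
    ∫⁻ ω, ENNReal.ofReal (nnZ μ ξ n i ω ^ 4) ∂P ≤ ENNReal.ofReal fourthMoment := by
  have := hξ.isProbabilityMeasure
  have hms : ∀ s : ℝ, MeasurableSet {ω | s < nnZ μ ξ n i ω} := fun s =>
    measurableSet_lt measurable_const (hξ.measurable_nnZ n i)
  have hle : ∀ ω, ENNReal.ofReal (nnZ μ ξ n i ω ^ 4) ≤ ∑' m : ℕ,
      {ω | (m : ℝ) < nnZ μ ξ n i ω}.indicator (fun _ => ENNReal.ofReal (((m : ℝ) + 1) ^ 4)) ω := by
    intro ω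
    have hz := nnZ_nonneg μ ξ n i ω
    rcases hz.eq_or_lt with h | h
    · simp [← h]
    -- The layer `m = k - 1` alone suffices: it lies below `nnZ`, and `m + 1 = k` lies above.
    set k := ⌈nnZ μ ξ n i ω⌉₊ with hk
    have hk1 : 1 ≤ k := Nat.one_le_iff_ne_zero.2 (Nat.ceil_pos.2 h).ne'
    have h1 : ((k - 1 : ℕ) : ℝ) < nnZ μ ξ n i ω := Nat.lt_ceil.1 (by omega)
    refine le_trans ?_ (ENNReal.le_tsum (k - 1))
    rw [indicator_of_mem (by exact h1)]
    refine ENNReal.ofReal_le_ofReal (pow_le_pow_left₀ hz ?_ 4)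
    rw [Nat.cast_sub hk1, Nat.cast_one, sub_add_cancel]
    exact Nat.le_ceil _
  calc ∫⁻ ω, ENNReal.ofReal (nnZ μ ξ n i ω ^ 4) ∂P
      ≤ ∫⁻ ω, ∑' m : ℕ, {ω | (m : ℝ) < nnZ μ ξ n i ω}.indicator
          (fun _ => ENNReal.ofReal (((m : ℝ) + 1) ^ 4)) ω ∂P := lintegral_mono hle
    _ = ∑' m : ℕ, ENNReal.ofReal (((m : ℝ) + 1) ^ 4) * P {ω | (m : ℝ) < nnZ μ ξ n i ω} := by
        rw [lintegral_tsum fun m : ℕ => (measurable_const.indicator (hms (m : ℝ))).aemeasurable]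
        exact tsum_congr fun m => lintegral_indicator_const (hms m) _
    _ ≤ ∑' m : ℕ, ENNReal.ofReal (((m : ℝ) + 1) ^ 4 * Real.exp (-((m : ℝ) / 2))) := by
        refine ENNReal.tsum_le_tsum fun m => ?_
        rw [ENNReal.ofReal_mul (by positivity)]
        gcongr
        exact hξ.measure_lt_nnZ_le hμ hn hi (Nat.cast_nonneg m)
    _ = ENNReal.ofReal fourthMoment :=
        (ENNReal.ofReal_tsum_of_nonneg (fun m => by positivity) summable_fourth_moment).symm

/-! ### Samples with a density -/

/-- The law with density `g`. -/
noncomputable def densityLaw (g : E d → ℝ) : Measure (E d) :=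
  volume.withDensity fun x => ENNReal.ofReal (g x)

theorem IsIIDSample.isIID {g : E d → ℝ} (hξ : IsIIDSample P ξ g) : IsIID P ξ (densityLaw g) :=
  ⟨hξ.measurable, hξ.indep, hξ.law⟩

theorem densityLaw_sphere (hd : 0 < d) (g : E d → ℝ) (x : E d) (r : ℝ) :
    densityLaw g (Metric.sphere x r) = 0 := by
  have : Nonempty (Fin d) := ⟨⟨0, hd⟩⟩
  exact withDensity_absolutelyContinuous _ _ (Measure.addHaar_sphere volume x r)

theorem integrable_of_lintegral_eq_one {g : E d → ℝ} (hm : Measurable g) (h0 : ∀ x, 0 ≤ g x)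
    (h1 : ∫⁻ x, ENNReal.ofReal (g x) = 1) : Integrable g :=
  ⟨hm.aestronglyMeasurable, by
    rw [hasFiniteIntegral_iff_ofReal (Eventually.of_forall h0), h1]; exact ENNReal.one_lt_top⟩

theorem densityLaw_real {g : E d → ℝ} (hm : Measurable g) (h0 : ∀ x, 0 ≤ g x)
    {B : Set (E d)} (hB : MeasurableSet B) : (densityLaw g).real B = ∫ y in B, g y := by
  rw [measureReal_def, densityLaw, withDensity_apply _ hB,
    integral_eq_lintegral_of_nonneg_ae (Eventually.of_forall h0) hm.aestronglyMeasurable]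

end GMSP

/-! ### Score and envelope of a single ball. -/

namespace GMSP

variable {q d : ℕ}

/-- The supremum over `θ ∈ T` of the average of `|u_θ|` over `B` relative to `f_θ`. -/
noncomputable def ballSup (f u : E q → E d → ℝ) (T : Set (E q)) (B : Set (E d)) : ℝ≥0∞ :=
  ⨆ θ ∈ T, (∫⁻ y in B, ‖u θ y‖ₑ) / ENNReal.ofReal (modelProb f θ B)

/-- The envelope associated with the ball `B`. -/
noncomputable def ballEnvelope (h : ℝ → ℝ) (f : E q → E d → ℝ) (n : ℕ) (T : Set (E q))
    (B : Set (E d)) : ℝ≥0∞ :=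
  (q : ℝ≥0∞) *
    ((⨆ θ ∈ T, ‖deriv (deriv h) (n * modelProb f θ B) * (n * modelProb f θ B) ^ 2‖ₑ) *
        (⨆ l : Fin q, ballSup f (pd f l) T B) ^ 2 +
      (⨆ θ ∈ T, ‖deriv h (n * modelProb f θ B) * (n * modelProb f θ B)‖ₑ) *
        ⨆ j : Fin q, ⨆ l : Fin q, ballSup f (pd (pd f l) j) T B)

theorem modelProb_of_volume_eq_zero {f : E q → E d → ℝ} {B : Set (E d)} (hB : volume B = 0)
    (θ : E q) : modelProb f θ B = 0 := by
  rw [modelProb, Measure.restrict_eq_zero.2 hB, integral_zero_measure]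

/-- Coinciding sample points give balls of radius zero. The Lipschitz bound is asserted at every
`ω`, so this case cannot be discarded as a null event. -/
theorem ballPsi_of_volume_eq_zero (h : ℝ → ℝ) {f : E q → E d → ℝ} (n : ℕ) {B : Set (E d)}
    (hB : volume B = 0) (θ : E q) : ballPsi h f n B θ = 0 := by
  ext j
  simp [ballPsi, modelProb_of_volume_eq_zero hB]

theorem ballEnvelope_of_volume_eq_zero (h : ℝ → ℝ) {f : E q → E d → ℝ} (n : ℕ) (T : Set (E q))
    {B : Set (E d)} (hB : volume B = 0) : ballEnvelope h f n T B = 0 := by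
  simp [ballEnvelope, modelProb_of_volume_eq_zero hB]

variable {Θ Θ₀ : Set (E q)} {θ₀ : E q} {f : E q → E d → ℝ} {h φ₁ φ₂ : ℝ → ℝ}

theorem enorm_integral_div_le {u : E d → ℝ} {B : Set (E d)} {p : ℝ} (hp : 0 < p) :
    ‖(∫ y in B, u y) / p‖ₑ ≤ (∫⁻ y in B, ‖u y‖ₑ) / ENNReal.ofReal p := by
  rw [div_eq_mul_inv, enorm_mul, enorm_inv hp.ne', Real.enorm_of_nonneg hp.le, div_eq_mul_inv]
  gcongr
  exact enorm_integral_le_lintegral_enorm _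

theorem enorm_ballJac_le {n : ℕ} {T : Set (E q)} {B : Set (E d)} {θ : E q} (hθ : θ ∈ T)
    (hp : 0 < modelProb f θ B) (j l : Fin q) :
    ‖ballJac h f n B j l θ‖ₑ ≤
      (⨆ θ ∈ T, ‖deriv (deriv h) (n * modelProb f θ B) * (n * modelProb f θ B) ^ 2‖ₑ) *
        (⨆ l : Fin q, ballSup f (pd f l) T B) ^ 2 +
      (⨆ θ ∈ T, ‖deriv h (n * modelProb f θ B) * (n * modelProb f θ B)‖ₑ) *
        ⨆ j : Fin q, ⨆ l : Fin q, ballSup f (pd (pd f l) j) T B := by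
  have h1 : ∀ l, ‖(∫ y in B, pd f l θ y) / modelProb f θ B‖ₑ ≤
      ⨆ l : Fin q, ballSup f (pd f l) T B := fun l =>
    (enorm_integral_div_le hp).trans ((le_iSup₂ (f := fun θ (_ : θ ∈ T) =>
      (∫⁻ y in B, ‖pd f l θ y‖ₑ) / ENNReal.ofReal (modelProb f θ B)) θ hθ).trans
        (le_iSup (fun l => ballSup f (pd f l) T B) l))
  have h2 : ‖(∫ y in B, pd (pd f j) l θ y) / modelProb f θ B‖ₑ ≤
      ⨆ j : Fin q, ⨆ l : Fin q, ballSup f (pd (pd f l) j) T B :=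
    (enorm_integral_div_le hp).trans ((le_iSup₂ (f := fun θ (_ : θ ∈ T) =>
      (∫⁻ y in B, ‖pd (pd f j) l θ y‖ₑ) / ENNReal.ofReal (modelProb f θ B)) θ hθ).trans
        (le_iSup₂ (f := fun j l => ballSup f (pd (pd f l) j) T B) l j))
  refine (enorm_add_le _ _).trans (add_le_add ?_ ?_)
  · rw [enorm_mul, enorm_mul (_ / _) (_ / _), sq (⨆ l : Fin q, ballSup f (pd f l) T B)]
    exact mul_le_mul' (le_iSup₂ (f := fun θ (_ : θ ∈ T) =>
      ‖deriv (deriv h) (n * modelProb f θ B) * (n * modelProb f θ B) ^ 2‖ₑ) θ hθ)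
        (mul_le_mul' (h1 l) (h1 j))
  · rw [enorm_mul]
    exact mul_le_mul' (le_iSup₂ (f := fun θ (_ : θ ∈ T) =>
      ‖deriv h (n * modelProb f θ B) * (n * modelProb f θ B)‖ₑ) θ hθ) h2

/-- The envelope is `q` times a common bound for the entries of the Jacobian on `T`, so this is the
mean value inequality on the convex set `T`. -/
theorem enorm_ballPsi_sub_le (hh : IsRegularDivergence h φ₁ φ₂) (hA : AssumptionA2 Θ Θ₀ θ₀ f)
    {n : ℕ} (hn : 0 < n) {T : Set (E q)} (hT : Convex ℝ T) (hTΘ : T ⊆ Θ₀) {B : Set (E d)}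
    (hB : IsCompact B) (hp : ∀ θ ∈ T, 0 < modelProb f θ B) {s t : E q} (hs : s ∈ T)
    (ht : t ∈ T) :
    ‖ballPsi h f n B s - ballPsi h f n B t‖ₑ ≤ ballEnvelope h f n T B * ‖s - t‖ₑ := by
  rcases eq_or_ne s t with rfl | hst
  · simp
  rcases Nat.eq_zero_or_pos q with rfl | hq
  · exact absurd (Subsingleton.elim s t) hst
  have hst' : ‖s - t‖ₑ ≠ 0 := enorm_ne_zero.2 (sub_ne_zero.2 hst)
  unfold ballEnvelope
  have key := fun θ (hθ : θ ∈ T) j l => enorm_ballJac_le (h := h) (n := n) hθ (hp θ hθ) j l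
  revert key
  generalize (⨆ θ ∈ T, ‖deriv (deriv h) (n * modelProb f θ B) * (n * modelProb f θ B) ^ 2‖ₑ) *
        (⨆ l : Fin q, ballSup f (pd f l) T B) ^ 2 +
      (⨆ θ ∈ T, ‖deriv h (n * modelProb f θ B) * (n * modelProb f θ B)‖ₑ) *
        ⨆ j : Fin q, ⨆ l : Fin q, ballSup f (pd (pd f l) j) T B = M
  intro key
  -- An infinite bound is harmless since `q ≠ 0` and `s ≠ t`: the right side is then `∞` and not `0
  -- * ∞`.
  rcases eq_or_ne M ∞ with rfl | hM
  · rw [ENNReal.mul_top (Nat.cast_ne_zero.2 hq.ne'), ENNReal.top_mul hst']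
    exact le_top
  have h1 := norm_sub_le_of_jacobian_le hT (M := M.toReal) ENNReal.toReal_nonneg
    (fun θ hθ j => hasFDerivAt_ballPsi hh hA hn hB (hTΘ hθ) (hp θ hθ) j)
    (fun θ hθ j l => by
      rw [← Real.norm_eq_abs, ← toReal_enorm]
      exact ENNReal.toReal_mono hM (key θ hθ j l)) hs ht
  rw [← ofReal_norm, ← ofReal_norm (s - t), ← ENNReal.ofReal_toReal hM, ← ENNReal.ofReal_natCast,
    ← ENNReal.ofReal_mul (Nat.cast_nonneg q), ← ENNReal.ofReal_mul (by positivity)]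
  exact ENNReal.ofReal_le_ofReal h1

theorem ballEnvelope_le (hh : IsRegularDivergence h φ₁ φ₂) {n : ℕ} (hn : 0 < n) {T : Set (E q)}
    {x : E d} {B : Set (E d)} {C ε : ℝ} (hC : 0 ≤ C)
    (hr : ∀ θ ∈ T, IsScoreRegime h φ₁ φ₂ f θ₀ x C ε θ B) :
    ballEnvelope h f n T B ≤
      ENNReal.ofReal (q * (C ^ 3 + C ^ 2) * (1 + (n * modelProb f θ₀ B) ^ 2)) := by
  set s : ℝ := 1 + (n * modelProb f θ₀ B) ^ 2 with hs
  have hs0 : 0 ≤ s := by positivity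
  have hz : ∀ θ ∈ T, 0 < (n : ℝ) * modelProb f θ B := fun θ hθ =>
    mul_pos (Nat.cast_pos.2 hn) (hr θ hθ).pos
  have h1 : (⨆ θ ∈ T, ‖deriv (deriv h) (n * modelProb f θ B) * (n * modelProb f θ B) ^ 2‖ₑ) ≤
      ENNReal.ofReal (C * s) := iSup₂_le fun θ hθ => by
    rw [hh.deriv_deriv_mul _ (hz θ hθ), ← ofReal_norm]
    exact ENNReal.ofReal_le_ofReal ((hr θ hθ).phi₂ n)
  have h2 : (⨆ θ ∈ T, ‖deriv h (n * modelProb f θ B) * (n * modelProb f θ B)‖ₑ) ≤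
      ENNReal.ofReal (C * s) := iSup₂_le fun θ hθ => by
    rw [hh.deriv_mul _ (hz θ hθ), ← ofReal_norm]
    exact ENNReal.ofReal_le_ofReal ((hr θ hθ).phi₁ n)
  have h3 : (⨆ l : Fin q, ballSup f (pd f l) T B) ≤ ENNReal.ofReal C :=
    iSup_le fun l => iSup₂_le fun θ hθ => (hr θ hθ).fst l
  have h4 : (⨆ j : Fin q, ⨆ l : Fin q, ballSup f (pd (pd f l) j) T B) ≤ ENNReal.ofReal C :=
    iSup₂_le fun j l => iSup₂_le fun θ hθ => (hr θ hθ).snd j l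
  calc ballEnvelope h f n T B ≤ ENNReal.ofReal q * (ENNReal.ofReal (C * s) *
        ENNReal.ofReal C ^ 2 + ENNReal.ofReal (C * s) * ENNReal.ofReal C) := by
        rw [ENNReal.ofReal_natCast, ballEnvelope]
        gcongr
    _ = _ := by
        rw [← ENNReal.ofReal_pow hC, ← ENNReal.ofReal_mul (by positivity),
          ← ENNReal.ofReal_mul (by positivity), ← ENNReal.ofReal_add (by positivity)
          (by positivity), ← ENNReal.ofReal_mul (by positivity)]
        congr 1
        ring

/-- The linear map given by the limit of the Jacobian matrix of the score. -/
noncomputable def limLin (φ₁ φ₂ : ℝ → ℝ) (f : E q → E d → ℝ) (θ₀ : E q) (x : E d) (z : ℝ)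
    (v : E q) : E q :=
  WithLp.toLp 2 fun j => ∑ l, limJac φ₁ φ₂ f θ₀ x j l z * v l

theorem limLin_sub (x : E d) (z : ℝ) (v w : E q) :
    limLin φ₁ φ₂ f θ₀ x z (v - w) = limLin φ₁ φ₂ f θ₀ x z v - limLin φ₁ φ₂ f θ₀ x z w := by
  ext j
  simp [limLin, mul_sub]

/-- The mean value inequality is applied to the score minus a fixed linear map, whose Jacobian
entries on `T` are at most `ε (1 + z²)`. The same linear map works for all `s` and `t`, because
`limJac` does not involve the parameter. -/
theorem norm_ballPsi_sub_limLin_le (hh : IsRegularDivergence h φ₁ φ₂)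
    (hA : AssumptionA2 Θ Θ₀ θ₀ f) {n : ℕ} (hn : 0 < n) {T : Set (E q)} (hT : Convex ℝ T)
    (hTΘ : T ⊆ Θ₀) {x : E d} {B : Set (E d)} (hB : IsCompact B) {C ε : ℝ} (hε : 0 ≤ ε)
    (hr : ∀ θ ∈ T, IsScoreRegime h φ₁ φ₂ f θ₀ x C ε θ B) {s t : E q} (hs : s ∈ T) (ht : t ∈ T) :
    ‖ballPsi h f n B s - ballPsi h f n B t -
        limLin φ₁ φ₂ f θ₀ x (n * modelProb f θ₀ B) (s - t)‖ ≤
      q * (ε * (1 + (n * modelProb f θ₀ B) ^ 2)) * ‖s - t‖ := by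
  set z := (n : ℝ) * modelProb f θ₀ B with hz
  have key := norm_sub_le_of_jacobian_le hT
    (Φ := fun θ => ballPsi h f n B θ - limLin φ₁ φ₂ f θ₀ x z θ)
    (J := fun j l θ => ballJac h f n B j l θ - limJac φ₁ φ₂ f θ₀ x j l z)
    (M := ε * (1 + z ^ 2)) (by positivity) (fun θ hθ j => ?_)
    (fun θ hθ j l => (hr θ hθ).jac n hn j l) hs ht
  · rw [limLin_sub]
    rwa [sub_sub_sub_comm] at key
  · have h1 := hasFDerivAt_ballPsi hh hA hn hB (hTΘ hθ) (hr θ hθ).pos j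
    have h2 : HasFDerivAt (fun θ : E q => ∑ l, limJac φ₁ φ₂ f θ₀ x j l z * θ l)
        (∑ l, limJac φ₁ φ₂ f θ₀ x j l z • (EuclideanSpace.proj l : E q →L[ℝ] ℝ)) θ :=
      HasFDerivAt.fun_sum fun l _ =>
        ((EuclideanSpace.proj l : E q →L[ℝ] ℝ).hasFDerivAt (x := θ)).const_mul
          (limJac φ₁ φ₂ f θ₀ x j l z)
    refine (h1.sub h2).congr_fderiv ?_
    simp only [sub_smul, Finset.sum_sub_distrib]

end GMSP

namespace GMSP

/-! ### Measurability -/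

section Measurability

variable {q d : ℕ}

theorem measurableSet_mem_closedBall :
    MeasurableSet {p : (E d × ℝ) × E d | p.2 ∈ Metric.closedBall p.1.1 p.1.2} := by
  have : MeasurableSet {q : (E d × ℝ) × E d | dist q.2 q.1.1 ≤ q.1.2} :=
    measurableSet_le (by fun_prop) (by fun_prop)
  exact this

theorem measurable_setIntegral_closedBall {u : E d → ℝ} (hu : Measurable u) :
    Measurable fun p : E d × ℝ => ∫ y in Metric.closedBall p.1 p.2, u y := by
  have h1 : Measurable ({p : (E d × ℝ) × E d | p.2 ∈ Metric.closedBall p.1.1 p.1.2}.indicator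
      fun p => u p.2) := (hu.comp measurable_snd).indicator measurableSet_mem_closedBall
  have h2 := (h1.stronglyMeasurable.integral_prod_right' (ν := (volume : Measure (E d)))).measurable
  convert h2 using 2 with p
  rw [← integral_indicator Metric.isClosed_closedBall.measurableSet]
  rfl

theorem measurable_setLIntegral_closedBall {u : E d → ℝ≥0∞} (hu : Measurable u) :
    Measurable fun p : E d × ℝ => ∫⁻ y in Metric.closedBall p.1 p.2, u y := by
  have h1 : Measurable ({p : (E d × ℝ) × E d | p.2 ∈ Metric.closedBall p.1.1 p.1.2}.indicator
      fun p => u p.2) := (hu.comp measurable_snd).indicator measurableSet_mem_closedBall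
  have h2 := h1.lintegral_prod_right' (ν := (volume : Measure (E d)))
  convert h2 using 2 with p
  rw [← lintegral_indicator Metric.isClosed_closedBall.measurableSet]
  rfl

variable {Θ Θ₀ : Set (E q)} {θ₀ : E q} {f : E q → E d → ℝ}

theorem AssumptionA2.measurable_modelProb (hA : AssumptionA2 Θ Θ₀ θ₀ f) {θ : E q} (hθ : θ ∈ Θ₀) :
    Measurable fun p : E d × ℝ => modelProb f θ (Metric.closedBall p.1 p.2) :=
  measurable_setIntegral_closedBall (continuous_of_continuousOn_prod hA.continuousOn hθ).measurable

theorem AssumptionA2.measurable_ballPsi (hA : AssumptionA2 Θ Θ₀ θ₀ f) (h : ℝ → ℝ) (n : ℕ)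
    {θ : E q} (hθ : θ ∈ Θ₀) :
    Measurable fun p : E d × ℝ => ballPsi h f n (Metric.closedBall p.1 p.2) θ := by
  have h1 := hA.measurable_modelProb hθ
  have h2 := h1.const_mul (n : ℝ)
  refine (WithLp.measurable_toLp 2 _).comp (measurable_pi_lambda _ fun j => ?_)
  exact (((measurable_deriv h).comp h2).mul h2).mul ((h1.const_div 1).mul
    (measurable_setIntegral_closedBall
      (continuous_of_continuousOn_prod (hA.continuousOn_pd j) hθ).measurable))

theorem measurable_ballSup {u : E q → E d → ℝ} (hA : AssumptionA2 Θ Θ₀ θ₀ f)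
    (hu : ContinuousOn (fun p : E q × E d => u p.1 p.2) (Θ₀ ×ˢ univ)) {D : Set (E q)}
    (hD : D.Countable) (hDΘ : D ⊆ Θ₀) :
    Measurable fun p : E d × ℝ => ballSup f u D (Metric.closedBall p.1 p.2) :=
  Measurable.biSup D hD fun _ hθ =>
    (measurable_setLIntegral_closedBall
      (continuous_of_continuousOn_prod hu (hDΘ hθ)).measurable.enorm).div
        (hA.measurable_modelProb (hDΘ hθ)).ennreal_ofReal

theorem AssumptionA2.measurable_ballEnvelope (hA : AssumptionA2 Θ Θ₀ θ₀ f) (h : ℝ → ℝ) (n : ℕ)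
    {D : Set (E q)} (hD : D.Countable) (hDΘ : D ⊆ Θ₀) :
    Measurable fun p : E d × ℝ => ballEnvelope h f n D (Metric.closedBall p.1 p.2) := by
  have h2 := fun θ (hθ : θ ∈ D) => (hA.measurable_modelProb (hDΘ hθ)).const_mul (n : ℝ)
  refine (Measurable.add (Measurable.mul ?_ ?_) (Measurable.mul ?_ ?_)).const_mul _
  · exact Measurable.biSup D hD fun θ hθ =>
      (((measurable_deriv _).comp (h2 θ hθ)).mul ((h2 θ hθ).pow_const 2)).enorm
  · exact (Measurable.iSup fun l => measurable_ballSup hA (hA.continuousOn_pd l) hD hDΘ).pow_const 2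
  · exact Measurable.biSup D hD fun θ hθ =>
      (((measurable_deriv _).comp (h2 θ hθ)).mul (h2 θ hθ)).enorm
  · exact Measurable.iSup fun j => Measurable.iSup fun l =>
      measurable_ballSup hA (hA.continuousOn_pd_pd j l) hD hDΘ

/-- By continuity the uncountable supremum over `Θ_n` can be taken over a countable dense subset,
which makes the envelope measurable. -/
theorem biSup_eq_of_dense {X : Type*} [TopologicalSpace X] {D T : Set X} (hDT : D ⊆ T)
    (hTD : T ⊆ closure D) {g : X → ℝ≥0∞} (hg : ContinuousOn g T) :
    ⨆ θ ∈ T, g θ = ⨆ θ ∈ D, g θ := by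
  refine le_antisymm (iSup₂_le fun θ hθ => ?_) (biSup_mono hDT)
  have : (𝓝[D] θ).NeBot := mem_closure_iff_nhdsWithin_neBot.1 (hTD hθ)
  refine le_of_tendsto ((hg θ hθ).mono_left (nhdsWithin_mono θ hDT)) ?_
  filter_upwards [self_mem_nhdsWithin] with t ht using le_iSup₂ (f := fun θ (_ : θ ∈ D) => g θ) t ht

theorem ballSup_eq_of_dense {u : E q → E d → ℝ} (hA : AssumptionA2 Θ Θ₀ θ₀ f)
    (hu : ContinuousOn (fun p : E q × E d => u p.1 p.2) (Θ₀ ×ˢ univ)) {D T : Set (E q)}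
    (hDT : D ⊆ T) (hTD : T ⊆ closure D) (hT : T ⊆ Θ₀) {B : Set (E d)} (hB : IsCompact B)
    (hp : ∀ θ ∈ T, 0 < modelProb f θ B) : ballSup f u T B = ballSup f u D B := by
  refine biSup_eq_of_dense hDT hTD ?_
  have hc : ContinuousOn (fun θ => ENNReal.ofReal ((∫ y in B, |u θ y|) / modelProb f θ B)) T :=
    ENNReal.continuous_ofReal.comp_continuousOn
      (((continuousOn_setIntegral (u := fun θ y => |u θ y|) hA.isOpen hu.abs hB).mono hT).div
        ((continuousOn_setIntegral hA.isOpen hA.continuousOn hB).mono hT)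
          fun θ hθ => (hp θ hθ).ne')
  refine hc.congr fun θ hθ => ?_
  beta_reduce
  rw [ENNReal.ofReal_div_of_pos (hp θ hθ)]
  congr 1
  exact (ofReal_integral_norm_eq_lintegral_enorm
    (integrableOn_of_continuousOn_prod hu (hT hθ) hB)).symm

theorem ballEnvelope_eq_of_dense {h φ₁ φ₂ : ℝ → ℝ} (hh : IsRegularDivergence h φ₁ φ₂)
    (hA : AssumptionA2 Θ Θ₀ θ₀ f) {n : ℕ} (hn : 0 < n) {D T : Set (E q)}
    (hDT : D ⊆ T) (hTD : T ⊆ closure D) (hT : T ⊆ Θ₀) {B : Set (E d)} (hB : IsCompact B)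
    (hp : ∀ θ ∈ T, 0 < modelProb f θ B) :
    ballEnvelope h f n T B = ballEnvelope h f n D B := by
  have hz : ∀ θ ∈ T, 0 < (n : ℝ) * modelProb f θ B := fun θ hθ =>
    mul_pos (Nat.cast_pos.2 hn) (hp θ hθ)
  have hzc : ContinuousOn (fun θ => (n : ℝ) * modelProb f θ B) T :=
    continuousOn_const.mul ((continuousOn_setIntegral hA.isOpen hA.continuousOn hB).mono hT)
  have hφ : ∀ φ, Admissible φ → ContinuousOn (fun θ => ‖φ (n * modelProb f θ B)‖ₑ) T :=
    fun φ hφ => continuous_enorm.comp_continuousOn (hφ.cont.comp hzc fun θ hθ => (hz θ hθ).le)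
  unfold ballEnvelope
  rw [biSup_eq_of_dense hDT hTD ((hφ φ₂ hh.adm₂).congr fun θ hθ => by
      rw [hh.deriv_deriv_mul _ (hz θ hθ)]),
    biSup_eq_of_dense hDT hTD ((hφ φ₁ hh.adm₁).congr fun θ hθ => by
      rw [hh.deriv_mul _ (hz θ hθ)])]
  simp_rw [fun l => ballSup_eq_of_dense hA (hA.continuousOn_pd l) hDT hTD hT hB hp,
    fun j l => ballSup_eq_of_dense hA (hA.continuousOn_pd_pd j l) hDT hTD hT hB hp]

end Measurability

/-! ### Brackets for Lipschitz families -/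

section Brackets

variable {q : ℕ}

/-- A finite cover of the unit ball is transported by `x ↦ c + r x`, so the number of pieces does
not depend on `c` or `r`. -/
theorem exists_cover_closedBall (q : ℕ) {κ : ℝ} (hκ : 0 < κ) :
    ∃ (m : ℕ) (x : Fin m → E q), ∀ (c : E q) (r : ℝ), 0 < r → ∀ θ ∈ Metric.closedBall c r,
      ∃ k, θ ∈ Metric.closedBall (c + r • x k) (κ * r) := by
  obtain ⟨t, -, htf, htc⟩ := (isCompact_closedBall (0 : E q) 1).finite_cover_balls hκ
  refine ⟨htf.toFinset.card, fun k => (htf.toFinset.equivFin.symm k : E q), fun c r hr θ hθ => ?_⟩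
  have h1 : r⁻¹ • (θ - c) ∈ Metric.closedBall (0 : E q) 1 := by
    rw [mem_closedBall_zero_iff, norm_smul, norm_inv, Real.norm_of_nonneg hr.le,
      inv_mul_le_iff₀ hr, mul_one, ← dist_eq_norm]
    exact hθ
  obtain ⟨y, hy, hyb⟩ := mem_iUnion₂.1 (htc h1)
  refine ⟨htf.toFinset.equivFin ⟨y, htf.mem_toFinset.2 hy⟩, ?_⟩
  simp only [Equiv.symm_apply_apply]
  rw [Metric.mem_closedBall, dist_eq_norm]
  rw [Metric.mem_ball, dist_eq_norm] at hyb
  have h2 : θ - (c + r • y) = r • (r⁻¹ • (θ - c) - y) := by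
    rw [smul_sub, smul_inv_smul₀ hr.ne']; abel
  rw [h2, norm_smul, Real.norm_of_nonneg hr.le, mul_comm]
  exact mul_le_mul_of_nonneg_right hyb.le hr.le

variable {Ω : Type*} [MeasurableSpace Ω] {P : Measure Ω}

theorem memLp_two_toReal {H : Ω → ℝ≥0∞} (hH : AEMeasurable H P)
    (h2 : ∫⁻ ω, H ω ^ 2 ∂P ≠ ∞) : MemLp (fun ω => (H ω).toReal) 2 P := by
  rw [memLp_two_iff_integrable_sq hH.ennreal_toReal.aestronglyMeasurable]
  simpa only [ENNReal.toReal_pow] using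
    integrable_toReal_of_lintegral_ne_top (hH.pow_const 2) h2

/-- Two parameters in the same piece are at distance at most `2κr`, so each component of `D` varies
there by at most `2κr H`. The brackets put this margin on both sides of the value at one reference
parameter; their width is `4κr H` in each component, which in norm brings the factor `√q`. -/
theorem hasBrackets_of_lipschitz {T : Set (E q)} {D : E q → Ω → E q} {H : Ω → ℝ≥0∞}
    {c : E q} {b r δ κ : ℝ} (hH : AEMeasurable H P) (h1 : ∫⁻ ω, H ω ∂P ≤ ENNReal.ofReal b)
    (h2 : ∫⁻ ω, H ω ^ 2 ∂P ≠ ∞) (hc : c ∈ T) (hDc : D c = 0)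
    (hD : ∀ θ ∈ T, AEStronglyMeasurable (D θ) P)
    (hlip : ∀ ω, ∀ s ∈ T, ∀ t ∈ T, ‖D s ω - D t ω‖ₑ ≤ H ω * ‖s - t‖ₑ)
    (hb : 0 ≤ b) (hr : 0 < r) (hκ : 0 < κ) (hκδ : √q * (4 * κ * b) ≤ δ) {m : ℕ}
    {x : Fin m → E q} (hcov : ∀ (c : E q) (r : ℝ), 0 < r → ∀ θ ∈ Metric.closedBall c r,
      ∃ k, θ ∈ Metric.closedBall (c + r • x k) (κ * r)) :
    HasBrackets P (T ∩ Metric.closedBall c r) D m (δ * r) := by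
  classical
  set U : Fin m → Set (E q) := fun k => Metric.closedBall (c + r • x k) (κ * r) with hU
  have hfin : ∀ᵐ ω ∂P, H ω < ∞ :=
    ae_lt_top' hH (h1.trans_lt ENNReal.ofReal_lt_top).ne
  have hHL := memLp_two_toReal hH h2
  have hlip' : ∀ ω, H ω < ∞ → ∀ s ∈ T, ∀ t ∈ T,
      ‖D s ω - D t ω‖ ≤ (H ω).toReal * ‖s - t‖ := fun ω hω s hs t ht => by
    have := ENNReal.toReal_mono (ENNReal.mul_ne_top hω.ne enorm_ne_top) (hlip ω s hs t ht)
    simpa [ENNReal.toReal_mul] using this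
  have hDL : ∀ θ ∈ T, MemLp (D θ) 2 P := fun θ hθ => by
    refine MemLp.of_le_mul (c := ‖θ - c‖) hHL (hD θ hθ) ?_
    filter_upwards [hfin] with ω hω
    have := hlip' ω hω θ hθ c hc
    rw [hDc, Pi.zero_apply, sub_zero] at this
    rw [Real.norm_of_nonneg ENNReal.toReal_nonneg, mul_comm]
    exact this
  set one : E q := WithLp.toLp 2 fun _ => 1 with hone
  set w : Ω → ℝ := fun ω => (H ω).toReal * (2 * κ * r) with hw
  have hwL : MemLp (fun ω => w ω • one) 2 P := by
    refine MemLp.of_le_mul (c := 2 * κ * r * ‖one‖) hHL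
      ((hHL.aestronglyMeasurable.mul_const _).smul_const _) (Eventually.of_forall fun ω => ?_)
    rw [norm_smul, hw, norm_mul, Real.norm_of_nonneg (by positivity : 0 ≤ 2 * κ * r)]
    exact le_of_eq (by ring)
  have hint : ∫ ω, (H ω).toReal ∂P ≤ b := by
    rw [integral_toReal hH hfin]
    exact ENNReal.toReal_le_of_le_ofReal hb h1
  -- The centres of the cover may lie outside `T`, where the Lipschitz bound is not available, so a
  -- point of `T` in the piece is used; an empty piece receives the default `c`.
  let ctr : Fin m → E q := fun k =>
    if hk : (T ∩ Metric.closedBall c r ∩ U k).Nonempty then hk.some else c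
  have hctr : ∀ k, (T ∩ Metric.closedBall c r ∩ U k).Nonempty → ctr k ∈ T ∧ ctr k ∈ U k :=
    fun k hk => by
      have : ctr k = hk.some := dif_pos hk
      exact this ▸ ⟨hk.some_mem.1.1, hk.some_mem.2⟩
  have hctrT : ∀ k, ctr k ∈ T := fun k => by
    by_cases hk : (T ∩ Metric.closedBall c r ∩ U k).Nonempty
    · exact (hctr k hk).1
    · have : ctr k = c := dif_neg hk
      rwa [this]
  refine ⟨U, fun k ω => D (ctr k) ω - w ω • one, fun k ω => D (ctr k) ω + w ω • one,
    fun θ hθ => ?_, fun k => ⟨(hDL _ (hctrT k)).sub hwL, (hDL _ (hctrT k)).add hwL, ?_, ?_⟩⟩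
  · obtain ⟨k, hk⟩ := hcov c r hr θ hθ.2
    exact mem_iUnion.2 ⟨k, hk⟩
  · have hone' : ‖one‖ ≤ √q := by
      simpa using norm_le_sqrt_mul_of_abs_le (v := one) zero_le_one fun j => by simp [hone]
    have e : ∀ ω, ‖D (ctr k) ω + w ω • one - (D (ctr k) ω - w ω • one)‖ =
        (H ω).toReal * (4 * κ * r * ‖one‖) := fun ω => by
      rw [show D (ctr k) ω + w ω • one - (D (ctr k) ω - w ω • one) = (2 * w ω) • one by
        rw [two_mul, add_smul]; abel, norm_smul, Real.norm_of_nonneg (by positivity), hw]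
      ring
    simp_rw [e]
    rw [integral_mul_const]
    calc (∫ ω, (H ω).toReal ∂P) * (4 * κ * r * ‖one‖) ≤ b * (4 * κ * r * √q) := by gcongr
      _ = √q * (4 * κ * b) * r := by ring
      _ ≤ δ * r := by gcongr
  · filter_upwards [hfin] with ω hω θ hθ j
    obtain ⟨-, hcU⟩ := hctr k ⟨θ, hθ⟩
    have hd : ‖θ - ctr k‖ ≤ 2 * κ * r := by
      rw [← dist_eq_norm]
      have := dist_triangle_right θ (ctr k) (c + r • x k)
      have h3 : dist θ (c + r • x k) ≤ κ * r := hθ.2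
      have h4 : dist (ctr k) (c + r • x k) ≤ κ * r := hcU
      linarith
    have h5 : ‖D θ ω - D (ctr k) ω‖ ≤ w ω :=
      (hlip' ω hω θ hθ.1.1 _ (hctrT k)).trans
        (mul_le_mul_of_nonneg_left hd ENNReal.toReal_nonneg)
    have h6 : |(D θ ω - D (ctr k) ω) j| ≤ w ω := by
      have := PiLp.norm_apply_le (D θ ω - D (ctr k) ω) j
      exact this.trans h5
    rw [PiLp.sub_apply, abs_le] at h6
    simp only [PiLp.sub_apply, PiLp.add_apply, PiLp.smul_apply, hone, smul_eq_mul, mul_one]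
    constructor <;> linarith [h6.1, h6.2]

end Brackets

end GMSP

/-! ### The Lipschitz bound, the envelope moments and the brackets. -/

namespace GMSP

variable {Ω : Type*} {q d : ℕ} {ξ : ℕ → Ω → E d}

theorem nnZ_eq {Θ Θ₀ : Set (E q)} {θ₀ : E q} {f : E q → E d → ℝ} (hf : IsDensityFamily Θ f)
    (hA : AssumptionA2 Θ Θ₀ θ₀ f) (n i : ℕ) (ω : Ω) :
    nnZ (densityLaw (f θ₀)) ξ n i ω = n * modelProb f θ₀ (nnBall ξ n i ω) := by
  have hθ₀ : θ₀ ∈ Θ := hA.subset hA.mem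
  rw [nnZ, densityLaw_real (hf.measurable θ₀ hθ₀) (hf.nonneg θ₀ hθ₀)
    (show MeasurableSet (nnBall ξ n i ω) from Metric.isClosed_closedBall.measurableSet), modelProb]

theorem volume_closedBall_zero (hd : 0 < d) (x : E d) : volume (Metric.closedBall x 0) = 0 := by
  have : Nonempty (Fin d) := ⟨⟨0, hd⟩⟩
  rw [Metric.closedBall_zero]
  exact measure_singleton x

variable [MeasurableSpace Ω] {P : Measure Ω}

theorem AssumptionA2.measurable_psiOn {Θ Θ₀ : Set (E q)} {θ₀ : E q} {f : E q → E d → ℝ}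
    (hA : AssumptionA2 Θ Θ₀ θ₀ f) {μ : Measure (E d)} (hξ : IsIID P ξ μ) {K : Set (E d)}
    (hK : IsCompact K) (h : ℝ → ℝ) (n i : ℕ) {θ : E q} (hθ : θ ∈ Θ₀) :
    Measurable (psiOn h f ξ K n i θ) := by
  have h1 := (hA.measurable_ballPsi h n hθ).comp
    ((hξ.measurable i).prodMk (hξ.measurable_nnDist n i))
  exact h1.indicator (hξ.measurable i hK.measurableSet)

variable [IsProbabilityMeasure P]

theorem IsIID.lintegral_one_add_sq_sq_le {μ : Measure (E d)} (hξ : IsIID P ξ μ)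
    (hμ : ∀ x r, μ (Metric.sphere x r) = 0) {n i : ℕ} (hn : 2 ≤ n) (hi : i < n) :
    ∫⁻ ω, ENNReal.ofReal ((1 + nnZ μ ξ n i ω ^ 2) ^ 2) ∂P ≤
      ENNReal.ofReal (2 + 2 * fourthMoment) := by
  have := hξ.isProbabilityMeasure
  calc ∫⁻ ω, ENNReal.ofReal ((1 + nnZ μ ξ n i ω ^ 2) ^ 2) ∂P
      ≤ ∫⁻ ω, (ENNReal.ofReal 2 + ENNReal.ofReal 2 * ENNReal.ofReal (nnZ μ ξ n i ω ^ 4)) ∂P := by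
        refine lintegral_mono fun ω => ?_
        rw [← ENNReal.ofReal_mul zero_le_two, ← ENNReal.ofReal_add zero_le_two (by positivity)]
        refine ENNReal.ofReal_le_ofReal ?_
        nlinarith [sq_nonneg (nnZ μ ξ n i ω ^ 2 - 1)]
    _ = ENNReal.ofReal 2 + ENNReal.ofReal 2 * ∫⁻ ω, ENNReal.ofReal (nnZ μ ξ n i ω ^ 4) ∂P := by
        rw [lintegral_add_left measurable_const, lintegral_const_mul' _ _ ENNReal.ofReal_ne_top]
        simp
    _ ≤ ENNReal.ofReal 2 + ENNReal.ofReal 2 * ENNReal.ofReal fourthMoment := by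
        gcongr
        exact hξ.lintegral_nnZ_pow_four_le hμ hn hi
    _ = _ := by
        rw [← ENNReal.ofReal_mul zero_le_two, ← ENNReal.ofReal_add zero_le_two
          (mul_nonneg zero_le_two fourthMoment_nonneg)]

theorem IsIID.lintegral_one_add_sq_le {μ : Measure (E d)} (hξ : IsIID P ξ μ)
    (hμ : ∀ x r, μ (Metric.sphere x r) = 0) {n i : ℕ} (hn : 2 ≤ n) (hi : i < n) :
    ∫⁻ ω, ENNReal.ofReal (1 + nnZ μ ξ n i ω ^ 2) ∂P ≤ ENNReal.ofReal (2 + 2 * fourthMoment) := by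
  refine le_trans (lintegral_mono fun ω => ENNReal.ofReal_le_ofReal ?_)
    (hξ.lintegral_one_add_sq_sq_le hμ hn hi)
  nlinarith [sq_nonneg (nnZ μ ξ n i ω), sq_nonneg (nnZ μ ξ n i ω ^ 2)]

theorem envelope_and_brackets (hd : 0 < d) {Θ Θ₀ : Set (E q)} {θ₀ : E q} {f : E q → E d → ℝ}
    (hf : IsDensityFamily Θ f) (hA2 : AssumptionA2 Θ Θ₀ θ₀ f) (hξ : IsIIDSample P ξ (f θ₀))
    {K : Set (E d)} (hK : IsCompact K) (hKpos : ∀ x ∈ K, 0 < f θ₀ x) {h φ₁ φ₂ : ℝ → ℝ}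
    (hh : IsRegularDivergence h φ₁ φ₂) :
    ∃ (b₁ b₂ : ℝ) (m : ℝ → ℕ), ∀ (α : ℕ → ℝ) (c : ℕ → E q), IsShrinking θ₀ α c →
      ∀ A : Set Ω, IsUniformEvent ξ A → ∀ i : ℕ, ∀ᶠ n in atTop,
        (∀ ω, ∀ s ∈ Metric.closedBall θ₀ (α n), ∀ t ∈ Metric.closedBall θ₀ (α n),
          A.indicator (fun ω => ‖psiOn h f ξ K n i s ω - psiOn h f ξ K n i t ω‖ₑ) ω ≤
            envelope h f ξ K A (Metric.closedBall θ₀ (α n)) n i ω * ‖s - t‖ₑ) ∧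
        AEMeasurable (envelope h f ξ K A (Metric.closedBall θ₀ (α n)) n i) P ∧
        ∫⁻ ω, envelope h f ξ K A (Metric.closedBall θ₀ (α n)) n i ω ∂P < ENNReal.ofReal b₁ ∧
        ∫⁻ ω, envelope h f ξ K A (Metric.closedBall θ₀ (α n)) n i ω ^ 2 ∂P < ENNReal.ofReal b₂ ∧
        (∀ δ > 0, ∀ r > 0, HasBrackets P
          (Metric.closedBall θ₀ (α n) ∩ Metric.closedBall (c n) r)
          (scoreDiff h f ξ K A n i (c n)) (m δ) (δ * r)) := by
  have hI := hξ.isIID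
  set μ := densityLaw (f θ₀) with hμdef
  have hμ : ∀ x r, μ (Metric.sphere x r) = 0 := densityLaw_sphere hd _
  obtain ⟨C, hC, -, hreg⟩ := exists_scoreRegime hh hA2 hK hKpos
  -- Precision `1` is enough: only the bounds by `C` enter the envelope, not the closeness to the
  -- limit.
  obtain ⟨ρ, hρ, hreg⟩ := hreg 1 one_pos
  have hM := fourthMoment_nonneg
  set c₀ : ℝ := q * (C ^ 3 + C ^ 2) with hc₀
  have hc₀0 : 0 ≤ c₀ := by positivity
  -- The summand `1` makes the moment bounds strict, also when `c₀ = 0`.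
  set b₁ : ℝ := c₀ * (2 + 2 * fourthMoment) + 1 with hb₁
  have hb₁0 : 0 ≤ b₁ := by positivity
  set b₂ : ℝ := c₀ ^ 2 * (2 + 2 * fourthMoment) + 1 with hb₂
  -- The relative radius is chosen so that `√q * 4κ * b₁ ≤ δ`. Any count will do for `δ ≤ 0`, so the
  -- number of brackets becomes a function on all of `ℝ`, fixed before the sequences, the event, `i`
  -- and `n`.
  have hcov : ∀ δ : ℝ, ∃ m : ℕ, 0 < δ → ∃ x : Fin m → E q, ∀ (c : E q) (r : ℝ), 0 < r →
      ∀ θ ∈ Metric.closedBall c r,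
        ∃ k, θ ∈ Metric.closedBall (c + r • x k) (δ / (4 * (√q + 1) * (b₁ + 1)) * r) := fun δ => by
    by_cases hδ : 0 < δ
    · obtain ⟨m, x, hx⟩ := exists_cover_closedBall q
        (by positivity : 0 < δ / (4 * (√q + 1) * (b₁ + 1)))
      exact ⟨m, fun _ => ⟨x, hx⟩⟩
    · exact ⟨0, fun h => absurd h hδ⟩
  choose m hm using hcov
  refine ⟨b₁, b₂, m, fun α c hα A hA i => ?_⟩
  -- The bound `i + 2` ensures both `i < n` and `2 ≤ n`.
  filter_upwards [hα.tendsto.eventually_le_const hρ, eventually_ge_atTop (i + 2),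
    Metric.tendstoUniformlyOn_iff.1 (hA.tendsto i) ρ hρ] with n hαn hni hAn
  have hn2 : 2 ≤ n := by omega
  have hn0 : 0 < n := by omega
  have hin : i < n := by omega
  set T := Metric.closedBall θ₀ (α n) with hT
  have hTρ : T ⊆ Metric.closedBall θ₀ ρ := Metric.closedBall_subset_closedBall hαn
  have hTΘ : T ⊆ Θ₀ := fun θ hθ => (hreg θ (hTρ hθ)).1
  have hcT : c n ∈ T := hα.mem n
  have hRρ : ∀ ω ∈ A, nnDist ξ n i ω ≤ ρ := fun ω hω => by
    have := (hAn ω hω).le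
    rwa [dist_comm, Real.dist_0_eq_abs, abs_of_nonneg (nnDist_nonneg ξ n i ω)] at this
  have hcases : ∀ ω ∈ A ∩ ξ i ⁻¹' K, volume (nnBall ξ n i ω) = 0 ∨
      ∀ θ ∈ T, IsScoreRegime h φ₁ φ₂ f θ₀ (ξ i ω) C 1 θ (nnBall ξ n i ω) := fun ω hω => by
    rcases (nnDist_nonneg ξ n i ω).eq_or_lt with h0 | h0
    · left
      rw [nnBall, ← h0]
      exact volume_closedBall_zero hd _
    · exact Or.inr fun θ hθ => ((hreg θ (hTρ hθ)).2 _ hω.2).2 _ h0 (hRρ ω hω.1)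
  have hBc : ∀ ω, IsCompact (nnBall ξ n i ω) := fun ω => isCompact_closedBall _ _
  have hSm : MeasurableSet (A ∩ ξ i ⁻¹' K) :=
    hA.measurableSet.inter (hI.measurable i hK.measurableSet)
  have henv : ∀ ω ∈ A ∩ ξ i ⁻¹' K, envelope h f ξ K A T n i ω =
      ballEnvelope h f n T (nnBall ξ n i ω) := fun ω hω => indicator_of_mem hω _
  have henv' : ∀ ω ∉ A ∩ ξ i ⁻¹' K, envelope h f ξ K A T n i ω = 0 :=
    fun ω hω => indicator_of_notMem hω _
  have hlip : ∀ ω, ∀ s ∈ T, ∀ t ∈ T,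
      A.indicator (fun ω => ‖psiOn h f ξ K n i s ω - psiOn h f ξ K n i t ω‖ₑ) ω ≤
        envelope h f ξ K A T n i ω * ‖s - t‖ₑ := fun ω s hs t ht => by
    by_cases hωA : ω ∈ A
    · rw [indicator_of_mem hωA]
      by_cases hωK : ω ∈ ξ i ⁻¹' K
      · rw [henv ω ⟨hωA, hωK⟩, psiOn, psiOn, indicator_of_mem hωK, indicator_of_mem hωK]
        change ‖ballPsi h f n (nnBall ξ n i ω) s - ballPsi h f n (nnBall ξ n i ω) t‖ₑ ≤ _
        rcases hcases ω ⟨hωA, hωK⟩ with h0 | h0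
        · rw [ballPsi_of_volume_eq_zero h n h0, ballPsi_of_volume_eq_zero h n h0]
          simp
        · exact enorm_ballPsi_sub_le hh hA2 hn0 (convex_closedBall _ _) hTΘ (hBc ω)
            (fun θ hθ => (h0 θ hθ).pos) hs ht
      · rw [psiOn, psiOn, indicator_of_notMem hωK, indicator_of_notMem hωK]
        simp
    · rw [indicator_of_notMem hωA]
      exact zero_le
  have hbound : ∀ ω, envelope h f ξ K A T n i ω ≤
      ENNReal.ofReal c₀ * ENNReal.ofReal (1 + nnZ μ ξ n i ω ^ 2) := fun ω => by
    rw [← ENNReal.ofReal_mul hc₀0]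
    by_cases hω : ω ∈ A ∩ ξ i ⁻¹' K
    · rw [henv ω hω]
      rcases hcases ω hω with h0 | h0
      · rw [ballEnvelope_of_volume_eq_zero h n T h0]
        exact zero_le
      · rw [hμdef, nnZ_eq hf hA2]
        exact ballEnvelope_le hh hn0 hC h0
    · rw [henv' ω hω]
      exact zero_le
  have hmeas : Measurable (envelope h f ξ K A T n i) := by
    obtain ⟨D, hDT, hDc, hTD⟩ :=
      (TopologicalSpace.IsSeparable.of_separableSpace T).exists_countable_dense_subset
    have h1 := (hA2.measurable_ballEnvelope h n hDc (hDT.trans hTΘ)).comp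
      ((hI.measurable i).prodMk (hI.measurable_nnDist n i))
    convert h1.indicator hSm using 1
    ext ω
    by_cases hω : ω ∈ A ∩ ξ i ⁻¹' K
    · rw [henv ω hω, indicator_of_mem hω]
      rcases hcases ω hω with h0 | h0
      · rw [ballEnvelope_of_volume_eq_zero h n T h0]
        exact (ballEnvelope_of_volume_eq_zero h n D h0).symm
      · change _ = ballEnvelope h f n D (nnBall ξ n i ω)
        exact ballEnvelope_eq_of_dense hh hA2 hn0 hDT hTD hTΘ (hBc ω) fun θ hθ => (h0 θ hθ).pos
    · rw [henv' ω hω, indicator_of_notMem hω]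
  have hint1 : ∫⁻ ω, envelope h f ξ K A T n i ω ∂P ≤
      ENNReal.ofReal (c₀ * (2 + 2 * fourthMoment)) := by
    refine (lintegral_mono hbound).trans ?_
    rw [lintegral_const_mul' _ _ ENNReal.ofReal_ne_top, ENNReal.ofReal_mul hc₀0]
    gcongr
    exact hI.lintegral_one_add_sq_le hμ hn2 hin
  have hint2 : ∫⁻ ω, envelope h f ξ K A T n i ω ^ 2 ∂P ≤
      ENNReal.ofReal (c₀ ^ 2 * (2 + 2 * fourthMoment)) := by
    refine (lintegral_mono fun ω => pow_le_pow_left' (hbound ω) 2).trans ?_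
    have hp : ∀ ω, 0 ≤ 1 + nnZ μ ξ n i ω ^ 2 := fun ω => by positivity
    simp_rw [mul_pow, ← ENNReal.ofReal_pow hc₀0, ← ENNReal.ofReal_pow (hp _)]
    rw [lintegral_const_mul' _ _ ENNReal.ofReal_ne_top, ENNReal.ofReal_mul (by positivity)]
    gcongr
    exact hI.lintegral_one_add_sq_sq_le hμ hn2 hin
  refine ⟨hlip, hmeas.aemeasurable, hint1.trans_lt ?_, hint2.trans_lt ?_, fun δ hδ r hr => ?_⟩
  · exact (ENNReal.ofReal_lt_ofReal_iff (by positivity)).2 (lt_add_one _)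
  · exact (ENNReal.ofReal_lt_ofReal_iff (by positivity)).2 (lt_add_one _)
  · obtain ⟨x, hx⟩ := hm δ hδ
    refine hasBrackets_of_lipschitz hmeas.aemeasurable (b := b₁)
      (hint1.trans (ENNReal.ofReal_le_ofReal (by linarith)))
      (hint2.trans_lt ENNReal.ofReal_lt_top).ne hcT ?_ (fun θ hθ => ?_) (fun ω s hs t ht => ?_)
      hb₁0 hr (by positivity) ?_ hx
    · ext1 ω
      by_cases hω : ω ∈ A <;> simp [scoreDiff, hω]
    · exact (((hA2.measurable_psiOn hI hK h n i (hTΘ hθ)).sub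
        (hA2.measurable_psiOn hI hK h n i (hTΘ hcT))).indicator
          hA.measurableSet).aestronglyMeasurable
    · refine le_trans (le_of_eq ?_) (hlip ω s hs t ht)
      by_cases hω : ω ∈ A <;> simp [scoreDiff, hω]
    · rw [show √q * (4 * (δ / (4 * (√q + 1) * (b₁ + 1))) * b₁) =
        δ * ((√q / (√q + 1)) * (b₁ / (b₁ + 1))) by field_simp]
      refine mul_le_of_le_one_right hδ.le (mul_le_one₀ ?_ (by positivity) ?_)
      · rw [div_le_one (by positivity)]; linarith
      · rw [div_le_one (by positivity)]; linarith

end GMSP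

/-! ### Asymptotic independence of two nearest neighbour balls. -/

namespace GMSP

theorem tendsto_one_add_div_pow_sub (t : ℝ) (k : ℕ) :
    Tendsto (fun n : ℕ => (1 + t / n) ^ (n - k)) atTop (𝓝 (Real.exp t)) := by
  have h1 := Real.tendsto_one_add_div_pow_exp t
  have h2 : Tendsto (fun n : ℕ => 1 + t / (n : ℝ)) atTop (𝓝 1) := by
    simpa using (tendsto_const_div_atTop_nhds_zero_nat t).const_add 1
  have h3 : Tendsto (fun n : ℕ => (1 + t / (n : ℝ)) ^ n / (1 + t / (n : ℝ)) ^ k) atTop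
      (𝓝 (Real.exp t)) := by
    have := h1.div (h2.pow k) (by simp)
    rw [one_pow, div_one] at this
    exact this
  refine h3.congr' ?_
  filter_upwards [eventually_ge_atTop k, h2.eventually_ne one_ne_zero] with n hn h0
  rw [div_eq_iff (pow_ne_zero _ h0), ← pow_add, Nat.sub_add_cancel hn]

variable {d : ℕ}

/-- The triples `((x, y), w)` such that `w` is in neither of the small balls around `x`
and `y`. -/
def farSet (μ : Measure (E d)) (t : ℝ) : Set ((E d × E d) × E d) :=
  {p | (p.1.1, p.2) ∈ (nearSet μ t)ᶜ ∧ (p.1.2, p.2) ∈ (nearSet μ t)ᶜ}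

/-- The pairs `(x, y)` neither of which lies in the small ball around the other one. -/
def apartSet (μ : Measure (E d)) (t : ℝ) : Set (E d × E d) :=
  {p | p ∈ (nearSet μ t)ᶜ ∧ p.swap ∈ (nearSet μ t)ᶜ}

/-- The conditional probability, given `ξ_i = x` and `ξ_j = y`, that the nearest neighbour balls
around both points have probability greater than `t`, for a sample with `m` further elements. -/
noncomputable def pairKernel (μ : Measure (E d)) (t : ℝ) (m : ℕ) : E d × E d → ℝ :=
  (apartSet μ t).indicator fun p => μ.real (Prod.mk p ⁻¹' farSet μ t) ^ m

section Sets

variable (μ : Measure (E d)) [IsFiniteMeasure μ] (t : ℝ)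

theorem measurableSet_farSet : MeasurableSet (farSet μ t) := by
  have hN := (measurableSet_nearSet μ t).compl
  exact (((measurable_fst.comp measurable_fst).prodMk measurable_snd) hN).inter
    (((measurable_snd.comp measurable_fst).prodMk measurable_snd) hN)

theorem measurableSet_apartSet : MeasurableSet (apartSet μ t) := by
  have hN := (measurableSet_nearSet μ t).compl
  exact hN.inter (measurable_swap hN)

theorem measurable_pairKernel (m : ℕ) : Measurable (pairKernel μ t m) :=
  ((measurable_measure_prodMk_left (measurableSet_farSet μ t)).ennreal_toReal.pow_const m).indicator
    (measurableSet_apartSet μ t)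

end Sets

theorem abs_pairKernel_le (μ : Measure (E d)) [IsProbabilityMeasure μ] (t : ℝ) (m : ℕ)
    (p : E d × E d) : |pairKernel μ t m p| ≤ 1 := by
  unfold pairKernel
  by_cases hp : p ∈ apartSet μ t
  · rw [indicator_of_mem hp, abs_of_nonneg (by positivity)]
    exact pow_le_one₀ measureReal_nonneg measureReal_le_one
  · rw [indicator_of_notMem hp]
    simp

/-- As both points charge all balls around them, for large `n` the balls of probability `s/n` have
radius below a third of the distance between `x` and `y`. They are then disjoint and contain neither
the other centre, so the kernel equals `(1 - 2s/n)^(n-2)`. -/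
theorem tendsto_pairKernel (μ : Measure (E d)) [IsProbabilityMeasure μ]
    (hμ : ∀ x r, μ (Metric.sphere x r) = 0) {s : ℝ} (hs : 0 ≤ s) {x y : E d} (hxy : x ≠ y)
    (hx : ∀ r > 0, 0 < μ.real (Metric.closedBall x r))
    (hy : ∀ r > 0, 0 < μ.real (Metric.closedBall y r)) :
    Tendsto (fun n : ℕ => pairKernel μ (s / n) (n - 2) (x, y)) atTop
      (𝓝 (Real.exp (-s) * Real.exp (-s))) := by
  rw [← Real.exp_add, show -s + -s = -(2 * s) by ring]
  refine (tendsto_one_add_div_pow_sub (-(2 * s)) 2).congr' ?_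
  have hd : 0 < dist x y := dist_pos.2 hxy
  have hr : 0 < dist x y / 3 := by positivity
  have h0 : Tendsto (fun n : ℕ => s / (n : ℝ)) atTop (𝓝 0) :=
    tendsto_const_div_atTop_nhds_zero_nat s
  filter_upwards [h0.eventually_lt_const (hx _ hr), h0.eventually_lt_const (hy _ hr),
    h0.eventually_lt_const one_pos] with n hnx hny hn1
  have key : ∀ u w : E d, s / n < μ.real (Metric.closedBall u (dist x y / 3)) →
      (u, w) ∈ nearSet μ (s / n) → dist u w < dist x y / 3 := fun u w hu hw => by
    by_contra hlt
    exact absurd (hu.trans_le (measureReal_mono (Metric.closedBall_subset_closedBall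
      (not_lt.1 hlt)))) (not_lt.2 hw)
  have hmem : (x, y) ∈ apartSet μ (s / n) :=
    ⟨fun h => by linarith [key x y hnx h], fun h => by
      have := key y x hny h
      rw [dist_comm] at this
      linarith⟩
  have hfar : Prod.mk (x, y) ⁻¹' farSet μ (s / n) =
      (Prod.mk x ⁻¹' nearSet μ (s / n) ∪ Prod.mk y ⁻¹' nearSet μ (s / n))ᶜ := by
    ext w
    simp [farSet]
  have hms : ∀ u : E d, MeasurableSet (Prod.mk u ⁻¹' nearSet μ (s / n)) := fun u =>
    measurable_prodMk_left (measurableSet_nearSet μ _)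
  have hdisj : Disjoint (Prod.mk x ⁻¹' nearSet μ (s / n)) (Prod.mk y ⁻¹' nearSet μ (s / n)) :=
    disjoint_left.2 fun w hw hw' => by
      have h1 := key x w hnx hw
      have h2 := key y w hny hw'
      have h3 := dist_triangle_right x y w
      linarith
  have hn0 : 0 ≤ s / (n : ℝ) := by positivity
  rw [pairKernel, indicator_of_mem hmem, hfar,
    probReal_compl_eq_one_sub ((hms x).union (hms y)), measureReal_union hdisj (hms y),
    measureReal_def, measureReal_def, measure_nearSet μ hμ x hn1, measure_nearSet μ hμ y hn1,
    ENNReal.toReal_ofReal hn0]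
  congr 1
  ring

theorem integral_prod_mul_self {μ : Measure (E d)} (a : E d → ℝ) [SFinite μ] :
    ∫ p, a p.1 * a p.2 ∂μ.prod μ = (∫ x, a x ∂μ) ^ 2 := by
  rw [integral_prod_mul a a, sq]

/-- Dominated convergence: the kernel is at most `1` in absolute value, the diagonal is null, and
positivity of balls is needed only where `a` does not vanish. -/
theorem tendsto_integral_pairKernel (μ : Measure (E d)) [IsProbabilityMeasure μ]
    (hμ : ∀ x r, μ (Metric.sphere x r) = 0) {s : ℝ} (hs : 0 ≤ s) {a : E d → ℝ}
    (ha : Measurable a) {L : ℝ} (hL : ∀ x, |a x| ≤ L)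
    (hsupp : ∀ x, a x ≠ 0 → ∀ r > 0, 0 < μ.real (Metric.closedBall x r)) :
    Tendsto (fun n : ℕ => ∫ p, a p.1 * a p.2 * pairKernel μ (s / n) (n - 2) p ∂μ.prod μ) atTop
      (𝓝 ((Real.exp (-s) * ∫ x, a x ∂μ) ^ 2)) := by
  have hlim : (Real.exp (-s) * ∫ x, a x ∂μ) ^ 2 =
      ∫ p, a p.1 * a p.2 * (Real.exp (-s) * Real.exp (-s)) ∂μ.prod μ := by
    rw [integral_mul_const, integral_prod_mul_self]; ring
  have ham : Measurable fun p : E d × E d => a p.1 * a p.2 :=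
    (ha.comp measurable_fst).mul (ha.comp measurable_snd)
  rw [hlim]
  refine tendsto_integral_of_dominated_convergence (fun _ => L * L)
    (fun n => (ham.mul (measurable_pairKernel μ _ _)).aestronglyMeasurable)
    (integrable_const _) (fun n => Eventually.of_forall fun p => ?_) ?_
  · have hL0 : 0 ≤ L := (abs_nonneg _).trans (hL p.1)
    rw [Real.norm_eq_abs, abs_mul, abs_mul]
    calc |a p.1| * |a p.2| * |pairKernel μ (s / n) (n - 2) p| ≤ L * L * 1 := by
          gcongr
          · exact hL _
          · exact hL _
          · exact abs_pairKernel_le μ _ _ _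
      _ = L * L := mul_one _
  · have hm : MeasurableSet {p : E d × E d | p.1 = p.2} :=
      measurableSet_eq_fun measurable_fst measurable_snd
    have hdiag : (μ.prod μ) {p : E d × E d | p.1 = p.2} = 0 := by
      rw [Measure.measure_prod_null hm]
      refine Eventually.of_forall fun x => ?_
      have : Prod.mk x ⁻¹' {p : E d × E d | p.1 = p.2} = Metric.sphere x 0 := by
        ext y; simp [eq_comm]
      simp only [this, hμ, Pi.zero_apply]
    filter_upwards [measure_eq_zero_iff_ae_notMem.1 hdiag] with p hp
    by_cases h1 : a p.1 = 0
    · simp [h1]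
    by_cases h2 : a p.2 = 0
    · simp [h2]
    exact (tendsto_pairKernel μ hμ hs (x := p.1) (y := p.2) hp (hsupp _ h1)
      (hsupp _ h2)).const_mul _

variable {Ω : Type*} [MeasurableSpace Ω] {P : Measure Ω} [IsProbabilityMeasure P]
  {ξ : ℕ → Ω → E d} {μ : Measure (E d)}

theorem IsIID.integral_mul_indicator (hξ : IsIID P ξ μ) (hμ : ∀ x r, μ (Metric.sphere x r) = 0)
    {n i : ℕ} (hn : 2 ≤ n) (hi : i < n) {s : ℝ} (hs : 0 ≤ s) (hsn : s < n) {a : E d → ℝ}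
    (ha : Measurable a) :
    ∫ ω, a (ξ i ω) * (Ioi s).indicator 1 (nnZ μ ξ n i ω) ∂P =
      (1 + -s / n) ^ (n - 1) * ∫ x, a x ∂μ := by
  have := hξ.isProbabilityMeasure
  have hn0 : (0 : ℝ) < n := by positivity
  have h0 : 0 ≤ 1 - s / n := by
    rw [sub_nonneg, div_le_one hn0]; exact hsn.le
  have hS : MeasurableSet {ω | s < nnZ μ ξ n i ω} :=
    measurableSet_lt measurable_const (hξ.measurable_nnZ n i)
  have e : ∀ ω, a (ξ i ω) * (Ioi s).indicator 1 (nnZ μ ξ n i ω) =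
      {ω | s < nnZ μ ξ n i ω}.indicator (fun ω => a (ξ i ω)) ω := fun ω => by
    by_cases h : s < nnZ μ ξ n i ω <;> simp [h]
  simp_rw [e]
  rw [integral_indicator hS, ← integral_map (hξ.measurable i).aemeasurable
    ha.aestronglyMeasurable, hξ.map_restrict_lt_nnZ hμ hn hi hs hsn, integral_smul_measure,
    ENNReal.toReal_ofReal (by positivity), smul_eq_mul, neg_div, ← sub_eq_add_neg]

theorem IsIID.integral_mul_indicator_pair (hξ : IsIID P ξ μ) {n i j : ℕ} (hn : 2 ≤ n) (hi : i < n)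
    (hj : j < n) (hij : i ≠ j) (s : ℝ) {a : E d → ℝ} (ha : Measurable a) :
    ∫ ω, (a (ξ i ω) * (Ioi s).indicator 1 (nnZ μ ξ n i ω)) *
        (a (ξ j ω) * (Ioi s).indicator 1 (nnZ μ ξ n j ω)) ∂P =
      ∫ p, a p.1 * a p.2 * pairKernel μ (s / n) (n - 2) p ∂μ.prod μ := by
  have := hξ.isProbabilityMeasure
  set U : Ω → E d × E d := fun ω => (ξ i ω, ξ j ω) with hU
  have hUm : Measurable U := (hξ.measurable i).prodMk (hξ.measurable j)
  set J := ((Finset.range n).erase i).erase j with hJ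
  have hJc : J.card = n - 2 := by
    rw [hJ, Finset.card_erase_of_mem (by simp [hij.symm, hj]),
      Finset.card_erase_of_mem (by simpa using hi), Finset.card_range]
    omega
  set V := {ω | ∀ k ∈ J, (U ω, ξ k ω) ∈ farSet μ (s / n)} with hV
  set C := apartSet μ (s / n) with hC
  have hCm : MeasurableSet C := measurableSet_apartSet μ _
  -- The event splits into a condition on the pair alone and conditions on the `n - 2` remaining
  -- points, which are independent of the pair.
  have hset : {ω | s < nnZ μ ξ n i ω ∧ s < nnZ μ ξ n j ω} = U ⁻¹' C ∩ V := by
    ext ω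
    simp only [mem_ofPred_eq, lt_nnZ_iff hn, mem_inter_iff, mem_preimage, hC, hV, apartSet, farSet,
      hU, hJ, Finset.mem_erase, Finset.mem_range, Prod.swap_prod_mk]
    constructor
    · rintro ⟨h1, h2⟩
      exact ⟨⟨h1 j ⟨hij.symm, hj⟩, h2 i ⟨hij, hi⟩⟩, fun k hk =>
        ⟨h1 k hk.2, h2 k ⟨hk.1, hk.2.2⟩⟩⟩
    · rintro ⟨⟨h1, h2⟩, h3⟩
      refine ⟨fun k hk => ?_, fun k hk => ?_⟩
      · rcases eq_or_ne k j with rfl | hkj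
        · exact h1
        · exact (h3 k ⟨hkj, hk⟩).1
      · rcases eq_or_ne k i with rfl | hki
        · exact h2
        · exact (h3 k ⟨hk.1, hki, hk.2⟩).2
  have hSm : MeasurableSet {ω | s < nnZ μ ξ n i ω ∧ s < nnZ μ ξ n j ω} :=
    (measurableSet_lt measurable_const (hξ.measurable_nnZ n i)).inter
      (measurableSet_lt measurable_const (hξ.measurable_nnZ n j))
  have hind : IndepFun U (fun ω (k : J) => ξ k ω) P := by
    refine hξ.indepFun_of_finset (S := {i, j}) (J := J) ?_
      (g := fun x => (x ⟨i, by simp⟩, x ⟨j, by simp⟩))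
      ((measurable_pi_apply _).prodMk (measurable_pi_apply _))
    rw [Finset.disjoint_left]
    intro k hk hk'
    simp only [hJ, Finset.mem_erase] at hk'
    rcases Finset.mem_insert.1 hk with h | h
    · exact hk'.2.1 h
    · exact hk'.1 (Finset.mem_singleton.1 h)
  have hmap := hξ.map_restrict hUm hind (measurableSet_farSet μ (s / n))
  rw [hξ.map_pair hij, hJc] at hmap
  have hF : Measurable fun p : E d × E d => a p.1 * a p.2 :=
    (ha.comp measurable_fst).mul (ha.comp measurable_snd)
  have e : ∀ ω, (a (ξ i ω) * (Ioi s).indicator 1 (nnZ μ ξ n i ω)) *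
        (a (ξ j ω) * (Ioi s).indicator 1 (nnZ μ ξ n j ω)) =
      {ω | s < nnZ μ ξ n i ω ∧ s < nnZ μ ξ n j ω}.indicator
        (fun ω => (fun p : E d × E d => a p.1 * a p.2) (U ω)) ω := fun ω => by
    by_cases h : s < nnZ μ ξ n i ω <;> by_cases h' : s < nnZ μ ξ n j ω <;> simp [h, h', hU]
  simp_rw [e]
  have hgm : Measurable fun u => μ (Prod.mk u ⁻¹' farSet μ (s / n)) ^ (n - 2) :=
    (measurable_measure_prodMk_left (measurableSet_farSet μ (s / n))).pow_const _
  rw [integral_indicator hSm, hset, ← Measure.restrict_restrict (hUm hCm),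
    ← integral_map hUm.aemeasurable hF.aestronglyMeasurable, ← Measure.restrict_map hUm hCm, hmap,
    setIntegral_withDensity_eq_setIntegral_toReal_smul hgm (ae_of_all _ fun u => by
      exact ENNReal.pow_lt_top (measure_lt_top _ _)) _ hCm,
    ← integral_indicator hCm]
  refine integral_congr_ae (Eventually.of_forall fun p => ?_)
  by_cases hp : p ∈ C
  · simp only [indicator_of_mem hp, pairKernel, ENNReal.toReal_pow, smul_eq_mul, measureReal_def]
    rw [indicator_of_mem hp, mul_comm]
  · simp only [indicator_of_notMem hp, pairKernel]
    rw [indicator_of_notMem hp, mul_zero]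

end GMSP

/-! ### Laws of large numbers for nearest neighbour functionals. -/

namespace GMSP

variable {d : ℕ} {Ω : Type*} [MeasurableSpace Ω] {P : Measure Ω}
  {ξ : ℕ → Ω → E d} {μ : Measure (E d)} {a : E d → ℝ} {L : ℝ} {φ χ : ℝ → ℝ}

/-- The function `φ` is measurable, and bounded on compact subsets of `[0, ∞)`. -/
structure IsTestFun (φ : ℝ → ℝ) : Prop where
  measurable : Measurable φ
  bounded : ∀ M : ℝ, ∃ C, ∀ z, 0 ≤ z → z ≤ M → |φ z| ≤ C

namespace IsTestFun

theorem add (h : IsTestFun φ) (h' : IsTestFun χ) : IsTestFun fun z => φ z + χ z :=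
  ⟨h.measurable.add h'.measurable, fun M => by
    obtain ⟨C, hC⟩ := h.bounded M
    obtain ⟨C', hC'⟩ := h'.bounded M
    exact ⟨C + C', fun z hz hzM => (abs_add_le _ _).trans (add_le_add (hC z hz hzM) (hC' z hz hzM))⟩⟩

theorem const_mul (h : IsTestFun φ) (c : ℝ) : IsTestFun fun z => c * φ z :=
  ⟨h.measurable.const_mul c, fun M => by
    obtain ⟨C, hC⟩ := h.bounded M
    refine ⟨|c| * C, fun z hz hzM => ?_⟩
    rw [abs_mul]
    exact mul_le_mul_of_nonneg_left (hC z hz hzM) (abs_nonneg c)⟩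

theorem indicator_Ioi (s : ℝ) : IsTestFun ((Ioi s).indicator 1) :=
  ⟨measurable_one.indicator measurableSet_Ioi, fun _ => ⟨1, fun z _ _ => by
    by_cases h : s < z <;> simp [h]⟩⟩

theorem zero : IsTestFun fun _ => 0 := ⟨measurable_const, fun _ => ⟨0, fun z _ _ => by simp⟩⟩

theorem finset_sum {ι : Type*} (s : Finset ι) {φ : ι → ℝ → ℝ} (h : ∀ k ∈ s, IsTestFun (φ k)) :
    IsTestFun fun z => ∑ k ∈ s, φ k z := by
  classical
  induction s using Finset.induction_on with
  | empty => simpa using zero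
  | insert k s hk ih =>
    simp_rw [Finset.sum_insert hk]
    exact (h k (Finset.mem_insert_self k s)).add
      (ih fun j hj => h j (Finset.mem_insert_of_mem hj))

end IsTestFun

/-- The functional `a(ξ_i) φ(n μ(B_n(ξ_i)))` of the sample. -/
noncomputable def nnTerm (a : E d → ℝ) (φ : ℝ → ℝ) (μ : Measure (E d)) (ξ : ℕ → Ω → E d)
    (n i : ℕ) (ω : Ω) : ℝ :=
  a (ξ i ω) * φ (nnZ μ ξ n i ω)

/-- The deviation of the mean of the `nnTerm`s of a sample from the expectation. -/
noncomputable def nnDev (P : Measure Ω) (a : E d → ℝ) (φ : ℝ → ℝ) (μ : Measure (E d))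
    (ξ : ℕ → Ω → E d) (n : ℕ) (ω : Ω) : ℝ :=
  1 / n * ∑ i ∈ Finset.range n, nnTerm a φ μ ξ n i ω - ∫ ω, nnTerm a φ μ ξ n 0 ω ∂P

/-- The law of large numbers for the functional given by `a` and `φ`. -/
def NNLaw (P : Measure Ω) (a : E d → ℝ) (φ : ℝ → ℝ) (μ : Measure (E d))
    (ξ : ℕ → Ω → E d) : Prop :=
  ∀ ε > 0, ∀ᶠ n in atTop, ∫ ω, |nnDev P a φ μ ξ n ω| ∂P ≤ ε

theorem nnLaw_zero : NNLaw P a (fun _ => 0) μ ξ := fun ε hε =>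
  Eventually.of_forall fun n => by simp [nnDev, nnTerm, hε.le]

theorem nnLaw_const_mul (h : NNLaw P a φ μ ξ) (c : ℝ) : NNLaw P a (fun z => c * φ z) μ ξ :=
    fun ε hε => by
  filter_upwards [h (ε / (|c| + 1)) (by positivity)] with n hn
  have hdev : ∀ ω, nnDev P a (fun z => c * φ z) μ ξ n ω = c * nnDev P a φ μ ξ n ω := fun ω => by
    have e : ∀ i ω, nnTerm a (fun z => c * φ z) μ ξ n i ω = c * nnTerm a φ μ ξ n i ω :=
      fun i ω => mul_left_comm _ _ _
    simp only [nnDev, e]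
    rw [integral_const_mul, ← Finset.mul_sum]
    ring
  simp_rw [hdev, abs_mul]
  rw [integral_const_mul]
  calc |c| * ∫ ω, |nnDev P a φ μ ξ n ω| ∂P ≤ (|c| + 1) * (ε / (|c| + 1)) := by
        gcongr
        linarith
    _ = ε := by field_simp

variable [IsProbabilityMeasure P]

namespace IsIID

theorem integrable_test (hξ : IsIID P ξ μ) (hφ : IsTestFun φ) (n i : ℕ) :
    Integrable (fun ω => φ (nnZ μ ξ n i ω)) P := by
  have := hξ.isProbabilityMeasure
  obtain ⟨C, hC⟩ := hφ.bounded n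
  exact Integrable.of_bound (hφ.measurable.comp (hξ.measurable_nnZ n i)).aestronglyMeasurable C
    (Eventually.of_forall fun ω => hC _ (nnZ_nonneg μ ξ n i ω) (nnZ_le μ ξ n i ω))

theorem integrable_nnTerm (hξ : IsIID P ξ μ) (ha : Measurable a) (hL : ∀ x, |a x| ≤ L)
    (hφ : IsTestFun φ) (n i : ℕ) : Integrable (nnTerm a φ μ ξ n i) P :=
  (hξ.integrable_test hφ n i).bdd_mul (ha.comp (hξ.measurable i)).aestronglyMeasurable
    (Eventually.of_forall fun ω => hL (ξ i ω))

theorem integrable_nnDev (hξ : IsIID P ξ μ) (ha : Measurable a) (hL : ∀ x, |a x| ≤ L)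
    (hφ : IsTestFun φ) (n : ℕ) : Integrable (nnDev P a φ μ ξ n) P :=
  ((integrable_finsetSum _ fun i _ => hξ.integrable_nnTerm ha hL hφ n i).const_mul _).sub
    (integrable_const _)

theorem nnLaw_add (hξ : IsIID P ξ μ) (ha : Measurable a) (hL : ∀ x, |a x| ≤ L)
    (hφ : IsTestFun φ) (hχ : IsTestFun χ) (h : NNLaw P a φ μ ξ) (h' : NNLaw P a χ μ ξ) :
    NNLaw P a (fun z => φ z + χ z) μ ξ := fun ε hε => by
  filter_upwards [h (ε / 2) (half_pos hε), h' (ε / 2) (half_pos hε)] with n hn hn'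
  have hdev : ∀ ω, nnDev P a (fun z => φ z + χ z) μ ξ n ω =
      nnDev P a φ μ ξ n ω + nnDev P a χ μ ξ n ω := fun ω => by
    have e : ∀ i ω, nnTerm a (fun z => φ z + χ z) μ ξ n i ω =
        nnTerm a φ μ ξ n i ω + nnTerm a χ μ ξ n i ω := fun i ω => mul_add _ _ _
    simp only [nnDev, e]
    rw [integral_add (hξ.integrable_nnTerm ha hL hφ n 0) (hξ.integrable_nnTerm ha hL hχ n 0),
      Finset.sum_add_distrib]
    ring
  have i1 := (hξ.integrable_nnDev ha hL hφ n).abs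
  have i2 := (hξ.integrable_nnDev ha hL hχ n).abs
  calc ∫ ω, |nnDev P a (fun z => φ z + χ z) μ ξ n ω| ∂P
      ≤ ∫ ω, (|nnDev P a φ μ ξ n ω| + |nnDev P a χ μ ξ n ω|) ∂P :=
        integral_mono (hξ.integrable_nnDev ha hL (hφ.add hχ) n).abs (i1.add i2) fun ω => by
          simp only [hdev]; exact abs_add_le _ _
    _ = _ := integral_add i1 i2
    _ ≤ ε := by linarith

theorem nnLaw_finset_sum {ι : Type*} (hξ : IsIID P ξ μ) (ha : Measurable a)
    (hL : ∀ x, |a x| ≤ L) (s : Finset ι) {φ : ι → ℝ → ℝ} (hφ : ∀ k ∈ s, IsTestFun (φ k))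
    (h : ∀ k ∈ s, NNLaw P a (φ k) μ ξ) : NNLaw P a (fun z => ∑ k ∈ s, φ k z) μ ξ := by
  classical
  induction s using Finset.induction_on with
  | empty => simpa using nnLaw_zero
  | insert k s hk ih =>
    simp_rw [Finset.sum_insert hk]
    have hs : ∀ j ∈ s, IsTestFun (φ j) := fun j hj => hφ j (Finset.mem_insert_of_mem hj)
    exact hξ.nnLaw_add ha hL (hφ k (Finset.mem_insert_self k s)) (IsTestFun.finset_sum s hs)
      (h k (Finset.mem_insert_self k s)) (ih hs fun j hj => h j (Finset.mem_insert_of_mem hj))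

/-- Replacing `φ` by `χ` changes the sample mean, in `L¹`, and the expectation by at most `L η`
each, where `η` bounds the `L¹` distance uniformly in `i < n`. -/
theorem nnLaw_of_approx (hξ : IsIID P ξ μ) (ha : Measurable a) (hL : ∀ x, |a x| ≤ L)
    (hφ : IsTestFun φ)
    (happ : ∀ ε > 0, ∃ χ, IsTestFun χ ∧ NNLaw P a χ μ ξ ∧ ∀ᶠ n in atTop, ∀ i < n,
      ∫ ω, |φ (nnZ μ ξ n i ω) - χ (nnZ μ ξ n i ω)| ∂P ≤ ε) : NNLaw P a φ μ ξ := fun ε hε => by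
  have hL0 : 0 ≤ L := (abs_nonneg _).trans (hL 0)
  obtain ⟨χ, hχ, hlaw, hclose⟩ := happ (ε / (2 * (2 * L + 1))) (by positivity)
  filter_upwards [hlaw (ε / 2) (half_pos hε), hclose, eventually_gt_atTop 0] with n hn hn' hn0
  set η := ε / (2 * (2 * L + 1)) with hη
  have hη0 : 0 < η := by positivity
  have hn0' : (0 : ℝ) < n := Nat.cast_pos.2 hn0
  have hterm : ∀ i ω, |nnTerm a φ μ ξ n i ω - nnTerm a χ μ ξ n i ω| ≤
      L * |φ (nnZ μ ξ n i ω) - χ (nnZ μ ξ n i ω)| := fun i ω => by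
    rw [nnTerm, nnTerm, ← mul_sub, abs_mul]
    exact mul_le_mul_of_nonneg_right (hL _) (abs_nonneg _)
  have idiff : ∀ i, Integrable (fun ω => |φ (nnZ μ ξ n i ω) - χ (nnZ μ ξ n i ω)|) P := fun i =>
    ((hξ.integrable_test hφ n i).sub (hξ.integrable_test hχ n i)).abs
  have hmean : |(∫ ω, nnTerm a φ μ ξ n 0 ω ∂P) - ∫ ω, nnTerm a χ μ ξ n 0 ω ∂P| ≤ L * η := by
    rw [← integral_sub (hξ.integrable_nnTerm ha hL hφ n 0) (hξ.integrable_nnTerm ha hL hχ n 0)]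
    refine abs_integral_le_integral_abs.trans ?_
    calc ∫ ω, |nnTerm a φ μ ξ n 0 ω - nnTerm a χ μ ξ n 0 ω| ∂P
        ≤ ∫ ω, L * |φ (nnZ μ ξ n 0 ω) - χ (nnZ μ ξ n 0 ω)| ∂P :=
          integral_mono ((hξ.integrable_nnTerm ha hL hφ n 0).sub
            (hξ.integrable_nnTerm ha hL hχ n 0)).abs ((idiff 0).const_mul L) (hterm 0)
      _ = L * ∫ ω, |φ (nnZ μ ξ n 0 ω) - χ (nnZ μ ξ n 0 ω)| ∂P := integral_const_mul _ _
      _ ≤ L * η := by gcongr; exact hn' 0 hn0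
  have hpt : ∀ ω, |nnDev P a φ μ ξ n ω| ≤ |nnDev P a χ μ ξ n ω| +
      (L * (1 / n * ∑ i ∈ Finset.range n, |φ (nnZ μ ξ n i ω) - χ (nnZ μ ξ n i ω)|) + L * η) :=
    fun ω => by
    have e : nnDev P a φ μ ξ n ω = nnDev P a χ μ ξ n ω +
        (1 / n * ∑ i ∈ Finset.range n, (nnTerm a φ μ ξ n i ω - nnTerm a χ μ ξ n i ω) -
        ((∫ ω, nnTerm a φ μ ξ n 0 ω ∂P) - ∫ ω, nnTerm a χ μ ξ n 0 ω ∂P)) := by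
      rw [nnDev, nnDev, Finset.sum_sub_distrib]; ring
    rw [e]
    refine (abs_add_le _ _).trans (add_le_add le_rfl ((abs_sub _ _).trans (add_le_add ?_ hmean)))
    rw [abs_mul, abs_of_pos (by positivity : (0 : ℝ) < 1 / n), mul_left_comm, Finset.mul_sum]
    gcongr
    exact (Finset.abs_sum_le_sum_abs _ _).trans (Finset.sum_le_sum fun i _ => hterm i ω)
  have i1 := (hξ.integrable_nnDev ha hL hχ n).abs
  have i2 : Integrable (fun ω => L * (1 / n * ∑ i ∈ Finset.range n,
      |φ (nnZ μ ξ n i ω) - χ (nnZ μ ξ n i ω)|)) P :=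
    ((integrable_finsetSum _ fun i _ => idiff i).const_mul _).const_mul _
  have hsum : ∫ ω, L * (1 / n * ∑ i ∈ Finset.range n,
      |φ (nnZ μ ξ n i ω) - χ (nnZ μ ξ n i ω)|) ∂P ≤ L * η := by
    rw [integral_const_mul, integral_const_mul, integral_finsetSum _ fun i _ => idiff i]
    gcongr
    calc 1 / (n : ℝ) * ∑ i ∈ Finset.range n, ∫ ω, |φ (nnZ μ ξ n i ω) - χ (nnZ μ ξ n i ω)| ∂P
        ≤ 1 / (n : ℝ) * ∑ _i ∈ Finset.range n, η := by
          gcongr with i hi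
          exact hn' i (Finset.mem_range.1 hi)
      _ = η := by
          rw [Finset.sum_const, Finset.card_range, nsmul_eq_mul]; field_simp
  calc ∫ ω, |nnDev P a φ μ ξ n ω| ∂P
      ≤ ∫ ω, (|nnDev P a χ μ ξ n ω| + (L * (1 / n * ∑ i ∈ Finset.range n,
          |φ (nnZ μ ξ n i ω) - χ (nnZ μ ξ n i ω)|) + L * η)) ∂P :=
        integral_mono (hξ.integrable_nnDev ha hL hφ n).abs
          (i1.add (i2.add (integrable_const _))) hpt
    _ = (∫ ω, |nnDev P a χ μ ξ n ω| ∂P) + ((∫ ω, L * (1 / n * ∑ i ∈ Finset.range n,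
          |φ (nnZ μ ξ n i ω) - χ (nnZ μ ξ n i ω)|) ∂P) + L * η) := by
        have i3 : Integrable (fun ω => L * (1 / n * ∑ i ∈ Finset.range n,
          |φ (nnZ μ ξ n i ω) - χ (nnZ μ ξ n i ω)|) + L * η) P := i2.add (integrable_const _)
        rw [integral_add i1 i3, integral_add i2 (integrable_const _)]
        simp
    _ ≤ ε / 2 + (L * η + L * η) := by gcongr
    _ ≤ ε := by
        have : (2 * L + 1) * η = ε / 2 := by rw [hη]; field_simp
        nlinarith

/-- The second moment method: off-diagonal products and the squared mean have the same limit, and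
the `n` diagonal terms contribute only `O(1/n)` after division by `n²`. -/
theorem nnLaw_indicator (hξ : IsIID P ξ μ) (hμ : ∀ x r, μ (Metric.sphere x r) = 0)
    (ha : Measurable a) (hL : ∀ x, |a x| ≤ L)
    (hsupp : ∀ x, a x ≠ 0 → ∀ r > 0, 0 < μ.real (Metric.closedBall x r)) {s : ℝ} (hs : 0 ≤ s) :
    NNLaw P a ((Ioi s).indicator 1) μ ξ := fun ε hε => by
  have := hξ.isProbabilityMeasure
  have hL0 : 0 ≤ L := (abs_nonneg _).trans (hL 0)
  have hφ := IsTestFun.indicator_Ioi s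
  have l1 := tendsto_integral_pairKernel μ hμ hs ha hL hsupp
  have l2 : Tendsto (fun n : ℕ => ((1 + -s / n) ^ (n - 1) * ∫ x, a x ∂μ) ^ 2) atTop
      (𝓝 ((Real.exp (-s) * ∫ x, a x ∂μ) ^ 2)) :=
    ((tendsto_one_add_div_pow_sub (-s) 1).mul_const _).pow 2
  have l3 : Tendsto (fun n : ℕ => 2 * L ^ 2 / (n : ℝ)) atTop (𝓝 0) :=
    tendsto_const_div_atTop_nhds_zero_nat _
  have l4 := (l1.add l3).sub l2
  rw [add_zero, sub_self] at l4
  filter_upwards [l4.eventually_le_const (by positivity : 0 < ε ^ 2), eventually_ge_atTop 2,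
    (tendsto_natCast_atTop_atTop (R := ℝ)).eventually_gt_atTop s] with n hn hn2 hns
  have hn0 : (0 : ℝ) < n := by positivity
  set e := ∫ p, a p.1 * a p.2 * pairKernel μ (s / n) (n - 2) p ∂μ.prod μ with he
  set m := (1 + -s / n) ^ (n - 1) * ∫ x, a x ∂μ with hm
  set Y := nnTerm a ((Ioi s).indicator 1) μ ξ n with hY
  have hYm : ∀ i < n, ∫ ω, Y i ω ∂P = m := fun i hi =>
    hξ.integral_mul_indicator hμ hn2 hi hs hns ha
  have hYL : ∀ i ω, |Y i ω| ≤ L := fun i ω => by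
    simp only [hY, nnTerm]
    rw [abs_mul]
    refine (mul_le_mul (hL _) ?_ (abs_nonneg _) hL0).trans_eq (mul_one L)
    by_cases h : s < nnZ μ ξ n i ω <;> simp [h]
  have hYi : ∀ i, Integrable (Y i) P := fun i => hξ.integrable_nnTerm ha hL hφ n i
  have hYYi : ∀ i j, Integrable (fun ω => Y i ω * Y j ω) P := fun i j =>
    (hYi j).bdd_mul (hYi i).aestronglyMeasurable (Eventually.of_forall (hYL i))
  have heL : |e| ≤ L ^ 2 := by
    have := norm_integral_le_of_norm_le_const (μ := μ.prod μ) (C := L ^ 2)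
      (f := fun p => a p.1 * a p.2 * pairKernel μ (s / n) (n - 2) p)
      (Eventually.of_forall fun p => by
        rw [Real.norm_eq_abs, abs_mul, abs_mul]
        calc |a p.1| * |a p.2| * |pairKernel μ (s / n) (n - 2) p| ≤ L * L * 1 := by
              gcongr
              · exact hL _
              · exact hL _
              · exact abs_pairKernel_le μ _ _ _
          _ = L ^ 2 := by ring)
    simpa using this
  -- On the diagonal the second moment is at most `L²`, and `L² ≤ e + 2L²` because `|e| ≤ L²`; this
  -- writes all pairs as `e` plus a correction.
  have hYY : ∀ i ∈ Finset.range n, ∀ j ∈ Finset.range n,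
      ∫ ω, Y i ω * Y j ω ∂P ≤ e + if i = j then 2 * L ^ 2 else 0 := fun i hi j hj => by
    rw [Finset.mem_range] at hi hj
    split_ifs with hij
    · subst hij
      have : ∫ ω, Y i ω * Y i ω ∂P ≤ ∫ _ω, L ^ 2 ∂P :=
        integral_mono (hYYi i i) (integrable_const _) fun ω => by
          have := hYL i ω
          simp only
          nlinarith [abs_nonneg (Y i ω), abs_mul_abs_self (Y i ω)]
      simp only [integral_const, probReal_univ, smul_eq_mul, one_mul] at this
      linarith [neg_abs_le e]
    · rw [add_zero]
      exact (hξ.integral_mul_indicator_pair hn2 hi hj hij s ha).le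
  have hdev : ∀ ω, nnDev P a ((Ioi s).indicator 1) μ ξ n ω =
      1 / n * ∑ i ∈ Finset.range n, Y i ω - m := fun ω => by
    rw [nnDev, ← hYm 0 (by omega)]
  have hSi : Integrable (fun ω => 1 / (n : ℝ) * ∑ i ∈ Finset.range n, Y i ω) P :=
    (integrable_finsetSum _ fun i _ => hYi i).const_mul _
  have hSm : ∫ ω, 1 / (n : ℝ) * ∑ i ∈ Finset.range n, Y i ω ∂P = m := by
    rw [integral_const_mul, integral_finsetSum _ fun i _ => hYi i,
      Finset.sum_congr rfl fun i hi => hYm i (Finset.mem_range.1 hi), Finset.sum_const,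
      Finset.card_range, nsmul_eq_mul]
    field_simp
  have hSS : ∀ ω, (1 / (n : ℝ) * ∑ i ∈ Finset.range n, Y i ω) ^ 2 =
      1 / (n : ℝ) ^ 2 * ∑ i ∈ Finset.range n, ∑ j ∈ Finset.range n, Y i ω * Y j ω := fun ω => by
    rw [← Finset.sum_mul_sum]; ring
  have hSSi : Integrable (fun ω => (1 / (n : ℝ) * ∑ i ∈ Finset.range n, Y i ω) ^ 2) P := by
    simp_rw [hSS]
    exact (integrable_finsetSum _ fun i _ => integrable_finsetSum _ fun j _ =>
      hYYi i j).const_mul _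
  have hSSle : ∫ ω, (1 / (n : ℝ) * ∑ i ∈ Finset.range n, Y i ω) ^ 2 ∂P ≤ e + 2 * L ^ 2 / n := by
    simp_rw [hSS]
    rw [integral_const_mul, integral_finsetSum _ fun i _ => integrable_finsetSum _ fun j _ =>
      hYYi i j]
    simp_rw [integral_finsetSum _ fun j _ => hYYi _ j]
    calc 1 / (n : ℝ) ^ 2 * ∑ i ∈ Finset.range n, ∑ j ∈ Finset.range n, ∫ ω, Y i ω * Y j ω ∂P
        ≤ 1 / (n : ℝ) ^ 2 * ∑ i ∈ Finset.range n, ∑ j ∈ Finset.range n,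
            (e + if i = j then 2 * L ^ 2 else 0) := by
          gcongr with i hi j hj
          exact hYY i hi j hj
      _ = 1 / (n : ℝ) ^ 2 * (n * (n * e + 2 * L ^ 2)) := by
          congr 1
          rw [Finset.sum_congr rfl (g := fun _ => n * e + 2 * L ^ 2)]
          · simp [mul_add]
          · intro i hi
            rw [Finset.sum_add_distrib, Finset.sum_ite_eq, if_pos hi]
            simp
      _ = e + 2 * L ^ 2 / n := by field_simp
  have hsq : ∫ ω, nnDev P a ((Ioi s).indicator 1) μ ξ n ω ^ 2 ∂P ≤ ε ^ 2 := by
    have e1 : ∀ ω, nnDev P a ((Ioi s).indicator 1) μ ξ n ω ^ 2 =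
        (1 / (n : ℝ) * ∑ i ∈ Finset.range n, Y i ω) ^ 2 -
          2 * m * (1 / (n : ℝ) * ∑ i ∈ Finset.range n, Y i ω) + m ^ 2 := fun ω => by
      rw [hdev]; ring
    simp_rw [e1]
    have i3 : Integrable (fun ω => (1 / (n : ℝ) * ∑ i ∈ Finset.range n, Y i ω) ^ 2 -
        2 * m * (1 / (n : ℝ) * ∑ i ∈ Finset.range n, Y i ω)) P := hSSi.sub (hSi.const_mul _)
    rw [integral_add i3 (integrable_const _),
      integral_sub hSSi (hSi.const_mul _), integral_const_mul, hSm]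
    simp only [integral_const, probReal_univ, smul_eq_mul, one_mul]
    nlinarith
  have hsqi : Integrable (fun ω => nnDev P a ((Ioi s).indicator 1) μ ξ n ω ^ 2) P := by
    have e1 : ∀ ω, nnDev P a ((Ioi s).indicator 1) μ ξ n ω ^ 2 =
        (1 / (n : ℝ) * ∑ i ∈ Finset.range n, Y i ω) ^ 2 -
          2 * m * (1 / (n : ℝ) * ∑ i ∈ Finset.range n, Y i ω) + m ^ 2 := fun ω => by
      rw [hdev]; ring
    simp_rw [e1]
    exact (hSSi.sub (hSi.const_mul _)).add (integrable_const _)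
  -- The `L²` bound is turned into an `L¹` bound by `|x| ≤ ε/2 + x²/(2ε)`.
  calc ∫ ω, |nnDev P a ((Ioi s).indicator 1) μ ξ n ω| ∂P
      ≤ ∫ ω, (ε / 2 + 1 / (2 * ε) * nnDev P a ((Ioi s).indicator 1) μ ξ n ω ^ 2) ∂P := by
        refine integral_mono (hξ.integrable_nnDev ha hL hφ n).abs
          ((integrable_const _).add (hsqi.const_mul _)) fun ω => ?_
        simp only
        rw [← sq_abs (nnDev P a ((Ioi s).indicator 1) μ ξ n ω), ← sub_nonneg]
        have : ε / 2 + 1 / (2 * ε) * |nnDev P a ((Ioi s).indicator 1) μ ξ n ω| ^ 2 -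
            |nnDev P a ((Ioi s).indicator 1) μ ξ n ω| =
          1 / (2 * ε) * (|nnDev P a ((Ioi s).indicator 1) μ ξ n ω| - ε) ^ 2 := by
          field_simp; ring
        rw [this]
        positivity
    _ = ε / 2 + 1 / (2 * ε) * ∫ ω, nnDev P a ((Ioi s).indicator 1) μ ξ n ω ^ 2 ∂P := by
        rw [integral_add (integrable_const _) (hsqi.const_mul _), integral_const_mul]
        simp
    _ ≤ ε / 2 + 1 / (2 * ε) * ε ^ 2 := by gcongr
    _ = ε := by field_simp; norm_num

end IsIID

end GMSP

/-! ### From indicators to admissible functions. -/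

namespace GMSP

variable {d : ℕ} {Ω : Type*} [MeasurableSpace Ω] {P : Measure Ω} [IsProbabilityMeasure P]
  {ξ : ℕ → Ω → E d} {μ : Measure (E d)} {a : E d → ℝ} {L : ℝ} {φ : ℝ → ℝ}

theorem IsIID.integral_nnZ_pow_four_le (hξ : IsIID P ξ μ)
    (hμ : ∀ x r, μ (Metric.sphere x r) = 0) {n i : ℕ} (hn : 2 ≤ n) (hi : i < n) :
    ∫ ω, nnZ μ ξ n i ω ^ 4 ∂P ≤ fourthMoment := by
  have := hξ.isProbabilityMeasure
  rw [integral_eq_lintegral_of_nonneg_ae (Eventually.of_forall fun ω => by positivity)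
    ((hξ.measurable_nnZ n i).pow_const 4).aestronglyMeasurable]
  exact ENNReal.toReal_le_of_le_ofReal fourthMoment_nonneg (hξ.lintegral_nnZ_pow_four_le hμ hn hi)

/-- The step function which approximates `φ` on `(0, N b]` with mesh `b`. -/
noncomputable def stepFun (φ : ℝ → ℝ) (b : ℝ) (N : ℕ) (z : ℝ) : ℝ :=
  ∑ k ∈ Finset.range N,
    φ (k * b) * ((Ioi ((k : ℝ) * b)).indicator 1 z + -1 * (Ioi (((k + 1 : ℕ) : ℝ) * b)).indicator 1 z)

theorem stepFun_eq {b : ℝ} (hb : 0 < b) (N : ℕ) (z : ℝ) :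
    stepFun φ b N z = ∑ k ∈ Finset.range N, if k + 1 = ⌈z / b⌉₊ then φ (k * b) else 0 := by
  refine Finset.sum_congr rfl fun k _ => ?_
  have h : ∀ j : ℕ, (Ioi ((j : ℝ) * b)).indicator (1 : ℝ → ℝ) z =
      if j < ⌈z / b⌉₊ then 1 else 0 := fun j => by
    have : z ∈ Ioi ((j : ℝ) * b) ↔ j < ⌈z / b⌉₊ := by
      rw [Nat.lt_ceil, lt_div_iff₀ hb, mem_Ioi]
    simp only [indicator_apply, this, Pi.one_apply]
  rw [h, h]
  by_cases h1 : k + 1 = ⌈z / b⌉₊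
  · rw [if_pos (by omega), if_neg (by omega), if_pos h1]; ring
  · rw [if_neg h1]
    by_cases h2 : k < ⌈z / b⌉₊
    · rw [if_pos h2, if_pos (by omega)]; ring
    · rw [if_neg h2, if_neg (by omega)]; ring

/-- Up to `N b` the error is an oscillation over one cell. Beyond, the step function vanishes and
quadratic growth is traded for `z⁴ / (N b)²`, which the fourth moment controls. At `z = 0` the step
function is `0` whatever `φ 0` is, hence `0 < z`. -/
theorem abs_sub_stepFun_le {b C ε : ℝ} (hb : 0 < b) {N : ℕ} (hN : 1 ≤ N * b) (hC : 0 ≤ C)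
    (hε : 0 ≤ ε) (hgrowth : ∀ z, 0 ≤ z → |φ z| ≤ C * (1 + z ^ 2))
    (hosc : ∀ x ∈ Icc 0 (N * b), ∀ y ∈ Icc 0 (N * b), |x - y| ≤ b → |φ x - φ y| ≤ ε) {z : ℝ}
    (hz : 0 < z) : |φ z - stepFun φ b N z| ≤ ε + 2 * C / (N * b) ^ 2 * z ^ 4 := by
  have hM : 0 < N * b := by linarith
  rw [stepFun_eq hb]
  set k := ⌈z / b⌉₊ with hk
  have hk1 : 1 ≤ k := Nat.one_le_iff_ne_zero.2 (Nat.ceil_pos.2 (div_pos hz hb)).ne'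
  rcases le_or_gt z (N * b) with h | h
  · have hkN : k ≤ N := Nat.ceil_le.2 ((div_le_iff₀ hb).2 h)
    rw [Finset.sum_eq_single (k - 1), if_pos (by omega)]
    · have h1 : ((k - 1 : ℕ) : ℝ) * b < z := by
        rw [← lt_div_iff₀ hb, ← Nat.lt_ceil]; omega
      have h2 : z ≤ ((k - 1 : ℕ) : ℝ) * b + b := by
        have : z / b ≤ k := Nat.le_ceil _
        rw [div_le_iff₀ hb] at this
        rw [Nat.cast_sub hk1, Nat.cast_one]
        linarith
      have h0 : (0 : ℝ) ≤ ((k - 1 : ℕ) : ℝ) * b := by positivity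
      have := hosc z ⟨hz.le, h⟩ (((k - 1 : ℕ) : ℝ) * b) ⟨h0, by linarith⟩
        (abs_le.2 ⟨by linarith, by linarith⟩)
      have : 0 ≤ 2 * C / (N * b) ^ 2 * z ^ 4 := by positivity
      linarith
    · exact fun j _ hj => if_neg (by omega)
    · exact fun hj => absurd (Finset.mem_range.2 (by omega)) hj
  · have hkN : N < k := Nat.lt_ceil.2 ((lt_div_iff₀ hb).2 h)
    rw [Finset.sum_eq_zero fun j hj => if_neg (by rw [Finset.mem_range] at hj; omega), sub_zero]
    have h1 := hgrowth z hz.le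
    have h2 : 1 + z ^ 2 ≤ 2 * z ^ 2 := by nlinarith
    have h3 : z ^ 2 ≤ z ^ 4 / (N * b) ^ 2 := by
      rw [le_div_iff₀ (by positivity)]
      have : (N * b) ^ 2 ≤ z ^ 2 := pow_le_pow_left₀ hM.le h.le 2
      calc z ^ 2 * (N * b) ^ 2 ≤ z ^ 2 * z ^ 2 := by gcongr
        _ = z ^ 4 := by ring
    calc |φ z| ≤ C * (2 * (z ^ 4 / (N * b) ^ 2)) := h1.trans (by gcongr; linarith)
      _ = 2 * C / (N * b) ^ 2 * z ^ 4 := by ring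
      _ ≤ _ := by linarith

theorem isTestFun_stepFun (φ : ℝ → ℝ) (b : ℝ) (N : ℕ) : IsTestFun (stepFun φ b N) :=
  IsTestFun.finset_sum _ fun _ _ => ((IsTestFun.indicator_Ioi _).add
    ((IsTestFun.indicator_Ioi _).const_mul _)).const_mul _

theorem IsIID.nnLaw_stepFun (hξ : IsIID P ξ μ) (hμ : ∀ x r, μ (Metric.sphere x r) = 0)
    (ha : Measurable a) (hL : ∀ x, |a x| ≤ L)
    (hsupp : ∀ x, a x ≠ 0 → ∀ r > 0, 0 < μ.real (Metric.closedBall x r)) (φ : ℝ → ℝ) {b : ℝ}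
    (hb : 0 ≤ b) (N : ℕ) : NNLaw P a (stepFun φ b N) μ ξ := by
  refine hξ.nnLaw_finset_sum ha hL _ (fun k _ => ?_) fun k _ => nnLaw_const_mul ?_ _
  · exact ((IsTestFun.indicator_Ioi _).add
      ((IsTestFun.indicator_Ioi _).const_mul _)).const_mul _
  · exact hξ.nnLaw_add ha hL (IsTestFun.indicator_Ioi _)
      ((IsTestFun.indicator_Ioi _).const_mul _)
      (hξ.nnLaw_indicator hμ ha hL hsupp (by positivity))
      (nnLaw_const_mul (hξ.nnLaw_indicator hμ ha hL hsupp (by positivity)) _)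

/-- Nothing is known of `φ` on negative arguments, not even measurability, so the argument is
truncated. This changes no value at `nnZ`. -/
theorem Admissible.isTestFun (hφ : Admissible φ) : IsTestFun fun z => φ (max z 0) := by
  obtain ⟨C, hC, hg⟩ := hφ.growth
  refine ⟨(hφ.cont.comp_continuous (continuous_id.max continuous_const)
    fun z => show (0 : ℝ) ≤ max z 0 from le_max_right _ _).measurable, fun M => ⟨C * (1 + M ^ 2), fun z hz hzM => ?_⟩⟩
  rw [max_eq_left hz]
  refine (hg z hz).trans ?_
  gcongr

theorem IsIID.nnLaw_of_admissible (hξ : IsIID P ξ μ) (hμ : ∀ x r, μ (Metric.sphere x r) = 0)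
    (ha : Measurable a) (hL : ∀ x, |a x| ≤ L)
    (hsupp : ∀ x, a x ≠ 0 → ∀ r > 0, 0 < μ.real (Metric.closedBall x r)) (hφ : Admissible φ) :
    NNLaw P a φ μ ξ := by
  have := hξ.isProbabilityMeasure
  have hmax : ∀ n i ω, φ (max (nnZ μ ξ n i ω) 0) = φ (nnZ μ ξ n i ω) := fun n i ω => by
    rw [max_eq_left (nnZ_nonneg μ ξ n i ω)]
  have key : NNLaw P a (fun z => φ (max z 0)) μ ξ := by
    refine hξ.nnLaw_of_approx ha hL hφ.isTestFun fun ε hε => ?_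
    obtain ⟨C, hC, hg⟩ := hφ.growth
    have hM4 := fourthMoment_nonneg
    -- Chosen so that the tail term `2C / M² * fourthMoment` is at most `ε/2`; the summand `1` gives
    -- `1 ≤ M`.
    set M : ℝ := 1 + 4 * C * fourthMoment / ε with hM
    have hM1 : 1 ≤ M := by
      have : 0 ≤ 4 * C * fourthMoment / ε := by positivity
      linarith
    have huc := (isCompact_Icc (a := (0 : ℝ)) (b := M)).uniformContinuousOn_of_continuous
      (hφ.cont.mono Icc_subset_Ici_self)
    obtain ⟨η, hη, hosc⟩ := Metric.uniformContinuousOn_iff.1 huc (ε / 2) (half_pos hε)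
    obtain ⟨N, hN⟩ := exists_nat_gt (M / η)
    have hN0 : (0 : ℝ) < N := (by positivity : 0 ≤ M / η).trans_lt hN
    have hMN : N * (M / N) = M := by field_simp
    have hb : 0 < M / N := by positivity
    have hbη : M / N < η := by
      rw [div_lt_iff₀ hN0, mul_comm, ← div_lt_iff₀ hη]; exact hN
    refine ⟨stepFun φ (M / N) N, isTestFun_stepFun _ _ _,
      hξ.nnLaw_stepFun hμ ha hL hsupp φ hb.le N, ?_⟩
    filter_upwards [eventually_ge_atTop 2] with n hn i hi
    have hpt : ∀ᵐ ω ∂P, |φ (max (nnZ μ ξ n i ω) 0) - stepFun φ (M / N) N (nnZ μ ξ n i ω)| ≤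
        ε / 2 + 2 * C / M ^ 2 * nnZ μ ξ n i ω ^ 4 := by
      filter_upwards [hξ.ae_nnZ_pos hμ hn hi] with ω hω
      rw [hmax]
      have := abs_sub_stepFun_le (φ := φ) (N := N) hb (hMN.symm ▸ hM1) hC (half_pos hε).le hg
        (fun x hx y hy hxy => by
          rw [hMN] at hx hy
          exact (hosc x hx y hy (hxy.trans_lt hbη)).le) hω
      rwa [hMN] at this
    have i4 : Integrable (fun ω => nnZ μ ξ n i ω ^ 4) P :=
      Integrable.of_bound ((hξ.measurable_nnZ n i).pow_const 4).aestronglyMeasurable ((n : ℝ) ^ 4)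
        (Eventually.of_forall fun ω => by
          have h0 := nnZ_nonneg μ ξ n i ω
          rw [Real.norm_of_nonneg (by positivity)]
          exact pow_le_pow_left₀ h0 (nnZ_le μ ξ n i ω) 4)
    calc ∫ ω, |φ (max (nnZ μ ξ n i ω) 0) - stepFun φ (M / N) N (nnZ μ ξ n i ω)| ∂P
        ≤ ∫ ω, (ε / 2 + 2 * C / M ^ 2 * nnZ μ ξ n i ω ^ 4) ∂P :=
          integral_mono_ae ((hξ.integrable_test hφ.isTestFun n i).sub
            (hξ.integrable_test (isTestFun_stepFun _ _ _) n i)).abs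
            ((integrable_const _).add (i4.const_mul _)) hpt
      _ = ε / 2 + 2 * C / M ^ 2 * ∫ ω, nnZ μ ξ n i ω ^ 4 ∂P := by
          rw [integral_add (integrable_const _) (i4.const_mul _), integral_const_mul]
          simp
      _ ≤ ε / 2 + 2 * C / M ^ 2 * fourthMoment := by
          gcongr
          exact hξ.integral_nnZ_pow_four_le hμ hn hi
      _ ≤ ε := by
          have h1 : 4 * C * fourthMoment ≤ ε * M := by
            rw [hM, mul_add, mul_div_cancel₀ _ hε.ne']; linarith
          have h2 : 2 * C / M ^ 2 * fourthMoment ≤ ε / 2 := by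
            have h3 : ε * M * 1 ≤ ε * M * M := mul_le_mul_of_nonneg_left hM1 (by positivity)
            rw [div_mul_eq_mul_div, div_le_iff₀ (by positivity), sq]
            linarith
          linarith
  intro ε hε
  filter_upwards [key ε hε] with n hn
  simpa only [nnDev, nnTerm, hmax] using hn

end GMSP

/-! ### Exchanging the nearest neighbour: tails of its distance. -/

namespace GMSP

variable {d : ℕ} {Ω : Type*} {ξ : ℕ → Ω → E d}

/-- If the nearest neighbour of the first point among `n` is the `j`-th one, exchanging the points
number `1` and `j` brings it among the first `N`. -/
theorem nnDist_swap {n N j : ℕ} (hN : 2 ≤ N) (hNn : N ≤ n) (hj : j < n) (hj0 : j ≠ 0) (ω : Ω)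
    (h : dist (ξ 0 ω) (ξ j ω) = nnDist ξ n 0 ω) :
    nnDist (fun k => ξ (Equiv.swap 1 j k)) N 0 ω = nnDist ξ n 0 ω := by
  have h0 : Equiv.swap 1 j 0 = 0 := Equiv.swap_apply_of_ne_of_ne (by omega) (Ne.symm hj0)
  have hlt : ∀ k, k < n → Equiv.swap 1 j k < n := fun k hk => by
    rcases eq_or_ne k 1 with rfl | h1
    · rwa [Equiv.swap_apply_left]
    · rcases eq_or_ne k j with rfl | h2
      · rw [Equiv.swap_apply_right]; omega
      · rwa [Equiv.swap_apply_of_ne_of_ne h1 h2]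
  refine le_antisymm ?_ ?_
  · refine (nnDist_le (ξ := fun k => ξ (Equiv.swap 1 j k)) (i := 0) (j := 1) (by omega) one_ne_zero
      ω).trans ?_
    rw [h0, Equiv.swap_apply_left, h]
  · obtain ⟨k, hk, hk0, e⟩ := exists_dist_eq_nnDist (ξ := fun k => ξ (Equiv.swap 1 j k)) hN 0 ω
    rw [← e, h0]
    exact nnDist_le (hlt k (hk.trans_le hNn))
      (fun h' => hk0 ((Equiv.swap 1 j).injective (h'.trans h0.symm))) ω

variable [MeasurableSpace Ω] {P : Measure Ω} [IsProbabilityMeasure P] {μ : Measure (E d)}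

namespace IsIID

/-- Given `U = u`, the event has probability `μ(A_u)^|J|`, and only those `u` with `w u ≠ 0`
contribute. -/
theorem lintegral_indicator_le (hξ : IsIID P ξ μ) {β : Type*} [MeasurableSpace β] {U : Ω → β}
    (hU : Measurable U) {J : Finset ℕ} (hind : IndepFun U (fun ω (j : J) => ξ j ω) P)
    {A : Set (β × E d)} (hA : MeasurableSet A) {w : β → ℝ≥0∞} (hw : Measurable w) {p : ℝ≥0∞}
    (hp : ∀ u, w u ≠ 0 → μ (Prod.mk u ⁻¹' A) ≤ p) :
    ∫⁻ ω, {ω | ∀ k ∈ J, (U ω, ξ k ω) ∈ A}.indicator (fun ω => w (U ω)) ω ∂P ≤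
      p ^ J.card * ∫⁻ ω, w (U ω) ∂P := by
  have := hξ.isProbabilityMeasure
  have hS : MeasurableSet {ω | ∀ k ∈ J, (U ω, ξ k ω) ∈ A} := by
    have h1 : MeasurableSet (⋂ k ∈ J, (fun ω => (U ω, ξ k ω)) ⁻¹' A) :=
      J.measurableSet_biInter fun k _ => (hU.prodMk (hξ.measurable k)) hA
    convert h1 using 1
    ext ω
    simp
  rw [lintegral_indicator hS, ← lintegral_map hw hU, hξ.map_restrict hU hind hA,
    lintegral_withDensity_eq_lintegral_mul _ ((measurable_measure_prodMk_left hA).pow_const _) hw,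
    ← lintegral_map hw hU, ← lintegral_const_mul _ hw]
  refine lintegral_mono fun u => ?_
  rw [Pi.mul_apply]
  by_cases h : w u = 0
  · simp [h]
  · gcongr
    exact hp u h

theorem measure_lt_nnDist_le (hξ : IsIID P ξ μ) {K : Set (E d)} (hK : MeasurableSet K) {ρ : ℝ}
    {p : ℝ≥0∞} (hp : ∀ x ∈ K, μ {y | ρ < dist x y} ≤ p) {n i : ℕ} (hn : 2 ≤ n) (hi : i < n) :
    P {ω | ξ i ω ∈ K ∧ ρ < nnDist ξ n i ω} ≤ p ^ (n - 1) := by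
  have hind : IndepFun (ξ i) (fun ω (j : (Finset.range n).erase i) => ξ j ω) P :=
    hξ.indepFun_of_finset (S := {i}) (J := (Finset.range n).erase i) (by simp)
      (g := fun x => x ⟨i, by simp⟩) (measurable_pi_apply _)
  have hA : MeasurableSet {q : E d × E d | ρ < dist q.1 q.2} :=
    measurableSet_lt measurable_const (by fun_prop)
  have h := hξ.lintegral_indicator_le (hξ.measurable i) hind hA
    (w := K.indicator 1) (measurable_one.indicator hK) (p := p)
    fun x hx => hp x (by by_contra h; simp [h] at hx)
  rw [Finset.card_erase_of_mem (Finset.mem_range.2 hi), Finset.card_range] at h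
  refine le_trans ?_ (h.trans (mul_le_of_le_one_right zero_le ?_))
  · have hm : MeasurableSet {ω | ξ i ω ∈ K ∧ ρ < nnDist ξ n i ω} :=
      (hξ.measurable i hK).inter (measurableSet_lt measurable_const (hξ.measurable_nnDist n i))
    rw [← lintegral_indicator_one hm]
    refine lintegral_mono fun ω => ?_
    by_cases hω : ω ∈ {ω | ξ i ω ∈ K ∧ ρ < nnDist ξ n i ω}
    · have h1 : ω ∈ {ω | ∀ k ∈ (Finset.range n).erase i,
          (ξ i ω, ξ k ω) ∈ {q : E d × E d | ρ < dist q.1 q.2}} := fun k hk =>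
        (lt_nnDist_iff hn i ω ρ).1 hω.2 k (Finset.mem_range.1 (Finset.mem_of_mem_erase hk))
          (Finset.ne_of_mem_erase hk)
      rw [indicator_of_mem hω, indicator_of_mem h1, indicator_of_mem hω.1]
      rfl
    · rw [indicator_of_notMem hω]
      exact zero_le
  · calc ∫⁻ ω, K.indicator 1 (ξ i ω) ∂P ≤ ∫⁻ _, 1 ∂P :=
          lintegral_mono fun ω => indicator_le_self' (fun _ _ => zero_le) _
      _ = 1 := by simp

/-- Summing over the possible nearest neighbours `j` costs a factor `n`. Exchanging `j` with `1`
brings the nearest neighbour among the first `N` points, so the integrand becomes a function of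
these alone, with the law it has for sample size `N`. The other `n - N` points are independent of
them and must all lie beyond `ρ`. -/
theorem lintegral_lt_nnDist_le (hξ : IsIID P ξ μ) {K : Set (E d)} {ρ : ℝ}
    {p : ℝ≥0∞} (hp : ∀ x ∈ K, μ {y | ρ < dist x y} ≤ p) {w : E d × ℝ → ℝ≥0∞} (hw : Measurable w)
    (hwK : ∀ u, w u ≠ 0 → u.1 ∈ K) {n N : ℕ} (hN : 2 ≤ N) (hNn : N ≤ n) :
    ∫⁻ ω, {ω | ρ < nnDist ξ n 0 ω}.indicator (fun ω => w (ξ 0 ω, nnDist ξ n 0 ω)) ω ∂P ≤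
      n * p ^ (n - N) * ∫⁻ ω, w (ξ 0 ω, nnDist ξ N 0 ω) ∂P := by
  have h0N : 0 ∈ Finset.range N := Finset.mem_range.2 (by omega)
  set g : (Finset.range N → E d) → E d × ℝ := fun v => (v ⟨0, h0N⟩,
    ⨅ j : {j : ℕ // j < N ∧ j ≠ 0}, dist (v ⟨0, h0N⟩) (v ⟨j, Finset.mem_range.2 j.2.1⟩)) with hg
  have hgm : Measurable g := by
    refine (measurable_pi_apply _).prodMk (Measurable.iInf fun j => ?_)
    exact (measurable_pi_apply _).dist (measurable_pi_apply _)
  have hA : MeasurableSet {q : (E d × ℝ) × E d | ρ < dist q.1.1 q.2} :=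
    measurableSet_lt measurable_const (by fun_prop)
  have hswap : ∀ j, IsIID P (fun k => ξ (Equiv.swap 1 j k)) μ := fun j =>
    hξ.precomp (Equiv.swap 1 j).injective
  have hU : ∀ {ζ : ℕ → Ω → E d}, IsIID P ζ μ → Measurable fun ω => (ζ 0 ω, nnDist ζ N 0 ω) :=
    fun hζ => (hζ.measurable 0).prodMk (hζ.measurable_nnDist N 0)
  have hlaw : ∀ {ζ : ℕ → Ω → E d}, IsIID P ζ μ →
      P.map (fun ω => (ζ 0 ω, nnDist ζ N 0 ω)) = (Measure.pi fun _ => μ).map g := fun {ζ} hζ => by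
    rw [← hζ.map_finset, Measure.map_map hgm (measurable_pi_lambda _ fun j => hζ.measurable j)]
    rfl
  -- The value `j = 0` is admitted although no nearest neighbour has it. Since that exchange moves
  -- `0`, the image `Equiv.swap 1 j 0` is kept unevaluated.
  have hterm : ∀ j, ∫⁻ ω, {ω | ∀ k ∈ Finset.Ico N n,
      ((ξ (Equiv.swap 1 j 0) ω, nnDist (fun k => ξ (Equiv.swap 1 j k)) N 0 ω),
        ξ (Equiv.swap 1 j k) ω) ∈ {q : (E d × ℝ) × E d | ρ < dist q.1.1 q.2}}.indicator
      (fun ω => w (ξ (Equiv.swap 1 j 0) ω, nnDist (fun k => ξ (Equiv.swap 1 j k)) N 0 ω)) ω ∂P ≤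
      p ^ (n - N) * ∫⁻ ω, w (ξ 0 ω, nnDist ξ N 0 ω) ∂P := fun j => by
    have hind : IndepFun
        (fun ω => (ξ (Equiv.swap 1 j 0) ω, nnDist (fun k => ξ (Equiv.swap 1 j k)) N 0 ω))
        (fun ω (k : Finset.Ico N n) => ξ (Equiv.swap 1 j k) ω) P :=
      (hswap j).indepFun_of_finset (S := Finset.range N) (J := Finset.Ico N n)
        (by rw [Finset.range_eq_Ico]; exact Finset.Ico_disjoint_Ico_consecutive 0 N n) hgm
    have h1 := (hswap j).lintegral_indicator_le (hU (hswap j)) hind hA hw (p := p)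
      fun u hu => hp u.1 (hwK u hu)
    rw [Nat.card_Ico] at h1
    refine h1.trans (le_of_eq ?_)
    rw [← lintegral_map hw (hU (hswap j)), ← lintegral_map hw (hU hξ), hlaw (hswap j), hlaw hξ]
  calc ∫⁻ ω, {ω | ρ < nnDist ξ n 0 ω}.indicator (fun ω => w (ξ 0 ω, nnDist ξ n 0 ω)) ω ∂P
      ≤ ∫⁻ ω, ∑ j ∈ Finset.range n, {ω | ∀ k ∈ Finset.Ico N n,
        ((ξ (Equiv.swap 1 j 0) ω, nnDist (fun k => ξ (Equiv.swap 1 j k)) N 0 ω),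
        ξ (Equiv.swap 1 j k) ω) ∈ {q : (E d × ℝ) × E d | ρ < dist q.1.1 q.2}}.indicator
        (fun ω => w (ξ (Equiv.swap 1 j 0) ω,
          nnDist (fun k => ξ (Equiv.swap 1 j k)) N 0 ω)) ω ∂P := by
        refine lintegral_mono fun ω => ?_
        by_cases hω : ω ∈ {ω | ρ < nnDist ξ n 0 ω}
        · obtain ⟨j, hj, hj0, e⟩ := exists_dist_eq_nnDist (ξ := ξ) (hN.trans hNn) 0 ω
          have h0 : Equiv.swap 1 j 0 = 0 := Equiv.swap_apply_of_ne_of_ne (by omega) (Ne.symm hj0)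
          refine le_trans (le_of_eq ?_) (Finset.single_le_sum (fun _ _ => zero_le)
            (Finset.mem_range.2 hj))
          rw [indicator_of_mem hω, indicator_of_mem, nnDist_swap hN hNn hj hj0 ω e, h0]
          intro k hk
          have hk' := Finset.mem_Ico.1 hk
          change ρ < dist (ξ (Equiv.swap 1 j 0) ω) (ξ (Equiv.swap 1 j k) ω)
          rw [h0]
          refine (lt_nnDist_iff (hN.trans hNn) 0 ω ρ).1 hω _ ?_ fun h' =>
            absurd ((Equiv.swap 1 j).injective (h'.trans h0.symm)) (by omega)
          rcases eq_or_ne k j with rfl | h2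
          · rw [Equiv.swap_apply_right]; omega
          · rw [Equiv.swap_apply_of_ne_of_ne (by omega) h2]; exact hk'.2
        · rw [indicator_of_notMem hω]
          exact zero_le
    _ = ∑ j ∈ Finset.range n, ∫⁻ ω, _ ∂P := by
        refine lintegral_finsetSum _ fun j _ => ?_
        refine (hw.comp (hU (hswap j))).indicator ?_
        have h1 : MeasurableSet (⋂ k ∈ Finset.Ico N n, (fun ω =>
            ((ξ (Equiv.swap 1 j 0) ω, nnDist (fun k => ξ (Equiv.swap 1 j k)) N 0 ω),
              ξ (Equiv.swap 1 j k) ω)) ⁻¹' {q : (E d × ℝ) × E d | ρ < dist q.1.1 q.2}) :=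
          Finset.measurableSet_biInter _ fun k _ =>
            ((hU (hswap j)).prodMk ((hswap j).measurable k)) hA
        convert h1 using 1
        ext ω
        simp only [mem_ofPred_eq, mem_iInter, mem_preimage]
    _ ≤ ∑ j ∈ Finset.range n, p ^ (n - N) * ∫⁻ ω, w (ξ 0 ω, nnDist ξ N 0 ω) ∂P :=
        Finset.sum_le_sum fun j _ => hterm j
    _ = n * p ^ (n - N) * ∫⁻ ω, w (ξ 0 ω, nnDist ξ N 0 ω) ∂P := by
        rw [Finset.sum_const, Finset.card_range, nsmul_eq_mul, mul_assoc]

end IsIID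

end GMSP

/-! ### The score on large balls. -/

namespace GMSP

variable {q d : ℕ} {Θ Θ₀ : Set (E q)} {θ₀ : E q} {f : E q → E d → ℝ} {K : Set (E d)}
  {h φ₁ φ₂ : ℝ → ℝ}

/-- On the ball of radius `ρ` the density is at least half the minimum of `f θ₀` over `K`, and the
volume of this ball does not depend on its centre. Larger balls only gain mass. -/
theorem exists_le_modelProb (hf : IsDensityFamily Θ f) (hA : AssumptionA2 Θ Θ₀ θ₀ f)
    (hK : IsCompact K) (hKpos : ∀ x ∈ K, 0 < f θ₀ x) {ρ : ℝ} (hρ : 0 < ρ)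
    (hreg : ∀ θ ∈ Metric.closedBall θ₀ ρ, θ ∈ Θ₀ ∧
      ∀ x ∈ K, ∀ y ∈ Metric.closedBall x ρ, f θ₀ x / 2 ≤ f θ y) :
    ∃ c > 0, ∀ θ ∈ Metric.closedBall θ₀ ρ, ∀ x ∈ K, ∀ r, ρ ≤ r →
      c ≤ modelProb f θ (Metric.closedBall x r) := by
  rcases K.eq_empty_or_nonempty with rfl | hne
  · exact ⟨1, one_pos, by simp⟩
  obtain ⟨x₀, hx₀, hmin⟩ := hK.exists_isMinOn hne
    (continuous_of_continuousOn_prod hA.continuousOn hA.mem).continuousOn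
  set V := volume.real (Metric.closedBall (0 : E d) ρ) with hV
  have hVpos : 0 < V := ENNReal.toReal_pos (Metric.measure_closedBall_pos _ _ hρ).ne'
    (isCompact_closedBall _ _).measure_lt_top.ne
  refine ⟨f θ₀ x₀ / 2 * V, mul_pos (half_pos (hKpos x₀ hx₀)) hVpos, fun θ hθ x hx r hr => ?_⟩
  obtain ⟨hθ', hlow⟩ := hreg θ hθ
  have hint : ∀ r, IntegrableOn (f θ) (Metric.closedBall x r) := fun r =>
    integrableOn_of_continuousOn_prod hA.continuousOn hθ' (isCompact_closedBall x r)
  have hVx : volume.real (Metric.closedBall x ρ) = V := by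
    rw [hV, measureReal_def, measureReal_def, Measure.addHaar_closedBall_center]
  calc f θ₀ x₀ / 2 * V = ∫ _ in Metric.closedBall x ρ, f θ₀ x₀ / 2 := by
        rw [setIntegral_const, smul_eq_mul, hVx, mul_comm]
    _ ≤ ∫ y in Metric.closedBall x ρ, f θ y := by
        refine setIntegral_mono_on
          (integrableOn_const (isCompact_closedBall _ _).measure_lt_top.ne) (hint ρ)
          Metric.isClosed_closedBall.measurableSet fun y hy => ?_
        have := isMinOn_iff.1 hmin x hx
        exact le_trans (by linarith) (hlow x hx y hy)
    _ ≤ ∫ y in Metric.closedBall x r, f θ y :=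
        setIntegral_mono_set (hint r) (Eventually.of_forall (hf.nonneg θ (hA.subset hθ')))
          (Metric.closedBall_subset_closedBall hr).eventuallyLE

theorem modelProb_le_one (hf : IsDensityFamily Θ f) {θ : E q} (hθ : θ ∈ Θ) (B : Set (E d)) :
    modelProb f θ B ≤ 1 := by
  have h0 : 0 ≤ᵐ[volume] f θ := Eventually.of_forall (hf.nonneg θ hθ)
  refine (setIntegral_le_integral (integrable_of_lintegral_eq_one (hf.measurable θ hθ)
    (hf.nonneg θ hθ) (hf.lintegral_eq_one θ hθ)) h0).trans (le_of_eq ?_)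
  rw [integral_eq_lintegral_of_nonneg_ae h0 (hf.measurable θ hθ).aestronglyMeasurable,
    hf.lintegral_eq_one θ hθ, ENNReal.toReal_one]

/-- For a fixed ball the sample size enters only through the scalar `φ₁(nP)`, so scores for
different sample sizes are proportional. -/
theorem ballPsi_eq_smul (hh : IsRegularDivergence h φ₁ φ₂) {n : ℕ} {θ : E q} {B : Set (E d)}
    (hn : 0 < n * modelProb f θ B) :
    ballPsi h f n B θ = φ₁ (n * modelProb f θ B) •
      WithLp.toLp 2 fun j => (1 / modelProb f θ B) * ∫ y in B, pd f j θ y := by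
  ext j
  simp [ballPsi, hh.deriv_mul _ hn]

/-- For balls of probability bounded away from `0` the score of a sample of size `n` is controlled
by that of a smaller sample. -/
theorem exists_norm_ballPsi_le (hh : IsRegularDivergence h φ₁ φ₂) {c : ℝ} (hc : 0 < c) :
    ∃ C, 0 ≤ C ∧ ∃ N₀ : ℕ, ∀ N n : ℕ, N₀ ≤ N → N ≤ n → ∀ (θ : E q) (B : Set (E d)),
      c ≤ modelProb f θ B → modelProb f θ B ≤ 1 →
        ‖ballPsi h f n B θ‖ ≤ C * n ^ 2 * ‖ballPsi h f N B θ‖ := by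
  obtain ⟨C, hC, hg⟩ := hh.adm₁.growth
  obtain ⟨a, ha, haway⟩ := hh.away
  -- With `N ≥ 2 / c` the argument `N P` is at least `2`, where `|φ₁| ≥ a`. The comparison factor is
  -- the growth bound at `n P ≤ n` divided by `a`.
  obtain ⟨N₀, hN₀⟩ := exists_nat_ge (2 / c)
  refine ⟨2 * C / a, by positivity, N₀, fun N n hN hNn θ B hcB hB1 => ?_⟩
  have hp : 0 < modelProb f θ B := hc.trans_le hcB
  have hNc : 2 ≤ (N : ℝ) * modelProb f θ B := by
    have h1 : 2 / c ≤ (N : ℝ) := hN₀.trans (Nat.cast_le.2 hN)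
    rw [div_le_iff₀ hc] at h1
    exact h1.trans (mul_le_mul_of_nonneg_left hcB (Nat.cast_nonneg N))
  have hNn' : (N : ℝ) ≤ n := Nat.cast_le.2 hNn
  have hn0 : 0 < (n : ℝ) * modelProb f θ B :=
    lt_of_lt_of_le (by linarith) (mul_le_mul_of_nonneg_right hNn' hp.le)
  have hn1 : (1 : ℝ) ≤ n := by
    have : 0 < (n : ℝ) := pos_of_mul_pos_left hn0 hp.le
    exact_mod_cast (Nat.cast_pos.1 this : 0 < n)
  rw [ballPsi_eq_smul hh hn0, ballPsi_eq_smul hh (by linarith), norm_smul, norm_smul, ← mul_assoc]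
  refine mul_le_mul_of_nonneg_right ?_ (norm_nonneg _)
  have h1 := hg _ hn0.le
  have h2 := haway _ hNc
  have h3 : ((n : ℝ) * modelProb f θ B) ^ 2 ≤ n ^ 2 :=
    pow_le_pow_left₀ hn0.le (mul_le_of_le_one_right (Nat.cast_nonneg n) hB1) 2
  have h4 : (1 : ℝ) ≤ n ^ 2 := one_le_pow₀ hn1
  rw [Real.norm_eq_abs, Real.norm_eq_abs]
  calc |φ₁ (n * modelProb f θ B)| ≤ C * (1 + (n * modelProb f θ B) ^ 2) := h1
    _ ≤ C * (2 * n ^ 2) := by gcongr; linarith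
    _ = 2 * C / a * n ^ 2 * a := by field_simp
    _ ≤ 2 * C / a * n ^ 2 * |φ₁ (N * modelProb f θ B)| := by gcongr

variable {Ω : Type*} {ξ : ℕ → Ω → E d}

theorem psiOn_of_mem {n i : ℕ} {ω : Ω} (hω : ξ i ω ∈ K) (θ : E q) :
    psiOn h f ξ K n i θ ω = ballPsi h f n (nnBall ξ n i ω) θ :=
  indicator_of_mem (s := ξ i ⁻¹' K) hω _

theorem psiOn_of_notMem {n i : ℕ} {ω : Ω} (hω : ξ i ω ∉ K) (θ : E q) :
    psiOn h f ξ K n i θ ω = 0 :=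
  indicator_of_notMem (s := ξ i ⁻¹' K) hω _

variable [MeasurableSpace Ω] {P : Measure Ω} [IsProbabilityMeasure P]

/-- Large nearest neighbour distances have exponentially small probability. -/
theorem exists_measure_lt_nnDist_le (hf : IsDensityFamily Θ f) (hA : AssumptionA2 Θ Θ₀ θ₀ f)
    (hK : IsCompact K) (hKpos : ∀ x ∈ K, 0 < f θ₀ x) {ρ : ℝ} (hρ : 0 < ρ)
    (hreg : ∀ θ ∈ Metric.closedBall θ₀ ρ, θ ∈ Θ₀ ∧
      ∀ x ∈ K, ∀ y ∈ Metric.closedBall x ρ, f θ₀ x / 2 ≤ f θ y) :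
    ∃ p : ℝ, 0 < p ∧ p < 1 ∧
      ∀ x ∈ K, densityLaw (f θ₀) {y | ρ < dist x y} ≤ ENNReal.ofReal p := by
  have hθ₀ : θ₀ ∈ Θ := hA.subset hA.mem
  have hprob : IsProbabilityMeasure (densityLaw (f θ₀)) := ⟨by
    rw [densityLaw, withDensity_apply _ MeasurableSet.univ, Measure.restrict_univ,
      hf.lintegral_eq_one θ₀ hθ₀]⟩
  obtain ⟨c, hc, hcK⟩ := exists_le_modelProb hf hA hK hKpos hρ hreg
  -- The maximum with `1/2` keeps `p` positive, so that `p^(n-N)` may later be written as `p^n /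
  -- p^N`.
  refine ⟨max (1 - c) (1 / 2), by positivity, max_lt (by linarith) (by norm_num), fun x hx => ?_⟩
  have hset : {y | ρ < dist x y} = (Metric.closedBall x ρ)ᶜ := by
    ext y
    simp [dist_comm x y]
  have hm : MeasurableSet (Metric.closedBall x ρ) := Metric.isClosed_closedBall.measurableSet
  rw [hset, ← ofReal_measureReal, probReal_compl_eq_one_sub hm,
    densityLaw_real (hf.measurable θ₀ hθ₀) (hf.nonneg θ₀ hθ₀) hm]
  refine ENNReal.ofReal_le_ofReal ((sub_le_sub_left ?_ 1).trans (le_max_left _ _))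
  exact hcK θ₀ (Metric.mem_closedBall_self hρ.le) x hx ρ le_rfl

/-- No bound on the derivatives of `f` over large balls is available. The score for `n` is therefore
compared on the same ball with the score for a smaller size `N`, and then the exchange argument is
applied to the latter. Once `N` is fixed with finite expectation, the right side decays
exponentially in `n`. -/
theorem exists_lintegral_psiOn_lt_nnDist_le (hh : IsRegularDivergence h φ₁ φ₂)
    (hf : IsDensityFamily Θ f) (hA : AssumptionA2 Θ Θ₀ θ₀ f)
    (hξ : IsIID P ξ (densityLaw (f θ₀))) (hK : IsCompact K) (hKpos : ∀ x ∈ K, 0 < f θ₀ x)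
    {ρ : ℝ} (hρ : 0 < ρ) (hreg : ∀ θ ∈ Metric.closedBall θ₀ ρ, θ ∈ Θ₀ ∧
      ∀ x ∈ K, ∀ y ∈ Metric.closedBall x ρ, f θ₀ x / 2 ≤ f θ y) {p : ℝ≥0∞}
    (hp : ∀ x ∈ K, densityLaw (f θ₀) {y | ρ < dist x y} ≤ p) :
    ∃ C, 0 ≤ C ∧ ∃ N₀ : ℕ, ∀ N n : ℕ, N₀ ≤ N → N ≤ n → ∀ θ ∈ Metric.closedBall θ₀ ρ,
      ∫⁻ ω, {ω | ρ < nnDist ξ n 0 ω}.indicator (fun ω => ‖psiOn h f ξ K n 0 θ ω‖ₑ) ω ∂P ≤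
        ENNReal.ofReal (C * n ^ 2) * (n * p ^ (n - N) * ∫⁻ ω, ‖psiOn h f ξ K N 0 θ ω‖ₑ ∂P) := by
  obtain ⟨c, hc, hcK⟩ := exists_le_modelProb hf hA hK hKpos hρ hreg
  obtain ⟨C, hC, N₀, hN₀⟩ := exists_norm_ballPsi_le (f := f) hh hc
  refine ⟨C, hC, max N₀ 2, fun N n hN hNn θ hθ => ?_⟩
  have hθ' := (hreg θ hθ).1
  have hN2 : 2 ≤ N := le_of_max_le_right hN
  set w : E d × ℝ → ℝ≥0∞ := (Prod.fst ⁻¹' K).indicator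
    fun u => ‖ballPsi h f N (Metric.closedBall u.1 u.2) θ‖ₑ with hw
  have hwm : Measurable w :=
    (hA.measurable_ballPsi h N hθ').enorm.indicator (measurable_fst hK.measurableSet)
  have hwpsi : ∀ ω, ‖psiOn h f ξ K N 0 θ ω‖ₑ = w (ξ 0 ω, nnDist ξ N 0 ω) := fun ω => by
    by_cases hω : ξ 0 ω ∈ K
    · rw [psiOn_of_mem hω, hw, indicator_of_mem (show _ ∈ Prod.fst ⁻¹' K from hω)]
      rfl
    · rw [psiOn_of_notMem hω, hw,
        indicator_of_notMem (show _ ∉ Prod.fst ⁻¹' K from hω), enorm_zero]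
  have key := hξ.lintegral_lt_nnDist_le hp hwm
    (fun u hu => by by_contra h'; exact hu (indicator_of_notMem (s := Prod.fst ⁻¹' K) h' _)) hN2 hNn
  simp_rw [hwpsi]
  refine le_trans ?_ (mul_le_mul_right key _)
  rw [← lintegral_const_mul' _ _ ENNReal.ofReal_ne_top]
  refine lintegral_mono fun ω => ?_
  by_cases hω : ω ∈ {ω | ρ < nnDist ξ n 0 ω}
  · rw [indicator_of_mem hω, indicator_of_mem hω]
    by_cases hωK : ξ 0 ω ∈ K
    · rw [psiOn_of_mem hωK, hw, indicator_of_mem (show _ ∈ Prod.fst ⁻¹' K from hωK)]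
      change ‖ballPsi h f n (nnBall ξ n 0 ω) θ‖ₑ ≤ _ * ‖ballPsi h f N (nnBall ξ n 0 ω) θ‖ₑ
      rw [← ofReal_norm, ← ofReal_norm, ← ENNReal.ofReal_mul (by positivity)]
      exact ENNReal.ofReal_le_ofReal (hN₀ N n (le_of_max_le_left hN) hNn θ _
        (hcK θ hθ _ hωK _ (le_of_lt hω)) (modelProb_le_one hf (hA.subset hθ') _))
    · rw [psiOn_of_notMem hωK, enorm_zero]
      exact zero_le
  · rw [indicator_of_notMem hω]
    exact zero_le

end GMSP

/-! ### The linear approximation of score differences. -/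

namespace GMSP

variable {q d : ℕ} {Θ Θ₀ : Set (E q)} {θ₀ : E q} {f : E q → E d → ℝ} {K : Set (E d)}
  {h φ₁ φ₂ φ : ℝ → ℝ} {Ω : Type*} {ξ : ℕ → Ω → E d}

/-- The coefficient of `φ₂` in the limit of the Jacobian matrix, restricted to `K`. -/
noncomputable def coef₂ (f : E q → E d → ℝ) (θ₀ : E q) (K : Set (E d)) (j l : Fin q) : E d → ℝ :=
  K.indicator fun x => relDeriv f l θ₀ x * relDeriv f j θ₀ x

/-- The coefficient of `φ₁` in the limit of the Jacobian matrix, restricted to `K`. -/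
noncomputable def coef₁ (f : E q → E d → ℝ) (θ₀ : E q) (K : Set (E d)) (j l : Fin q) : E d → ℝ :=
  K.indicator (relDeriv₂ f l j θ₀)

/-- The linear approximation of the score differences. -/
noncomputable def scoreLin (φ₁ φ₂ : ℝ → ℝ) (f : E q → E d → ℝ) (θ₀ : E q) (K : Set (E d))
    (ξ : ℕ → Ω → E d) (n i : ℕ) (v : E q) (ω : Ω) : E q :=
  WithLp.toLp 2 fun j => ∑ l, (nnTerm (coef₂ f θ₀ K j l) φ₂ (densityLaw (f θ₀)) ξ n i ω +
    nnTerm (coef₁ f θ₀ K j l) φ₁ (densityLaw (f θ₀)) ξ n i ω) * v l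

theorem scoreLin_of_mem {n i : ℕ} {ω : Ω} (hω : ξ i ω ∈ K) (v : E q) :
    scoreLin φ₁ φ₂ f θ₀ K ξ n i v ω =
      limLin φ₁ φ₂ f θ₀ (ξ i ω) (nnZ (densityLaw (f θ₀)) ξ n i ω) v := by
  ext j
  simp only [scoreLin, limLin, limJac, nnTerm, coef₁, coef₂, indicator_of_mem hω]
  exact Finset.sum_congr rfl fun l _ => by ring

theorem scoreLin_of_notMem {n i : ℕ} {ω : Ω} (hω : ξ i ω ∉ K) (v : E q) :
    scoreLin φ₁ φ₂ f θ₀ K ξ n i v ω = 0 := by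
  ext j
  simp [scoreLin, nnTerm, coef₁, coef₂, hω]

theorem norm_toLp_sum_mul_le (a : Fin q → Fin q → ℝ) (v : E q) :
    ‖(WithLp.toLp 2 fun j => ∑ l, a j l * v l : E q)‖ ≤ (∑ j, ∑ l, |a j l|) * ‖v‖ := by
  have h1 : ∀ w : E q, ‖w‖ ≤ ∑ j, |w j| := fun w => by
    rw [EuclideanSpace.norm_eq]
    refine Real.sqrt_le_iff.2 ⟨by positivity, ?_⟩
    exact Finset.sum_sq_le_sq_sum_of_nonneg fun j _ => norm_nonneg (w j)
  refine (h1 _).trans ?_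
  rw [Finset.sum_mul]
  refine Finset.sum_le_sum fun j _ => ?_
  rw [Finset.sum_mul]
  refine (Finset.abs_sum_le_sum_abs (fun l => a j l * v l) Finset.univ).trans
    (Finset.sum_le_sum fun l _ => ?_)
  rw [abs_mul]
  exact mul_le_mul_of_nonneg_left (PiLp.norm_apply_le v l) (abs_nonneg _)

theorem norm_scoreLin_le {C : ℝ} (hC : 0 ≤ C)
    (hlim : ∀ x ∈ K, ∀ j l z, 0 ≤ z → |limJac φ₁ φ₂ f θ₀ x j l z| ≤ C * (1 + z ^ 2)) (n i : ℕ)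
    (v : E q) (ω : Ω) : ‖scoreLin φ₁ φ₂ f θ₀ K ξ n i v ω‖ ≤
      q * q * (C * (1 + nnZ (densityLaw (f θ₀)) ξ n i ω ^ 2)) * ‖v‖ := by
  by_cases hω : ξ i ω ∈ K
  · rw [scoreLin_of_mem hω]
    refine (norm_toLp_sum_mul_le _ v).trans (mul_le_mul_of_nonneg_right ?_ (norm_nonneg v))
    refine (Finset.sum_le_sum fun j _ => Finset.sum_le_sum fun l _ =>
      hlim _ hω j l _ (nnZ_nonneg _ ξ n i ω)).trans (le_of_eq ?_)
    simp [mul_assoc]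
  · rw [scoreLin_of_notMem hω, norm_zero]
    positivity

theorem norm_psiOn_sub_scoreLin_le (hh : IsRegularDivergence h φ₁ φ₂) (hf : IsDensityFamily Θ f)
    (hA : AssumptionA2 Θ Θ₀ θ₀ f) {C ε ρ : ℝ} (hε : 0 ≤ ε)
    (hreg : ∀ θ ∈ Metric.closedBall θ₀ ρ, θ ∈ Θ₀ ∧ ∀ x ∈ K, ∀ r, 0 < r → r ≤ ρ →
      IsScoreRegime h φ₁ φ₂ f θ₀ x C ε θ (Metric.closedBall x r)) {n i : ℕ} (hn : 0 < n) {ω : Ω}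
    (h0 : 0 < nnDist ξ n i ω) (hρ : ξ i ω ∈ K → nnDist ξ n i ω ≤ ρ) {s t : E q}
    (hs : s ∈ Metric.closedBall θ₀ ρ) (ht : t ∈ Metric.closedBall θ₀ ρ) :
    ‖psiOn h f ξ K n i s ω - psiOn h f ξ K n i t ω - scoreLin φ₁ φ₂ f θ₀ K ξ n i (s - t) ω‖ ≤
      q * ε * (1 + nnZ (densityLaw (f θ₀)) ξ n i ω ^ 2) * ‖s - t‖ := by
  by_cases hω : ξ i ω ∈ K
  · rw [psiOn_of_mem hω, psiOn_of_mem hω, scoreLin_of_mem hω, nnZ_eq hf hA, mul_assoc (q : ℝ)]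
    exact norm_ballPsi_sub_limLin_le hh hA hn (convex_closedBall θ₀ ρ)
      (fun θ hθ => (hreg θ hθ).1) (isCompact_closedBall _ _) hε
      (fun θ hθ => (hreg θ hθ).2 _ hω _ h0 (hρ hω)) hs ht
  · rw [psiOn_of_notMem hω, psiOn_of_notMem hω, scoreLin_of_notMem hω, sub_zero, sub_zero,
      norm_zero]
    positivity

variable [MeasurableSpace Ω] {P : Measure Ω}

/-- The size of the deviations in the laws of large numbers for the linear approximation. -/
noncomputable def linDev (P : Measure Ω) (φ₁ φ₂ : ℝ → ℝ) (f : E q → E d → ℝ) (θ₀ : E q)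
    (K : Set (E d)) (ξ : ℕ → Ω → E d) (n : ℕ) (ω : Ω) : ℝ :=
  ∑ j, ∑ l, (|nnDev P (coef₂ f θ₀ K j l) φ₂ (densityLaw (f θ₀)) ξ n ω| +
    |nnDev P (coef₁ f θ₀ K j l) φ₁ (densityLaw (f θ₀)) ξ n ω|)

theorem linDev_nonneg (n : ℕ) (ω : Ω) : 0 ≤ linDev P φ₁ φ₂ f θ₀ K ξ n ω :=
  Finset.sum_nonneg fun _ _ => Finset.sum_nonneg fun _ _ => by positivity

variable [IsProbabilityMeasure P]

theorem IsIID.integrable_nnTerm_of_admissible {μ : Measure (E d)} {a : E d → ℝ} {L : ℝ}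
    (hξ : IsIID P ξ μ) (ha : Measurable a) (hL : ∀ x, |a x| ≤ L) (hφ : Admissible φ) (n i : ℕ) :
    Integrable (nnTerm a φ μ ξ n i) P := by
  have key := hξ.integrable_nnTerm ha hL hφ.isTestFun n i
  have e : nnTerm a (fun z => φ (max z 0)) μ ξ n i = nnTerm a φ μ ξ n i := by
    ext ω
    rw [nnTerm, nnTerm, max_eq_left (nnZ_nonneg μ ξ n i ω)]
  rwa [e] at key

/-- The coefficients `a` for which the law of large numbers holds. -/
structure IsCoef (μ : Measure (E d)) (L : ℝ) (a : E d → ℝ) : Prop where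
  measurable : Measurable a
  bound : ∀ x, |a x| ≤ L
  supp : ∀ x, a x ≠ 0 → ∀ r > 0, 0 < μ.real (Metric.closedBall x r)

/-- The coefficients are continuous on the compact set `K`, hence bounded. Points of `K` have
positive density and so charge every ball around them. -/
theorem exists_isCoef (hf : IsDensityFamily Θ f) (hA : AssumptionA2 Θ Θ₀ θ₀ f)
    (hh : IsRegularDivergence h φ₁ φ₂)
    (hμ : IsFiniteMeasure (densityLaw (f θ₀))) (hK : IsCompact K) (hKpos : ∀ x ∈ K, 0 < f θ₀ x) :
    ∃ L, ∀ j l, IsCoef (densityLaw (f θ₀)) L (coef₂ f θ₀ K j l) ∧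
      IsCoef (densityLaw (f θ₀)) L (coef₁ f θ₀ K j l) := by
  obtain ⟨L, hL, hc₁, hc₂, hb⟩ := hA.exists_relDeriv_bound hK hKpos
  obtain ⟨C, -, -, hreg⟩ := exists_scoreRegime hh hA hK hKpos
  obtain ⟨ρ, hρ, hreg⟩ := hreg 1 one_pos
  have hθ₀ : θ₀ ∈ Θ := hA.subset hA.mem
  have hsupp : ∀ x ∈ K, ∀ r > 0, 0 < (densityLaw (f θ₀)).real (Metric.closedBall x r) :=
    fun x hx r hr => by
    refine lt_of_lt_of_le ?_ (measureReal_mono (Metric.closedBall_subset_closedBall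
      (min_le_left r ρ)))
    rw [densityLaw_real (hf.measurable θ₀ hθ₀) (hf.nonneg θ₀ hθ₀)
      Metric.isClosed_closedBall.measurableSet]
    exact (((hreg θ₀ (Metric.mem_closedBall_self hρ.le)).2 x hx).2 _ (lt_min hr hρ)
      (min_le_right _ _)).pos
  have key : ∀ u : E d → ℝ, ContinuousOn u K → (∀ x ∈ K, |u x| ≤ L * L + L) →
      IsCoef (densityLaw (f θ₀)) (L * L + L) (K.indicator u) := fun u hu hu' => by
    refine ⟨?_, fun x => ?_, fun x hx => hsupp x (mem_of_indicator_ne_zero hx)⟩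
    · classical
      rw [← piecewise_eq_indicator]
      exact hu.measurable_piecewise continuousOn_const hK.measurableSet
    · by_cases hx : x ∈ K
      · rw [indicator_of_mem hx]; exact hu' x hx
      · rw [indicator_of_notMem hx, abs_zero]; positivity
  refine ⟨L * L + L, fun j l => ⟨key _ ((hc₁ l).mul (hc₁ j)) fun x hx => ?_,
    key _ (hc₂ l j) fun x hx => ?_⟩⟩
  · rw [abs_mul]
    have := mul_le_mul ((hb x hx).1 l) ((hb x hx).1 j) (abs_nonneg _) hL
    linarith
  · have := (hb x hx).2 l j
    have := mul_nonneg hL hL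
    linarith

theorem IsIID.integrable_scoreLin {L : ℝ} (hξ : IsIID P ξ (densityLaw (f θ₀)))
    (hφ₁ : Admissible φ₁) (hφ₂ : Admissible φ₂)
    (hcoef : ∀ j l, IsCoef (densityLaw (f θ₀)) L (coef₂ f θ₀ K j l) ∧
      IsCoef (densityLaw (f θ₀)) L (coef₁ f θ₀ K j l)) (n i : ℕ) (v : E q) :
    Integrable (scoreLin φ₁ φ₂ f θ₀ K ξ n i v) P :=
  Integrable.of_eval_piLp fun j => integrable_finsetSum Finset.univ
    (f := fun l ω => (nnTerm (coef₂ f θ₀ K j l) φ₂ (densityLaw (f θ₀)) ξ n i ω +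
      nnTerm (coef₁ f θ₀ K j l) φ₁ (densityLaw (f θ₀)) ξ n i ω) * v l) fun l _ =>
    ((hξ.integrable_nnTerm_of_admissible (hcoef j l).1.measurable (hcoef j l).1.bound hφ₂ n i).add
      (hξ.integrable_nnTerm_of_admissible (hcoef j l).2.measurable (hcoef j l).2.bound hφ₁
        n i)).mul_const _

/-- The deviation is linear in `v`, with finitely many coefficients `nnDev` that do not involve `v`.
A single random variable thus controls all directions at once, and the supremum over `θ` needs no
further argument. -/
theorem IsIID.norm_mean_scoreLin_sub_le {L : ℝ} (hξ : IsIID P ξ (densityLaw (f θ₀)))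
    (hφ₁ : Admissible φ₁) (hφ₂ : Admissible φ₂)
    (hcoef : ∀ j l, IsCoef (densityLaw (f θ₀)) L (coef₂ f θ₀ K j l) ∧
      IsCoef (densityLaw (f θ₀)) L (coef₁ f θ₀ K j l)) (n : ℕ) (v : E q) (ω : Ω) :
    ‖(1 / (n : ℝ)) • ∑ i ∈ Finset.range n, scoreLin φ₁ φ₂ f θ₀ K ξ n i v ω -
      ∫ ω, scoreLin φ₁ φ₂ f θ₀ K ξ n 0 v ω ∂P‖ ≤ linDev P φ₁ φ₂ f θ₀ K ξ n ω * ‖v‖ := by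
  have hint := hξ.integrable_scoreLin hφ₁ hφ₂ hcoef n 0 v
  have i₂ := fun j l => hξ.integrable_nnTerm_of_admissible (hcoef j l).1.measurable
    (hcoef j l).1.bound hφ₂ n 0
  have i₁ := fun j l => hξ.integrable_nnTerm_of_admissible (hcoef j l).2.measurable
    (hcoef j l).2.bound hφ₁ n 0
  have e : (1 / (n : ℝ)) • ∑ i ∈ Finset.range n, scoreLin φ₁ φ₂ f θ₀ K ξ n i v ω -
      ∫ ω, scoreLin φ₁ φ₂ f θ₀ K ξ n 0 v ω ∂P =
      WithLp.toLp 2 fun j => ∑ l, (nnDev P (coef₂ f θ₀ K j l) φ₂ (densityLaw (f θ₀)) ξ n ω +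
        nnDev P (coef₁ f θ₀ K j l) φ₁ (densityLaw (f θ₀)) ξ n ω) * v l := by
    ext j
    have hI : (∫ ω, scoreLin φ₁ φ₂ f θ₀ K ξ n 0 v ω ∂P) j =
        ∑ l, (∫ ω, nnTerm (coef₂ f θ₀ K j l) φ₂ (densityLaw (f θ₀)) ξ n 0 ω ∂P +
          ∫ ω, nnTerm (coef₁ f θ₀ K j l) φ₁ (densityLaw (f θ₀)) ξ n 0 ω ∂P) * v l := by
      rw [eval_integral_piLp fun j => hint.eval_piLp j]
      have iA : ∀ l, Integrable (fun ω =>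
          (nnTerm (coef₂ f θ₀ K j l) φ₂ (densityLaw (f θ₀)) ξ n 0 ω +
            nnTerm (coef₁ f θ₀ K j l) φ₁ (densityLaw (f θ₀)) ξ n 0 ω) * v l) P :=
        fun l => ((i₂ j l).add (i₁ j l)).mul_const _
      simp only [scoreLin]
      rw [integral_finsetSum _ fun l _ => iA l]
      refine Finset.sum_congr rfl fun l _ => ?_
      rw [integral_mul_const, integral_add (i₂ j l) (i₁ j l)]
    rw [PiLp.sub_apply, hI]
    simp only [PiLp.smul_apply, WithLp.ofLp_sum, Finset.sum_apply, scoreLin, smul_eq_mul]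
    rw [Finset.sum_comm, Finset.mul_sum, ← Finset.sum_sub_distrib]
    refine Finset.sum_congr rfl fun l _ => ?_
    rw [← Finset.sum_mul, Finset.sum_add_distrib, nnDev, nnDev]
    ring
  rw [e]
  refine (norm_toLp_sum_mul_le _ v).trans (mul_le_mul_of_nonneg_right ?_ (norm_nonneg v))
  exact Finset.sum_le_sum fun j _ => Finset.sum_le_sum fun l _ => abs_add_le _ _

theorem IsIID.integrable_nnDev_of_admissible {μ : Measure (E d)} {a : E d → ℝ} {L : ℝ}
    (hξ : IsIID P ξ μ) (ha : IsCoef μ L a) (hφ : Admissible φ) (n : ℕ) :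
    Integrable (nnDev P a φ μ ξ n) P :=
  ((integrable_finsetSum _ fun i _ =>
    hξ.integrable_nnTerm_of_admissible ha.measurable ha.bound hφ n i).const_mul _).sub
    (integrable_const _)

theorem IsIID.integrable_linDev {L : ℝ} (hξ : IsIID P ξ (densityLaw (f θ₀)))
    (hφ₁ : Admissible φ₁) (hφ₂ : Admissible φ₂)
    (hcoef : ∀ j l, IsCoef (densityLaw (f θ₀)) L (coef₂ f θ₀ K j l) ∧
      IsCoef (densityLaw (f θ₀)) L (coef₁ f θ₀ K j l)) (n : ℕ) :
    Integrable (linDev P φ₁ φ₂ f θ₀ K ξ n) P :=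
  integrable_finsetSum _ fun j _ => integrable_finsetSum _ fun l _ =>
    (hξ.integrable_nnDev_of_admissible (hcoef j l).1 hφ₂ n).abs.add
      (hξ.integrable_nnDev_of_admissible (hcoef j l).2 hφ₁ n).abs

theorem IsIID.eventually_integral_linDev_le {L : ℝ} (hξ : IsIID P ξ (densityLaw (f θ₀)))
    (hμ : ∀ x r, densityLaw (f θ₀) (Metric.sphere x r) = 0)
    (hφ₁ : Admissible φ₁) (hφ₂ : Admissible φ₂)
    (hcoef : ∀ j l, IsCoef (densityLaw (f θ₀)) L (coef₂ f θ₀ K j l) ∧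
      IsCoef (densityLaw (f θ₀)) L (coef₁ f θ₀ K j l)) {ε : ℝ} (hε : 0 < ε) :
    ∀ᶠ n in atTop, ∫ ω, linDev P φ₁ φ₂ f θ₀ K ξ n ω ∂P ≤ ε := by
  set δ : ℝ := ε / (2 * (q * q + 1)) with hδ
  have hδ0 : 0 < δ := by positivity
  have e₂ : ∀ᶠ n in atTop, ∀ j l,
      ∫ ω, |nnDev P (coef₂ f θ₀ K j l) φ₂ (densityLaw (f θ₀)) ξ n ω| ∂P ≤ δ :=
    eventually_all.2 fun j => eventually_all.2 fun l =>
      hξ.nnLaw_of_admissible hμ (hcoef j l).1.measurable (hcoef j l).1.bound (hcoef j l).1.supp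
        hφ₂ δ hδ0
  have e₁ : ∀ᶠ n in atTop, ∀ j l,
      ∫ ω, |nnDev P (coef₁ f θ₀ K j l) φ₁ (densityLaw (f θ₀)) ξ n ω| ∂P ≤ δ :=
    eventually_all.2 fun j => eventually_all.2 fun l =>
      hξ.nnLaw_of_admissible hμ (hcoef j l).2.measurable (hcoef j l).2.bound (hcoef j l).2.supp
        hφ₁ δ hδ0
  filter_upwards [e₁, e₂] with n h₁ h₂
  have i₂ := fun j l => (hξ.integrable_nnDev_of_admissible (hcoef j l).1 hφ₂ n).abs
  have i₁ := fun j l => (hξ.integrable_nnDev_of_admissible (hcoef j l).2 hφ₁ n).abs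
  have iA : ∀ j l, Integrable (fun ω =>
      |nnDev P (coef₂ f θ₀ K j l) φ₂ (densityLaw (f θ₀)) ξ n ω| +
        |nnDev P (coef₁ f θ₀ K j l) φ₁ (densityLaw (f θ₀)) ξ n ω|) P :=
    fun j l => (i₂ j l).add (i₁ j l)
  simp only [linDev]
  rw [integral_finsetSum _ fun j _ => integrable_finsetSum _ fun l _ => iA j l]
  calc _ ≤ ∑ j : Fin q, ∑ l : Fin q, (δ + δ) := by
        refine Finset.sum_le_sum fun j _ => ?_
        rw [integral_finsetSum _ fun l _ => iA j l]
        refine Finset.sum_le_sum fun l _ => ?_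
        rw [integral_add (i₂ j l) (i₁ j l)]
        exact add_le_add (h₂ j l) (h₁ j l)
    _ = ε * (q * q / (q * q + 1)) := by
        simp only [Finset.sum_const, Finset.card_univ, Fintype.card_fin, nsmul_eq_mul, hδ]
        field_simp
        ring
    _ ≤ ε := by
        refine mul_le_of_le_one_right hε.le ?_
        rw [div_le_one (by positivity)]
        linarith

end GMSP

/-! ### The centring term and the normalized sum. -/

namespace GMSP

variable {q d : ℕ} {Θ Θ₀ : Set (E q)} {θ₀ : E q} {f : E q → E d → ℝ} {K : Set (E d)}
  {h φ₁ φ₂ φ : ℝ → ℝ} {Ω : Type*} [MeasurableSpace Ω] {P : Measure Ω} [IsProbabilityMeasure P]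
  {ξ : ℕ → Ω → E d}

/-- On small balls the linearization error has mean at most `q ε (2 + 2 fourthMoment) ‖s - t‖`. On
large balls around points of `K` the linear part is at most of order `n²` on an event of probability
`p^(n-1)`, while the two scores are bounded separately by `e`, without a factor `‖s - t‖`. -/
theorem norm_integral_scoreLin_sub_le (hh : IsRegularDivergence h φ₁ φ₂)
    (hf : IsDensityFamily Θ f) (hA : AssumptionA2 Θ Θ₀ θ₀ f)
    (hξ : IsIID P ξ (densityLaw (f θ₀))) (hμ : ∀ x r, densityLaw (f θ₀) (Metric.sphere x r) = 0)
    (hK : IsCompact K) {L : ℝ} (hcoef : ∀ j l, IsCoef (densityLaw (f θ₀)) L (coef₂ f θ₀ K j l) ∧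
      IsCoef (densityLaw (f θ₀)) L (coef₁ f θ₀ K j l)) {C ε ρ p e : ℝ} (hC : 0 ≤ C) (hε : 0 ≤ ε)
    (hp0 : 0 ≤ p) (he : 0 ≤ e)
    (hlim : ∀ x ∈ K, ∀ j l z, 0 ≤ z → |limJac φ₁ φ₂ f θ₀ x j l z| ≤ C * (1 + z ^ 2))
    (hreg : ∀ θ ∈ Metric.closedBall θ₀ ρ, θ ∈ Θ₀ ∧ ∀ x ∈ K, ∀ r, 0 < r → r ≤ ρ →
      IsScoreRegime h φ₁ φ₂ f θ₀ x C ε θ (Metric.closedBall x r))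
    (hp : ∀ x ∈ K, densityLaw (f θ₀) {y | ρ < dist x y} ≤ ENNReal.ofReal p) {n : ℕ} (hn : 2 ≤ n)
    {s t : E q} (hs : s ∈ Metric.closedBall θ₀ ρ) (ht : t ∈ Metric.closedBall θ₀ ρ)
    (his : Integrable (psiOn h f ξ K n 0 s) P) (hit : Integrable (psiOn h f ξ K n 0 t) P)
    (hes : ∫⁻ ω, {ω | ρ < nnDist ξ n 0 ω}.indicator (fun ω => ‖psiOn h f ξ K n 0 s ω‖ₑ) ω ∂P ≤
      ENNReal.ofReal e)
    (het : ∫⁻ ω, {ω | ρ < nnDist ξ n 0 ω}.indicator (fun ω => ‖psiOn h f ξ K n 0 t ω‖ₑ) ω ∂P ≤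
      ENNReal.ofReal e) :
    ‖∫ ω, scoreLin φ₁ φ₂ f θ₀ K ξ n 0 (s - t) ω ∂P -
        (lambdaOn P h f ξ K n s - lambdaOn P h f ξ K n t)‖ ≤
      (q * ε * (2 + 2 * fourthMoment) + q * q * (C * (1 + n ^ 2)) * p ^ (n - 1)) * ‖s - t‖ +
        2 * e := by
  have hprob := hξ.isProbabilityMeasure
  set μ := densityLaw (f θ₀) with hμdef
  have hM := fourthMoment_nonneg
  set v := s - t with hv
  set D : ℝ := q * q * (C * (1 + n ^ 2)) * ‖v‖ with hD
  have hD0 : 0 ≤ D := by positivity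
  have hil := hξ.integrable_scoreLin hh.adm₁ hh.adm₂ hcoef n 0 v
  have hRm : MeasurableSet {ω | ρ < nnDist ξ n 0 ω} :=
    measurableSet_lt measurable_const (hξ.measurable_nnDist n 0)
  have hKRm : MeasurableSet {ω | ξ 0 ω ∈ K ∧ ρ < nnDist ξ n 0 ω} :=
    (hξ.measurable 0 hK.measurableSet).inter hRm
  have hms := hA.measurable_psiOn hξ hK h n 0 (hreg s hs).1
  have hmt := hA.measurable_psiOn hξ hK h n 0 (hreg t ht).1
  have hmz := hξ.measurable_nnZ n 0
  have hid : Integrable (fun ω => psiOn h f ξ K n 0 s ω - psiOn h f ξ K n 0 t ω) P := his.sub hit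
  rw [lambdaOn, lambdaOn, ← integral_sub his hit, ← integral_sub hil hid]
  have hpt : ∀ᵐ ω ∂P, ‖scoreLin φ₁ φ₂ f θ₀ K ξ n 0 v ω -
      (psiOn h f ξ K n 0 s ω - psiOn h f ξ K n 0 t ω)‖ₑ ≤
      ENNReal.ofReal (q * ε * ‖v‖) * ENNReal.ofReal (1 + nnZ μ ξ n 0 ω ^ 2) +
        ({ω | ρ < nnDist ξ n 0 ω}.indicator (fun ω => ‖psiOn h f ξ K n 0 s ω‖ₑ) ω +
        ({ω | ρ < nnDist ξ n 0 ω}.indicator (fun ω => ‖psiOn h f ξ K n 0 t ω‖ₑ) ω +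
        {ω | ξ 0 ω ∈ K ∧ ρ < nnDist ξ n 0 ω}.indicator (fun _ => ENNReal.ofReal D) ω)) := by
    filter_upwards [hξ.ae_nnDist_pos hμ hn 0] with ω hω
    by_cases hfar : ξ 0 ω ∈ K ∧ ρ < nnDist ξ n 0 ω
    · refine le_add_left ?_
      rw [indicator_of_mem (show ω ∈ {ω | ρ < nnDist ξ n 0 ω} from hfar.2),
        indicator_of_mem (show ω ∈ {ω | ρ < nnDist ξ n 0 ω} from hfar.2),
        indicator_of_mem (show ω ∈ {ω | ξ 0 ω ∈ K ∧ ρ < nnDist ξ n 0 ω} from hfar)]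
      have h1 : ‖scoreLin φ₁ φ₂ f θ₀ K ξ n 0 v ω‖ₑ ≤ ENNReal.ofReal D := by
        rw [← ofReal_norm]
        refine ENNReal.ofReal_le_ofReal ((norm_scoreLin_le hC hlim n 0 v ω).trans ?_)
        have h0 := nnZ_nonneg μ ξ n 0 ω
        have hz := nnZ_le μ ξ n 0 ω
        rw [hD]
        gcongr
      refine (enorm_sub_le).trans ((add_le_add h1 enorm_sub_le).trans (le_of_eq ?_))
      rw [add_comm, add_assoc]
    · refine le_add_right ?_
      rw [← ENNReal.ofReal_mul (by positivity), ← ofReal_norm, norm_sub_rev]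
      refine ENNReal.ofReal_le_ofReal ((norm_psiOn_sub_scoreLin_le hh hf hA hε hreg
        (by omega) hω (fun hωK => not_lt.1 fun hlt => hfar ⟨hωK, hlt⟩) hs ht).trans (le_of_eq ?_))
      ring
  have hP := hξ.measure_lt_nnDist_le hK.measurableSet hp hn (i := 0) (by omega)
  have hlint : ∫⁻ ω, ‖scoreLin φ₁ φ₂ f θ₀ K ξ n 0 v ω -
      (psiOn h f ξ K n 0 s ω - psiOn h f ξ K n 0 t ω)‖ₑ ∂P ≤
      ENNReal.ofReal ((q * ε * ‖v‖) * (2 + 2 * fourthMoment) + (e + (e + D * p ^ (n - 1)))) := by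
    refine (lintegral_mono_ae hpt).trans ?_
    rw [lintegral_add_left (((hmz.pow_const 2).const_add 1).ennreal_ofReal.const_mul _),
      lintegral_add_left (hms.enorm.indicator hRm), lintegral_add_left (hmt.enorm.indicator hRm),
      lintegral_const_mul' _ _ ENNReal.ofReal_ne_top, lintegral_indicator_const hKRm,
      ENNReal.ofReal_add (by positivity) (by positivity), ENNReal.ofReal_add he (by positivity),
      ENNReal.ofReal_add he (by positivity),
      ENNReal.ofReal_mul (p := q * ε * ‖v‖) (q := 2 + 2 * fourthMoment) (by positivity),
      ENNReal.ofReal_mul hD0, ENNReal.ofReal_pow hp0]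
    gcongr
    exact hξ.lintegral_one_add_sq_le hμ hn (i := 0) (by omega)
  refine (norm_integral_le_lintegral_norm _).trans ?_
  simp_rw [ofReal_norm]
  refine (ENNReal.toReal_le_of_le_ofReal (by positivity) hlint).trans (le_of_eq ?_)
  rw [hD]
  ring

/-- As `1/√n = √n / n`, all errors proportional to `r` acquire the factor `√n r`, absorbed by the
same term of the denominator. The remaining `√n e` is absorbed by its `1`. -/
theorem norm_score_sum_le {F : Type*} [NormedAddCommGroup F] [NormedSpace ℝ F] {n : ℕ}
    (hn : 0 < n) (D S : ℕ → F) (ES EL : F) {a b c e r : ℝ} {w : ℕ → ℝ}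
    (hr : 0 ≤ r) (hc : 0 ≤ c) (hb : 0 ≤ b) (ha : 0 ≤ a) (hw : ∀ i, 0 ≤ w i) (he : 0 ≤ e)
    (h1 : ∀ i < n, ‖D i - S i‖ ≤ a * w i * r)
    (h2 : ‖(1 / (n : ℝ)) • ∑ i ∈ Finset.range n, S i - ES‖ ≤ b * r)
    (h3 : ‖ES - EL‖ ≤ c * r + e) :
    ‖(1 / √(n : ℝ)) • ∑ i ∈ Finset.range n, D i - √(n : ℝ) • EL‖ / (1 + √(n : ℝ) * r) ≤
      a * (1 / n * ∑ i ∈ Finset.range n, w i) + b + (c + √(n : ℝ) * e) := by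
  have hn0 : (0 : ℝ) < n := Nat.cast_pos.2 hn
  have hs : 0 < √(n : ℝ) := Real.sqrt_pos.2 hn0
  have hss : 1 / √(n : ℝ) = √(n : ℝ) * (1 / n) := by
    rw [mul_one_div, Real.sqrt_div_self']
  have hW : 0 ≤ 1 / (n : ℝ) * ∑ i ∈ Finset.range n, w i :=
    mul_nonneg (by positivity) (Finset.sum_nonneg fun i _ => hw i)
  have e1 : (1 / √(n : ℝ)) • ∑ i ∈ Finset.range n, D i - √(n : ℝ) • EL =
      √(n : ℝ) • ((1 / (n : ℝ)) • ∑ i ∈ Finset.range n, (D i - S i) +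
        ((1 / (n : ℝ)) • ∑ i ∈ Finset.range n, S i - ES) + (ES - EL)) := by
    rw [hss, Finset.sum_sub_distrib]
    module
  have h4 : ‖(1 / (n : ℝ)) • ∑ i ∈ Finset.range n, (D i - S i)‖ ≤
      a * (1 / n * ∑ i ∈ Finset.range n, w i) * r := by
    rw [norm_smul, Real.norm_of_nonneg (by positivity)]
    calc 1 / (n : ℝ) * ‖∑ i ∈ Finset.range n, (D i - S i)‖
        ≤ 1 / n * ∑ i ∈ Finset.range n, a * w i * r := by
          gcongr
          exact (norm_sum_le _ _).trans (Finset.sum_le_sum fun i hi => h1 i (Finset.mem_range.1 hi))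
      _ = a * (1 / n * ∑ i ∈ Finset.range n, w i) * r := by
          rw [← Finset.sum_mul, ← Finset.mul_sum]
          ring
  rw [e1, norm_smul, Real.norm_of_nonneg hs.le, div_le_iff₀ (by positivity)]
  have h5 := (norm_add₃_le (a := (1 / (n : ℝ)) • ∑ i ∈ Finset.range n, (D i - S i))
    (b := (1 / (n : ℝ)) • ∑ i ∈ Finset.range n, S i - ES) (c := ES - EL)).trans
    (add_le_add (add_le_add h4 h2) h3)
  refine (mul_le_mul_of_nonneg_left h5 hs.le).trans ?_
  set W := a * (1 / (n : ℝ) * ∑ i ∈ Finset.range n, w i) with hWdef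
  have hW' : 0 ≤ W := mul_nonneg ha hW
  have h6 : 0 ≤ √(n : ℝ) * e * (√(n : ℝ) * r) := by positivity
  have h7 : √(n : ℝ) * (W * r + b * r + (c * r + e)) =
    (W + b + c) * (√(n : ℝ) * r) + √(n : ℝ) * e := by ring
  rw [h7]
  nlinarith

end GMSP

/-! ### The stochastic differentiability convergence. -/

namespace GMSP

variable {q d : ℕ} {Θ Θ₀ : Set (E q)} {θ₀ : E q} {f : E q → E d → ℝ} {K : Set (E d)}
  {h φ₁ φ₂ φ : ℝ → ℝ} {Ω : Type*} [MeasurableSpace Ω] {P : Measure Ω} [IsProbabilityMeasure P]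
  {ξ : ℕ → Ω → E d}

theorem tendsto_pow_mul_pow_sub (k N : ℕ) {p : ℝ} (hp0 : 0 < p) (hp1 : p < 1) :
    Tendsto (fun n : ℕ => (n : ℝ) ^ k * p ^ (n - N)) atTop (𝓝 0) := by
  have h1 := (tendsto_pow_const_mul_const_pow_of_abs_lt_one k
    (by rwa [abs_of_pos hp0] : |p| < 1)).mul_const ((p ^ N)⁻¹)
  rw [zero_mul] at h1
  refine h1.congr' ?_
  filter_upwards [eventually_ge_atTop N] with n hn
  rw [pow_sub₀ _ hp0.ne' hn, mul_assoc]

/-- If `X n` dominates `Y n` outside of small events and the means of `X n` are small, then `Y n`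
is small with large probability. -/
theorem measure_lt_le_of_le_ofReal {X : Ω → ℝ} {Y : Ω → ℝ≥0∞} {B : Set Ω} {ε₀ η : ℝ} (hε₀ : 0 < ε₀)
    {ε : ℝ≥0∞} (hε : ENNReal.ofReal ε₀ ≤ ε) (hX : Integrable X P) (hX0 : ∀ ω, 0 ≤ X ω)
    (hXη : ∫ ω, X ω ∂P ≤ ε₀ * η) (hXY : ∀ᵐ ω ∂P, ω ∉ B → Y ω ≤ ENNReal.ofReal (X ω)) :
    P {ω | ε < Y ω} ≤ P B + ENNReal.ofReal η := by
  have h1 : P.real {ω | ε₀ ≤ X ω} ≤ η := by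
    have := mul_meas_ge_le_integral_of_nonneg (Eventually.of_forall hX0) hX ε₀
    exact le_of_mul_le_mul_left (this.trans hXη) hε₀
  have h2 : P {ω | ε < Y ω} ≤ P (B ∪ {ω | ε₀ ≤ X ω}) := by
    refine measure_mono_ae ?_
    filter_upwards [hXY] with ω hω hlt
    by_cases hB : ω ∈ B
    · exact Or.inl hB
    · refine Or.inr ?_
      by_contra hlt'
      have h3 : ENNReal.ofReal (X ω) ≤ ENNReal.ofReal ε₀ :=
        ENNReal.ofReal_le_ofReal (not_le.1 hlt').le
      exact absurd hlt (not_lt.2 ((hω hB).trans (h3.trans hε)))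
  refine h2.trans ((measure_union_le _ _).trans (add_le_add le_rfl ?_))
  rw [← ofReal_measureReal]
  exact ENNReal.ofReal_le_ofReal h1

/-- Outside the event `B`, where some sample point in `K` has a distant nearest neighbour, the ratio
is almost surely at most a random variable `X` which does not involve `θ`. The mean of `X` is small
and `B` has exponentially small probability, so Markov's inequality concludes. -/
theorem tendsto_measure_supRatio (hd : 0 < d) (hf : IsDensityFamily Θ f)
    (hA2 : AssumptionA2 Θ Θ₀ θ₀ f) (hξ : IsIIDSample P ξ (f θ₀)) (hK : IsCompact K)
    (hKpos : ∀ x ∈ K, 0 < f θ₀ x) (hh : IsRegularDivergence h φ₁ φ₂) {α : ℕ → ℝ} {c : ℕ → E q}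
    (hα : IsShrinking θ₀ α c) (hsup : ∀ᶠ n in atTop,
      (⨆ θ ∈ Metric.closedBall θ₀ (α n), ∫⁻ ω, ‖psiOn h f ξ K n 0 θ ω‖ₑ ∂P) < ∞)
    {ε : ℝ≥0∞} (hε : 0 < ε) :
    Tendsto (fun n => P {ω | ε < supRatio P h f ξ K (Metric.closedBall θ₀ (α n)) (c n) n ω})
      atTop (𝓝 0) := by
  have hI := hξ.isIID
  have hprob := hI.isProbabilityMeasure
  have hμ := densityLaw_sphere hd (f θ₀)
  set μ := densityLaw (f θ₀) with hμdef
  have hM := fourthMoment_nonneg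
  set m : ℝ := 2 + 2 * fourthMoment with hm
  have hm0 : 0 < m := by positivity
  obtain ⟨L, hcoef⟩ := exists_isCoef hf hA2 hh inferInstance hK hKpos
  obtain ⟨C, hC, hlim, hreg⟩ := exists_scoreRegime hh hA2 hK hKpos
  refine ENNReal.tendsto_nhds_zero.2 fun η hη => ?_
  obtain ⟨ε₀, hε₀, hε₀ε⟩ : ∃ ε₀ : ℝ, 0 < ε₀ ∧ ENNReal.ofReal ε₀ ≤ ε := by
    obtain ⟨a, ha, haε⟩ := ENNReal.lt_iff_exists_nnreal_btwn.1 hε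
    exact ⟨a, by exact_mod_cast ha, by simpa using haε.le⟩
  obtain ⟨η₀, hη₀, hη₀η⟩ : ∃ η₀ : ℝ, 0 < η₀ ∧ ENNReal.ofReal η₀ ≤ η := by
    obtain ⟨a, ha, haη⟩ := ENNReal.lt_iff_exists_nnreal_btwn.1 hη
    exact ⟨a, by exact_mod_cast ha, by simpa using haη.le⟩
  -- The term `q κ m` enters the mean of `X` twice, through the sample mean and through the
  -- centring, with `ε₀η₀/16` each. The deviations and the two exponentially small terms take
  -- `ε₀η₀/8` each, which makes `ε₀η₀/2` in total.
  set κ : ℝ := ε₀ * η₀ / (16 * (q + 1) * m) with hκ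
  have hκ0 : 0 < κ := by positivity
  have hκm : q * κ * m ≤ ε₀ * η₀ / 16 := by
    have : q * κ * m = ε₀ * η₀ / 16 * (q / (q + 1)) := by rw [hκ]; field_simp
    rw [this]
    refine mul_le_of_le_one_right (by positivity) ?_
    rw [div_le_one (by positivity)]; linarith
  obtain ⟨ρ, hρ, hreg⟩ := hreg κ hκ0
  have hreg₁ : ∀ θ ∈ Metric.closedBall θ₀ ρ, θ ∈ Θ₀ ∧
      ∀ x ∈ K, ∀ y ∈ Metric.closedBall x ρ, f θ₀ x / 2 ≤ f θ y :=
    fun θ hθ => ⟨(hreg θ hθ).1, fun x hx => ((hreg θ hθ).2 x hx).1⟩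
  have hreg₂ : ∀ θ ∈ Metric.closedBall θ₀ ρ, θ ∈ Θ₀ ∧ ∀ x ∈ K, ∀ r, 0 < r → r ≤ ρ →
      IsScoreRegime h φ₁ φ₂ f θ₀ x C κ θ (Metric.closedBall x r) :=
    fun θ hθ => ⟨(hreg θ hθ).1, fun x hx => ((hreg θ hθ).2 x hx).2⟩
  obtain ⟨p, hp0, hp1, hp⟩ := exists_measure_lt_nnDist_le hf hA2 hK hKpos hρ hreg₁
  obtain ⟨C', hC', N₀, htail⟩ := exists_lintegral_psiOn_lt_nnDist_le hh hf hA2 hI hK hKpos hρ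
    hreg₁ hp
  -- A reference sample size fixed once, with finite supremum `S`. The radii `α n` need not
  -- decrease, so `α n ≤ α N` is imposed below as an eventual condition, possible because `α N > 0`.
  obtain ⟨N, hN, hNsup⟩ := ((eventually_ge_atTop N₀).and hsup).exists
  set S : ℝ := (⨆ θ ∈ Metric.closedBall θ₀ (α N), ∫⁻ ω, ‖psiOn h f ξ K N 0 θ ω‖ₑ ∂P).toReal
    with hS
  have hS0 : 0 ≤ S := ENNReal.toReal_nonneg
  set e : ℕ → ℝ := fun n => C' * n ^ 2 * (n * p ^ (n - N) * S) with he
  have he0 : ∀ n, 0 ≤ e n := fun n => by rw [he]; positivity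
  have hlim₁ : Tendsto (fun n : ℕ => (q * q * (C * (1 + n ^ 2)) * p ^ (n - 1) : ℝ)) atTop
      (𝓝 0) := by
    have h1 := ((tendsto_pow_mul_pow_sub 0 1 hp0 hp1).add
      (tendsto_pow_mul_pow_sub 2 1 hp0 hp1)).const_mul (q * q * C)
    rw [add_zero, mul_zero] at h1
    refine h1.congr fun n => ?_
    ring
  have hlim₂ : Tendsto (fun n : ℕ => √(n : ℝ) * (2 * e n)) atTop (𝓝 0) := by
    have h1 := (tendsto_pow_mul_pow_sub 4 N hp0 hp1).const_mul (2 * C' * S)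
    rw [mul_zero] at h1
    refine squeeze_zero (fun n => by have := he0 n; positivity) (fun n => ?_) h1
    have h2 : √(n : ℝ) ≤ n := by
      refine Real.sqrt_le_iff.2 ⟨Nat.cast_nonneg n, ?_⟩
      exact_mod_cast Nat.le_self_pow two_ne_zero n
    have h3 := mul_le_mul_of_nonneg_right h2 (by have := he0 n; positivity : 0 ≤ 2 * e n)
    refine h3.trans (le_of_eq ?_)
    simp only [he]
    ring
  have hlim₃ : Tendsto (fun n : ℕ => (n * p ^ (n - 1) : ℝ)) atTop (𝓝 0) := by
    simpa using tendsto_pow_mul_pow_sub 1 1 hp0 hp1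
  have hδ : 0 < ε₀ * η₀ / 8 := by positivity
  filter_upwards [eventually_ge_atTop 2, eventually_ge_atTop N, hsup,
    hα.tendsto.eventually_le_const hρ, hα.tendsto.eventually_le_const (hα.pos N),
    hI.eventually_integral_linDev_le hμ hh.adm₁ hh.adm₂ hcoef hδ,
    hlim₁.eventually_le_const hδ, hlim₂.eventually_le_const hδ,
    hlim₃.eventually_le_const (half_pos hη₀)] with n hn2 hnN hnsup hαρ hαN hdev h₁ h₂ h₃
  have hn0 : 0 < n := by omega
  set T := Metric.closedBall θ₀ (α n) with hT
  have hTρ : T ⊆ Metric.closedBall θ₀ ρ := Metric.closedBall_subset_closedBall hαρ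
  have hcT : c n ∈ T := hα.mem n
  have hint : ∀ θ ∈ T, Integrable (psiOn h f ξ K n 0 θ) P := fun θ hθ =>
    ⟨(hA2.measurable_psiOn hI hK h n 0 (hreg θ (hTρ hθ)).1).aestronglyMeasurable,
      (le_iSup₂ (f := fun θ (_ : θ ∈ T) => ∫⁻ ω, ‖psiOn h f ξ K n 0 θ ω‖ₑ ∂P) θ hθ).trans_lt
        hnsup⟩
  have hfar : ∀ θ ∈ T, ∫⁻ ω, {ω | ρ < nnDist ξ n 0 ω}.indicator
      (fun ω => ‖psiOn h f ξ K n 0 θ ω‖ₑ) ω ∂P ≤ ENNReal.ofReal (e n) := fun θ hθ => by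
    refine (htail N n hN hnN θ (hTρ hθ)).trans ?_
    simp only [he]
    rw [ENNReal.ofReal_mul (p := C' * n ^ 2) (by positivity),
      ENNReal.ofReal_mul (q := S) (by positivity), ENNReal.ofReal_mul (Nat.cast_nonneg n), ENNReal.ofReal_natCast, ENNReal.ofReal_pow hp0.le, hS,
      ENNReal.ofReal_toReal hNsup.ne]
    gcongr
    exact le_iSup₂ (f := fun θ (_ : θ ∈ Metric.closedBall θ₀ (α N)) =>
      ∫⁻ ω, ‖psiOn h f ξ K N 0 θ ω‖ₑ ∂P) θ (Metric.closedBall_subset_closedBall hαN hθ)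
  set B : Set Ω := ⋃ i ∈ Finset.range n, {ω | ξ i ω ∈ K ∧ ρ < nnDist ξ n i ω} with hB
  have hPB : P B ≤ ENNReal.ofReal (η₀ / 2) := by
    refine (measure_biUnion_finset_le _ _).trans ?_
    refine (Finset.sum_le_sum fun i hi =>
      hI.measure_lt_nnDist_le hK.measurableSet hp hn2 (Finset.mem_range.1 hi)).trans ?_
    rw [Finset.sum_const, Finset.card_range, nsmul_eq_mul, ← ENNReal.ofReal_pow hp0.le,
      ← ENNReal.ofReal_natCast, ← ENNReal.ofReal_mul (Nat.cast_nonneg n)]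
    exact ENNReal.ofReal_le_ofReal h₃
  set A : ℝ := q * κ * m + q * q * (C * (1 + n ^ 2)) * p ^ (n - 1) with hAdef
  set X : Ω → ℝ := fun ω => q * κ * (1 / n * ∑ i ∈ Finset.range n, (1 + nnZ μ ξ n i ω ^ 2)) +
    linDev P φ₁ φ₂ f θ₀ K ξ n ω + (A + √(n : ℝ) * (2 * e n)) with hX
  have hA0 : 0 ≤ A := by positivity
  have hen : 0 ≤ √(n : ℝ) * (2 * e n) := by have := he0 n; positivity
  have hz0 : ∀ i ω, 0 ≤ 1 + nnZ μ ξ n i ω ^ 2 := fun i ω => by positivity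
  have hzint : ∀ i, Integrable (fun ω => 1 + nnZ μ ξ n i ω ^ 2) P := fun i =>
    hI.integrable_test (φ := fun z => 1 + z ^ 2) ⟨by fun_prop, fun M => ⟨1 + M ^ 2,
      fun z hz hzM => by rw [abs_of_nonneg (by positivity)]; gcongr⟩⟩ n i
  have hzm : ∀ i < n, ∫ ω, (1 + nnZ μ ξ n i ω ^ 2) ∂P ≤ m := fun i hi => by
    rw [integral_eq_lintegral_of_nonneg_ae (Eventually.of_forall (hz0 i)) (hzint i).1]
    exact ENNReal.toReal_le_of_le_ofReal hm0.le (hI.lintegral_one_add_sq_le hμ hn2 hi)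
  have iW : Integrable (fun ω => q * κ * (1 / n * ∑ i ∈ Finset.range n, (1 + nnZ μ ξ n i ω ^ 2)))
      P := ((integrable_finsetSum _ fun i _ => hzint i).const_mul _).const_mul _
  have iD : Integrable (fun ω => linDev P φ₁ φ₂ f θ₀ K ξ n ω) P :=
    hI.integrable_linDev hh.adm₁ hh.adm₂ hcoef n
  have iWD : Integrable (fun ω => q * κ * (1 / n * ∑ i ∈ Finset.range n,
      (1 + nnZ μ ξ n i ω ^ 2)) + linDev P φ₁ φ₂ f θ₀ K ξ n ω) P := iW.add iD
  have hEX : ∫ ω, X ω ∂P ≤ ε₀ * (η₀ / 2) := by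
    have hW : ∫ ω, q * κ * (1 / n * ∑ i ∈ Finset.range n, (1 + nnZ μ ξ n i ω ^ 2)) ∂P ≤
        q * κ * m := by
      rw [integral_const_mul, integral_const_mul, integral_finsetSum _ fun i _ => hzint i]
      gcongr
      calc 1 / (n : ℝ) * ∑ i ∈ Finset.range n, ∫ ω, (1 + nnZ μ ξ n i ω ^ 2) ∂P
          ≤ 1 / n * ∑ i ∈ Finset.range n, m := by
            gcongr with i hi
            exact hzm i (Finset.mem_range.1 hi)
        _ = m := by
            rw [Finset.sum_const, Finset.card_range, nsmul_eq_mul]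
            field_simp
    rw [hX, integral_add iWD (integrable_const _), integral_add iW iD, integral_const,
      probReal_univ, one_smul]
    rw [hAdef]
    linarith
  have hX0 : ∀ ω, 0 ≤ X ω := fun ω => by
    have := linDev_nonneg (P := P) (φ₁ := φ₁) (φ₂ := φ₂) (f := f) (θ₀ := θ₀) (K := K) (ξ := ξ) n ω
    have := Finset.sum_nonneg fun i (_ : i ∈ Finset.range n) => hz0 i ω
    simp only [hX]
    positivity
  have hXY : ∀ᵐ ω ∂P, ω ∉ B → supRatio P h f ξ K T (c n) n ω ≤ ENNReal.ofReal (X ω) := by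
    filter_upwards [ae_all_iff.2 fun i => hI.ae_nnDist_pos hμ hn2 i] with ω hω hωB
    refine iSup₂_le fun θ hθ => ENNReal.ofReal_le_ofReal ?_
    refine norm_score_sum_le hn0 (fun i => psiOn h f ξ K n i θ ω - psiOn h f ξ K n i (c n) ω)
      (fun i => scoreLin φ₁ φ₂ f θ₀ K ξ n i (θ - c n) ω)
      (∫ ω, scoreLin φ₁ φ₂ f θ₀ K ξ n 0 (θ - c n) ω ∂P) _ (norm_nonneg _) hA0
      (linDev_nonneg n ω) (by positivity) (fun i => hz0 i ω) (by have := he0 n; positivity)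
      (fun i hi => ?_) (hI.norm_mean_scoreLin_sub_le hh.adm₁ hh.adm₂ hcoef n _ ω)
      (norm_integral_scoreLin_sub_le hh hf hA2 hI hμ hK hcoef hC hκ0.le hp0.le (he0 n) hlim hreg₂
        hp hn2 (hTρ hθ) (hTρ hcT) (hint θ hθ) (hint _ hcT) (hfar θ hθ) (hfar _ hcT))
    refine norm_psiOn_sub_scoreLin_le hh hf hA2 hκ0.le hreg₂ hn0 (hω i) (fun hωK => ?_) (hTρ hθ)
      (hTρ hcT)
    by_contra hlt
    exact hωB (mem_iUnion₂.2 ⟨i, Finset.mem_range.2 hi, hωK, not_le.1 hlt⟩)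
  have hX' : Integrable X P := iWD.add (integrable_const _)
  refine (measure_lt_le_of_le_ofReal hε₀ hε₀ε hX' hX0 hEX hXY).trans ?_
  refine (add_le_add hPB le_rfl).trans ?_
  rw [← ENNReal.ofReal_add (by positivity) (by positivity), add_halves]
  exact hη₀η

end GMSP

/-- Here `c n` stands for `θ_0^{(n)}`: it may be any point of `Θ_n`, in particular the maximizer of
`E h(z_{i,n}(θ))`. -/
theorem proposition8 {Ω : Type*} [MeasurableSpace Ω] (P : Measure Ω) [IsProbabilityMeasure P]
    {q d : ℕ} (hd : 0 < d) (Θ Θ₀ : Set (E q)) (θ₀ : E q) (f : E q → E d → ℝ)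
    (hf : IsDensityFamily Θ f) (hA2 : AssumptionA2 Θ Θ₀ θ₀ f)
    (ξ : ℕ → Ω → E d) (hξ : IsIIDSample P ξ (f θ₀))
    (K : Set (E d)) (hK : IsCompact K) (hKpos : ∀ x ∈ K, 0 < f θ₀ x)
    (h : ℝ → ℝ) (hh : IsDivergence h) :
    (∃ (b₁ b₂ : ℝ) (m : ℝ → ℕ), ∀ (α : ℕ → ℝ) (c : ℕ → E q), IsShrinking θ₀ α c →
      ∀ A : Set Ω, IsUniformEvent ξ A → ∀ i : ℕ, ∀ᶠ n in atTop,
        -- the Lipschitz condition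
        (∀ ω, ∀ s ∈ Metric.closedBall θ₀ (α n), ∀ t ∈ Metric.closedBall θ₀ (α n),
          A.indicator (fun ω => ‖psiOn h f ξ K n i s ω - psiOn h f ξ K n i t ω‖ₑ) ω ≤
            envelope h f ξ K A (Metric.closedBall θ₀ (α n)) n i ω * ‖s - t‖ₑ) ∧
        -- the moments of the envelope
        AEMeasurable (envelope h f ξ K A (Metric.closedBall θ₀ (α n)) n i) P ∧
        ∫⁻ ω, envelope h f ξ K A (Metric.closedBall θ₀ (α n)) n i ω ∂P < ENNReal.ofReal b₁ ∧
        ∫⁻ ω, envelope h f ξ K A (Metric.closedBall θ₀ (α n)) n i ω ^ 2 ∂P < ENNReal.ofReal b₂ ∧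
        -- the bracketing condition
        (∀ δ > 0, ∀ r > 0, HasBrackets P
          (Metric.closedBall θ₀ (α n) ∩ Metric.closedBall (c n) r)
          (scoreDiff h f ξ K A n i (c n)) (m δ) (δ * r))) ∧
    -- the stochastic differentiability convergence
    (∀ (α : ℕ → ℝ) (c : ℕ → E q), IsShrinking θ₀ α c →
      (∀ᶠ n in atTop,
        (⨆ θ ∈ Metric.closedBall θ₀ (α n), ∫⁻ ω, ‖psiOn h f ξ K n 0 θ ω‖ₑ ∂P) < ∞) →
      ∀ ε > 0, Tendsto
        (fun n => P {ω | ε < supRatio P h f ξ K (Metric.closedBall θ₀ (α n)) (c n) n ω})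
        atTop (𝓝 0)) := by
  obtain ⟨φ₁, φ₂, hr⟩ := hh.exists_regular
  exact ⟨envelope_and_brackets hd hf hA2 hξ hK hKpos hr, fun α c hα hsup ε hε =>
    tendsto_measure_supRatio hd hf hA2 hξ hK hKpos hr hα hsup hε⟩
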